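/- **Setting.** Let $Q=[0,1)^3$, $Q'=[-\pi,\pi)^3$, $e_\kappa(y)=e^{i\kappa\cdot y}$, and let $C^\infty_\#$ be the smooth $\mathbb Z^3$-periodic (scalar or vector) functions on $\mathbb R^3$. Let $\mu$ be a $\mathbb Z^3$-periodic Borel measure on $\mathbb R^3$ with $\mu(Q)=1$ and $\int_Q\partial_j\varphi\,d\mu=0$ for all $\varphi\in C^\infty_\#$, $j=1,2,3$; let $C^\infty_{\#,0}$ be the scalar $\varphi\in C^\infty_\#$ with $\int_Q\varphi\,d\mu=0$. Let $A,\widetilde A$ be measurable, $\mathbb Z^3$-periodic, real symmetric $3\times3$ matrix functions, bounded and uniformly positive definite. All norms and integrals over $Q$ are with respect to $\mu$, and $a\cdot\overline b=\sum_i a_i\overline{b_i}$. *Spaces.* $H^1_{\mathrm{curl}A^{1/2},\kappa}$ is the closure in $L^2(Q,d\mu)^3\oplus L^2(Q,d\mu)^3$ of the pairs $(e_\kappa\phi,\mathrm{curl}(e_\kappa A^{1/2}\phi))$ with $A^{1/2}\phi\in C^\infty_\#$; its elements are written $(e_\kappa u,\mathrm{curl}(e_\kappa A^{1/2}u))$ (the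 second component need not be determined by the first). Likewise, $\psi\in H^1_{\#,0}$ with gradient $\nabla(e_\kappa\psi)$ means that $(e_\kappa\psi,\nabla(e_\kappa\psi))$ is an $L^2\oplus L^2$-limit of pairs $(e_\kappa\varphi,\nabla(e_\kappa\varphi))$ with $\varphi\in C^\infty_{\#,0}$. *Problem.* For $\varepsilon>0$, $\theta\in\varepsilon^{-1}Q'$, $\kappa=\varepsilon\theta$ and $G\in L^2(Q,d\mu)^3$ with $\int_Q e_\kappa G\cdot\overline{\nabla(e_\kappa\varphi)}\,d\mu=0$ for all $\varphi\in C^\infty_\#$, let $D^\varepsilon_\theta$ solve $\varepsilon^{-2}A^{1/2}\overline{e_\kappa}\,\mathrm{curl}\,\widetilde A\,\mathrm{curl}\,e_\kappa A^{1/2}D^\varepsilon_\theta+D^\varepsilon_\theta=-A^{1/2}G$, that is, $(e_\kappa D^\varepsilon_\theta,\mathrm{curl}(e_\kappa A^{1/2}D^\varepsilon_\theta))\in H^1_{\mathrm{curl}A^{1/2},\kappa}$ and $$\varepsilon^{-2}\int_Q\widetilde A\,\mathrm{curl}(e_\kappa A^{1/2}D^\varepsilon_\theta)\cdot\overline{\mathrm{curl}(e_\kappa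 A^{1/2}\phi)}\,d\mu+\int_Q D^\varepsilon_\theta\cdot\overline\phi\,d\mu=-\int_Q A^{1/2}G\cdot\overline\phi\,d\mu$$ for all $(e_\kappa\phi,\mathrm{curl}(e_\kappa A^{1/2}\phi))\in H^1_{\mathrm{curl}A^{1/2},\kappa}$. *Cell problems.* $\Psi_\kappa=(\Psi_{\kappa,1},\Psi_{\kappa,2},\Psi_{\kappa,3})$ has components in $H^1_{\#,0}$, with $\int_Q A^{-1}\bigl(\nabla(e_\kappa\Psi_{\kappa,j})+e_\kappa\mathbf e_j\bigr)\cdot\overline{\nabla(e_\kappa\varphi)}\,d\mu=0$ for all $\varphi\in C^\infty_{\#,0}$ and $j=1,2,3$; the matrix $\nabla(e_\kappa\Psi_\kappa)$ has columns $\nabla(e_\kappa\Psi_{\kappa,j})$. The matrix function $\widetilde N$ has columns $\widetilde N_j$ such that $(\widetilde N_j,\mathrm{curl}(A^{1/2}\widetilde N_j))\in H^1_{\mathrm{curl}A^{1/2},0}$, $\int_Q A^{-1/2}\widetilde N_j\cdot\overline{\nabla\varphi}\,d\mu=0$ for all $\varphi\in C^\infty_{\#,0}$, $\int_Q A^{1/2}\widetilde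 N_j\,d\mu=0$, and $\int_Q\widetilde A\bigl(\mathrm{curl}(A^{1/2}\widetilde N_j)+\mathbf e_j\bigr)\cdot\overline{\mathrm{curl}(A^{1/2}\phi)}\,d\mu=0$ for all $(\phi,\mathrm{curl}(A^{1/2}\phi))\in H^1_{\mathrm{curl}A^{1/2},0}$ with $\int_Q A^{1/2}\phi\,d\mu=0$. Put $$\widehat A^{\rm hom}_{\varepsilon\theta}=\int_Q A^{-1}\bigl(\overline{e_\kappa}\nabla(e_\kappa\Psi_\kappa)+I\bigr)d\mu,\qquad \widetilde A^{\rm hom}=\int_Q\widetilde A\bigl(\mathrm{curl}(A^{1/2}\widetilde N)+I\bigr)d\mu .$$ **Theorem.** The matrices $\widehat A^{\rm hom}_{\varepsilon\theta}$ and $i\theta\times\widetilde A^{\rm hom}\,i\theta\times(\widehat A^{\rm hom}_{\varepsilon\theta})^{-1}+I$ are invertible, and, with $$d^\varepsilon_\theta=-\bigl(\widehat A^{\rm hom}_{\varepsilon\theta}\bigr)^{-1}\Bigl(i\theta\times\widetilde A^{\rm hom}\,i\theta\times\bigl(\widehat A^{\rm hom}_{\varepsilon\theta}\bigr)^{-1}+I\Bigr)^{-1}\int_Q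 G\,d\mu,$$ there is a constant $C>0$, depending only on $\mu,A,\widetilde A$ (and not on $\varepsilon$, $\theta$, $G$), such that the transformed electric field $E^\varepsilon_\theta:=A^{1/2}D^\varepsilon_\theta$ satisfies $$\bigl\|E^\varepsilon_\theta-\bigl(\overline{e_\kappa}\nabla(e_\kappa\Psi_\kappa)+I\bigr)d^\varepsilon_\theta\bigr\|_{L^2(Q,d\mu)}\le C\,\varepsilon\,\|G\|_{L^2(Q,d\mu)}$$ for all $\varepsilon>0$, $\theta\in\varepsilon^{-1}Q'$ and all $G$ as above. -/

import Mathlib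

open MeasureTheory Filter Topology
open scoped ContDiff

namespace PerMaxwell

/-- Points of physical space `ℝ³`. -/
abbrev R3 := EuclideanSpace ℝ (Fin 3)

/-- Complex vectors, with the Euclidean norm. In `ℂ³`, `inner ℂ b a` is `a · conj b`. -/
abbrev C3 := EuclideanSpace ℂ (Fin 3)

/-- The unit cell `Q = [0,1)³`. -/
def cell : Set R3 := {x | ∀ i, 0 ≤ x i ∧ x i < 1}

/-- The dual cell `Q' = [-π,π)³`. -/
def dualCell : Set R3 := {k | ∀ i, -Real.pi ≤ k i ∧ k i < Real.pi}

/-- The point of the lattice `ℤ³` with coordinates `n`. -/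
def latticePt (n : Fin 3 → ℤ) : R3 := WithLp.toLp 2 (fun i => (n i : ℝ))

/-- `Q`-periodicity of a function on `ℝ³`. -/
def Periodic {β : Type*} (f : R3 → β) : Prop :=
  ∀ (n : Fin 3 → ℤ) (x : R3), f (x + latticePt n) = f x

/-- The class `C^∞_#(Q)`, for scalar or vector functions. -/
def SmoothPeriodic {F : Type*} [NormedAddCommGroup F] [NormedSpace ℝ F] (f : R3 → F) : Prop :=
  ContDiff ℝ ∞ f ∧ Periodic f

/-- The class `C^∞_{#,0}(Q)`: smooth periodic scalar functions with zero `μ`-mean over `Q`. -/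
def SmoothPeriodicZeroMean (μ : Measure R3) (f : R3 → ℂ) : Prop :=
  SmoothPeriodic f ∧ ∫ y in cell, f y ∂μ = 0

/-- The partial derivative `∂_j f`. -/
noncomputable def pderiv {F : Type*} [NormedAddCommGroup F] [NormedSpace ℝ F]
    (j : Fin 3) (f : R3 → F) (x : R3) : F :=
  fderiv ℝ f x (EuclideanSpace.single j 1)

/-- The gradient of a smooth scalar function. -/
noncomputable def grad (f : R3 → ℂ) (x : R3) : C3 := WithLp.toLp 2 (fun j => pderiv j f x)

/-- The curl of a smooth vector function. -/
noncomputable def curl (u : R3 → C3) (x : R3) : C3 :=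
  WithLp.toLp 2 ![pderiv 1 u x 2 - pderiv 2 u x 1,
    pderiv 2 u x 0 - pderiv 0 u x 2,
    pderiv 0 u x 1 - pderiv 1 u x 0]

/-- The exponential `e_κ(y) = exp(i κ·y)`. -/
noncomputable def expo (κ y : R3) : ℂ := Complex.exp (Complex.I * ((∑ i, κ i * y i : ℝ) : ℂ))

/-- The action of a real `3 × 3` matrix on a complex vector. -/
noncomputable def act (M : Matrix (Fin 3) (Fin 3) ℝ) (v : C3) : C3 :=
  WithLp.toLp 2 ((M.map (fun t : ℝ => (t : ℂ))).mulVec v.ofLp)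

/-- The positive square root `M^{1/2}` of a symmetric positive definite matrix. -/
noncomputable def msqrt (M : Matrix (Fin 3) (Fin 3) ℝ) : Matrix (Fin 3) (Fin 3) ℝ :=
  cfc Real.sqrt M

/-- Material coefficients: measurable, `Q`-periodic, real symmetric matrix functions that are
bounded and uniformly positive definite. -/
structure IsCoefficient (A : R3 → Matrix (Fin 3) (Fin 3) ℝ) : Prop where
  measurable : ∀ i j, Measurable (fun y => A y i j)
  periodic : Periodic A
  symm : ∀ y, (A y).IsSymm
  bounds : ∃ α β : ℝ, 0 < α ∧ ∀ (y : R3) (ξ : Fin 3 → ℝ),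
    α * dotProduct ξ ξ ≤ dotProduct ξ ((A y).mulVec ξ) ∧
      dotProduct ξ ((A y).mulVec ξ) ≤ β * dotProduct ξ ξ

/-- `Q`-periodic Borel measures on `ℝ³` with `μ(Q) = 1` for which the derivatives of smooth
periodic functions have zero mean. -/
structure IsAdmissible (μ : Measure R3) : Prop where
  periodic : ∀ n : Fin 3 → ℤ, μ.map (fun x => x + latticePt n) = μ
  mass : μ cell = 1
  grad_mean : ∀ φ : R3 → ℂ, SmoothPeriodic φ → ∀ j, ∫ y in cell, pderiv j φ y ∂μ = 0

/-- `(e_κ u, w)` belongs to `H¹_{curl A^{1/2},κ}(Q,dμ)`, the closure in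
`L²(Q,dμ) ⊕ L²(Q,dμ)` of the pairs `(e_κ φ, curl(e_κ A^{1/2} φ))` with `A^{1/2} φ ∈ C^∞_#(Q)`.
In other words, `w` is one of the curls `curl(e_κ A^{1/2} u)`. -/
def IsCurlPair (μ : Measure R3) (A : R3 → Matrix (Fin 3) (Fin 3) ℝ) (κ : R3)
    (u w : R3 → C3) : Prop :=
  MemLp u 2 (μ.restrict cell) ∧ MemLp w 2 (μ.restrict cell) ∧
  ∃ φ : ℕ → R3 → C3,
    (∀ n, SmoothPeriodic (fun y => act (msqrt (A y)) (φ n y))) ∧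
    Tendsto (fun n => eLpNorm (fun y => expo κ y • φ n y - expo κ y • u y) 2 (μ.restrict cell))
      atTop (𝓝 0) ∧
    Tendsto (fun n => eLpNorm
      (fun y => curl (fun x => expo κ x • act (msqrt (A x)) (φ n x)) y - w y) 2
      (μ.restrict cell)) atTop (𝓝 0)

/-- `ψ ∈ H¹_{#,0}(Q,dμ)` and `g` is a gradient `∇(e_κ ψ)`: the pair `(e_κ ψ, g)` is a limit in
`L²(Q,dμ) ⊕ L²(Q,dμ)` of pairs `(e_κ φ, ∇(e_κ φ))` with `φ ∈ C^∞_{#,0}(Q)`. -/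
def IsGradPair (μ : Measure R3) (κ : R3) (ψ : R3 → ℂ) (g : R3 → C3) : Prop :=
  MemLp ψ 2 (μ.restrict cell) ∧ MemLp g 2 (μ.restrict cell) ∧
  ∃ φ : ℕ → R3 → ℂ,
    (∀ n, SmoothPeriodicZeroMean μ (φ n)) ∧
    Tendsto (fun n => eLpNorm (fun y => expo κ y * φ n y - expo κ y * ψ y) 2 (μ.restrict cell))
      atTop (𝓝 0) ∧
    Tendsto (fun n => eLpNorm (fun y => grad (fun x => expo κ x * φ n x) y - g y) 2
      (μ.restrict cell)) atTop (𝓝 0)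

/-- `conj(e_κ) div(e_κ G) = 0` in the weak sense. -/
def IsDivFree (μ : Measure R3) (κ : R3) (G : R3 → C3) : Prop :=
  ∀ φ : R3 → ℂ, SmoothPeriodic φ →
    ∫ y in cell, inner ℂ (grad (fun x => expo κ x * φ x) y) (expo κ y • G y) ∂μ = 0

/-- `D`, with `w = curl(e_κ A^{1/2} D)`, solves
`ε⁻² A^{1/2} conj(e_κ) curl At curl e_κ A^{1/2} D + D = - A^{1/2} G`. -/
def IsMaxwellSolution (μ : Measure R3) (A At : R3 → Matrix (Fin 3) (Fin 3) ℝ) (ε : ℝ) (κ : R3)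
    (G D w : R3 → C3) : Prop :=
  IsCurlPair μ A κ D w ∧
  ∀ φ z : R3 → C3, IsCurlPair μ A κ φ z →
    ((ε ^ 2 : ℝ) : ℂ)⁻¹ * (∫ y in cell, inner ℂ (z y) (act (At y) (w y)) ∂μ)
      + ∫ y in cell, inner ℂ (φ y) (D y) ∂μ
      = - ∫ y in cell, inner ℂ (φ y) (act (msqrt (A y)) (G y)) ∂μ

/-- `Ψ = (Ψ_1, Ψ_2, Ψ_3) ∈ H¹_{#,0}`, with gradients `g_j = ∇(e_κ Ψ_j)`, solves
`conj(e_κ) div A⁻¹(∇(e_κ Ψ) + e_κ I) = 0`. -/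
def IsPsiSolution (μ : Measure R3) (A : R3 → Matrix (Fin 3) (Fin 3) ℝ) (κ : R3)
    (Ψ : Fin 3 → R3 → ℂ) (g : Fin 3 → R3 → C3) : Prop :=
  ∀ j, IsGradPair μ κ (Ψ j) (g j) ∧
    ∀ φ : R3 → ℂ, SmoothPeriodicZeroMean μ φ →
      ∫ y in cell, inner ℂ (grad (fun x => expo κ x * φ x) y) (act (A y)⁻¹ (g j y)) ∂μ
      = - ∫ y in cell, inner ℂ (grad (fun x => expo κ x * φ x) y)
          (act (A y)⁻¹ (expo κ y • (EuclideanSpace.single j 1 : C3))) ∂μ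

/-- The matrix with columns `N_j`, with curls `W_j = curl(A^{1/2} N_j)`, solves the cell problem
`A^{1/2} curl At curl A^{1/2} N = - A^{1/2} curl At`, `div A^{-1/2} N = 0`, `∫_Q A^{1/2} N = 0`. -/
def IsCurlCellSolution (μ : Measure R3) (A At : R3 → Matrix (Fin 3) (Fin 3) ℝ)
    (N W : Fin 3 → R3 → C3) : Prop :=
  ∀ j, IsCurlPair μ A 0 (N j) (W j) ∧
    (∀ φ : R3 → ℂ, SmoothPeriodicZeroMean μ φ →
      ∫ y in cell, inner ℂ (grad φ y) (act (msqrt (A y))⁻¹ (N j y)) ∂μ = 0) ∧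
    ∫ y in cell, act (msqrt (A y)) (N j y) ∂μ = 0 ∧
    ∀ φ z : R3 → C3, IsCurlPair μ A 0 φ z → ∫ y in cell, act (msqrt (A y)) (φ y) ∂μ = 0 →
      ∫ y in cell, inner ℂ (z y) (act (At y) (W j y)) ∂μ
      = - ∫ y in cell, inner ℂ (z y) (act (At y) (EuclideanSpace.single j 1 : C3)) ∂μ

/-- `∫_Q A⁻¹(conj(e_κ) ∇(e_κ Ψ) + I)`, where `g_j = ∇(e_κ Ψ_j)` gives the `j`-th column. -/
noncomputable def homHat (μ : Measure R3) (A : R3 → Matrix (Fin 3) (Fin 3) ℝ) (κ : R3)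
    (g : Fin 3 → R3 → C3) : Matrix (Fin 3) (Fin 3) ℂ :=
  Matrix.of fun i j => (∫ y in cell, act (A y)⁻¹
    (starRingEnd ℂ (expo κ y) • g j y + (EuclideanSpace.single j 1 : C3)) ∂μ) i

/-- `∫_Q At (curl A^{1/2} N + I)`, where `W_j = curl(A^{1/2} N_j)` gives the `j`-th column. -/
noncomputable def homTilde (μ : Measure R3) (At : R3 → Matrix (Fin 3) (Fin 3) ℝ)
    (W : Fin 3 → R3 → C3) : Matrix (Fin 3) (Fin 3) ℂ :=
  Matrix.of fun i j => (∫ y in cell, act (At y)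
    (W j y + (EuclideanSpace.single j 1 : C3)) ∂μ) i

/-- The matrix of the map `v ↦ iθ × v` on `ℂ³`. -/
noncomputable def crossI (θ : R3) : Matrix (Fin 3) (Fin 3) ℂ :=
  LinearMap.toMatrix' (crossProduct (fun j => Complex.I * ((θ j : ℝ) : ℂ)))

/-- The matrix `iθ × At^hom iθ × (A^hom)⁻¹ + I`. -/
noncomputable def effective (θ : R3) (Ahat Atil : Matrix (Fin 3) (Fin 3) ℂ) :
    Matrix (Fin 3) (Fin 3) ℂ :=
  crossI θ * Atil * crossI θ * Ahat⁻¹ + 1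

/-- `d = - (A^hom)⁻¹ (iθ × At^hom iθ × (A^hom)⁻¹ + I)⁻¹ ∫_Q G`. -/
noncomputable def dVec (μ : Measure R3) (θ : R3) (Ahat Atil : Matrix (Fin 3) (Fin 3) ℂ)
    (G : R3 → C3) : C3 :=
  WithLp.toLp 2 (-((Ahat⁻¹ * (effective θ Ahat Atil)⁻¹).mulVec (∫ y in cell, G y ∂μ).ofLp))

end PerMaxwell

/-! Put `V = A^{1/2} D` and `κ = εθ`, and conjugate by `e_κ`: gradient and curl become `∇ + iκ` and
`curl + iκ×`, and all the curl spaces reduce to a single graph closure `curlGraph` in `L² × L²`,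
independent of `κ` and `A`. The two-scale ansatz is `E₀ + εE₁` with `E₀ = (conj(e_κ)∇(e_κΨ) + I)d`,
`c = iθ × d` and `E₁ = A^{1/2}N c`. Shifted gradients have zero shifted curl, so the shifted curl of
the ansatz is `εF + ε² iθ × E₁`, where `F = curl(A^{1/2}N)c + c`. Because `Ã F` annihilates curls,
the term of order `ε⁻¹` drops to order one, and the remainder `Z = V - E₀ - εE₁`, with shifted curl
`s`, satisfies (`residual_identity`) `ε⁻²⟨Ãs, s⟩ + ⟨A⁻¹Z, Z⟩ = -⟨R, Z⟩ - ⟨Ã(iθ × E₁), s⟩ - ε⟨A⁻¹E₁,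
Z⟩`, with `R = G + A⁻¹E₀ + iθ × ÃF`.

The residual `R` is of order one, so `⟨R, Z⟩` has to be controlled by `‖s‖`, which carries the
weight `ε⁻²`, and not by `‖Z‖`. Two orthogonality relations permit this. The equation defining `d`
says exactly that `R` has zero mean (`residual_zero_mean`). The constraint on `G` and the two cell
problems make `R` orthogonal to the shifted gradients of zero-mean functions
(`residual_solenoidal`). The hypothesis on `μ` makes the Fourier modes orthonormal in `L²(Q, dμ)`.
For `n ≠ 0` and `ξ = κ + 2πn`, the coefficient `R_n` is orthogonal to `ξ`, hence `|ξ| |Z_n · R_n| ≤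
|iξ × Z_n| |R_n|`, where `iξ × Z_n` is the coefficient of `s` and `|ξ| ≥ π`; the mode `n = 0` is
absent from `R`. Summation gives `|⟨R, Z⟩| ≤ ‖s‖ ‖R‖` uniformly in `κ`
(`norm_inner_le_of_solenoidal`), and Young's inequality then gives `‖Z‖ ≤ Cε‖G‖`.

Since `θ` is unbounded, uniformity also needs `effective_bounds`: not only `‖d‖` and `‖c‖` but also
`‖θ‖ ‖c‖` is bounded by a multiple of `‖G‖`, and `θ` enters `R` and `iθ × E₁` only through that
product. -/

namespace PerMaxwell

/-! ### Matrices acting on complex vectors -/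

/-- The action of a complex `3 × 3` matrix on a complex vector. -/
noncomputable def cact (M : Matrix (Fin 3) (Fin 3) ℂ) (v : C3) : C3 :=
  WithLp.toLp 2 (M.mulVec v.ofLp)

lemma act_eq_cact (M : Matrix (Fin 3) (Fin 3) ℝ) (v : C3) :
    act M v = cact (M.map (fun t : ℝ => (t : ℂ))) v := rfl

lemma cact_add (M : Matrix (Fin 3) (Fin 3) ℂ) (u v : C3) :
    cact M (u + v) = cact M u + cact M v := by
  ext i; simp [cact, Matrix.mulVec_add]

lemma cact_smul (M : Matrix (Fin 3) (Fin 3) ℂ) (c : ℂ) (v : C3) :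
    cact M (c • v) = c • cact M v := by
  ext i; simp [cact, Matrix.mulVec_smul]

lemma cact_mul (M N : Matrix (Fin 3) (Fin 3) ℂ) (v : C3) :
    cact (M * N) v = cact M (cact N v) := by
  ext i; simp [cact, Matrix.mulVec_mulVec]

lemma add_cact (M N : Matrix (Fin 3) (Fin 3) ℂ) (v : C3) :
    cact (M + N) v = cact M v + cact N v := by
  ext i; simp [cact, Matrix.add_mulVec]

@[simp] lemma cact_one (v : C3) : cact 1 v = v := by
  ext i; simp [cact]

lemma inner_cact (M : Matrix (Fin 3) (Fin 3) ℂ) (u v : C3) :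
    inner ℂ (cact M u) v = inner ℂ u (cact M.conjTranspose v) := by
  simp only [PiLp.inner_apply, cact, Matrix.mulVec, dotProduct, Fin.sum_univ_three,
    RCLike.inner_apply, map_add, map_mul, Matrix.conjTranspose_apply, RCLike.star_def]
  ring

/-- The action of a real matrix, as a linear map. -/
noncomputable def actL (M : Matrix (Fin 3) (Fin 3) ℝ) : C3 →ₗ[ℂ] C3 where
  toFun := act M
  map_add' := cact_add _
  map_smul' := cact_smul _

@[simp] lemma actL_apply (M : Matrix (Fin 3) (Fin 3) ℝ) (v : C3) : actL M v = act M v := rfl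

lemma act_mul (M N : Matrix (Fin 3) (Fin 3) ℝ) (v : C3) :
    act (M * N) v = act M (act N v) := by
  rw [act_eq_cact, act_eq_cact, act_eq_cact, ← cact_mul]
  congr 1
  exact Matrix.map_mul (f := Complex.ofRealHom)

@[simp] lemma act_one (v : C3) : act 1 v = v := by
  rw [act_eq_cact, Matrix.map_one _ (by simp) (by simp), cact_one]

lemma inner_act {M : Matrix (Fin 3) (Fin 3) ℝ} (hM : M.IsSymm) (u v : C3) :
    inner ℂ (act M u) v = inner ℂ u (act M v) := by
  rw [act_eq_cact, act_eq_cact, inner_cact]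
  congr 2
  ext i j
  simp [Matrix.conjTranspose_apply, hM.apply i j]

lemma act_inv_act {M : Matrix (Fin 3) (Fin 3) ℝ} (hM : IsUnit M.det) (v : C3) :
    act M⁻¹ (act M v) = v := by
  rw [← act_mul, Matrix.nonsing_inv_mul _ hM, act_one]

lemma act_act_inv {M : Matrix (Fin 3) (Fin 3) ℝ} (hM : IsUnit M.det) (v : C3) :
    act M (act M⁻¹ v) = v := by
  rw [← act_mul, Matrix.mul_nonsing_inv _ hM, act_one]

/-- The quadratic form of a real symmetric matrix at a complex vector. -/
lemma re_inner_act (M : Matrix (Fin 3) (Fin 3) ℝ) (v : C3) :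
    (inner ℂ v (act M v)).re =
      dotProduct (fun i => (v i).re) (M.mulVec fun i => (v i).re) +
        dotProduct (fun i => (v i).im) (M.mulVec fun i => (v i).im) := by
  simp only [PiLp.inner_apply, act, Matrix.mulVec, dotProduct, Fin.sum_univ_three,
    RCLike.inner_apply, Matrix.map_apply, Complex.add_re, Complex.mul_re, Complex.mul_im,
    Complex.add_im, Complex.ofReal_re, Complex.ofReal_im, Complex.conj_re, Complex.conj_im]
  ring

lemma norm_sq_eq_dotProduct (v : C3) :
    ‖v‖ ^ 2 = dotProduct (fun i => (v i).re) (fun i => (v i).re) +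
        dotProduct (fun i => (v i).im) (fun i => (v i).im) := by
  simp only [EuclideanSpace.norm_sq_eq, ← Complex.normSq_eq_norm_sq, Complex.normSq_apply,
    dotProduct, Fin.sum_univ_three]
  ring

/-! ### Square roots -/

open scoped MatrixOrder in
lemma msqrt_eq_sqrt {M : Matrix (Fin 3) (Fin 3) ℝ} (hM : M.PosSemidef) :
    msqrt M = CFC.sqrt M := by
  rw [msqrt, CFC.sqrt_eq_real_sqrt M hM.nonneg, cfcₙ_eq_cfc]

open scoped MatrixOrder in
lemma msqrt_posSemidef {M : Matrix (Fin 3) (Fin 3) ℝ} (hM : M.PosSemidef) :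
    (msqrt M).PosSemidef := by
  rw [msqrt_eq_sqrt hM]
  exact Matrix.nonneg_iff_posSemidef.1 (CFC.sqrt_nonneg M)

open scoped MatrixOrder in
lemma msqrt_mul_self {M : Matrix (Fin 3) (Fin 3) ℝ} (hM : M.PosSemidef) :
    msqrt M * msqrt M = M := by
  rw [msqrt_eq_sqrt hM, CFC.sqrt_mul_sqrt_self M hM.nonneg]

open scoped MatrixOrder in
lemma eq_msqrt {M S : Matrix (Fin 3) (Fin 3) ℝ} (hS : S.PosSemidef) (h : S * S = M) :
    msqrt M = S := by
  have hM : M.PosSemidef := by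
    have := Matrix.posSemidef_conjTranspose_mul_self S
    rwa [hS.isHermitian.eq, h] at this
  rw [msqrt_eq_sqrt hM, CFC.sqrt_unique h hS.nonneg]

/-- The set is cut out by closed conditions: symmetry and one weak inequality per test vector. It
serves as the Borel domain in the proof of `measurable_msqrt`. -/
lemma isClosed_posSemidef :
    IsClosed {S : Fin 3 → Fin 3 → ℝ | (Matrix.of S).PosSemidef} := by
  have : {S : Fin 3 → Fin 3 → ℝ | (Matrix.of S).PosSemidef} =
      {S | ∀ i j, S j i = S i j} ∩
        ⋂ x : Fin 3 → ℝ, {S | 0 ≤ dotProduct x ((Matrix.of S).mulVec x)} := by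
    ext S
    simp only [Matrix.posSemidef_iff_dotProduct_mulVec, Matrix.IsHermitian, ← Matrix.ext_iff,
      Matrix.conjTranspose_apply, Matrix.of_apply, star_trivial, Set.mem_inter_iff, Set.mem_iInter,
      Set.mem_ofPred_eq]
  rw [this]
  refine IsClosed.inter ?_ (isClosed_iInter fun x => ?_)
  · simp only [Set.ofPred_forall]
    refine isClosed_iInter fun i => isClosed_iInter fun j => isClosed_eq ?_ ?_ <;> fun_prop
  · refine isClosed_le continuous_const ?_
    simp only [dotProduct, Matrix.mulVec, Matrix.of_apply]
    fun_prop

/-- By the Lusin–Souslin theorem, squaring, which is continuous and injective on the cone `P` of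
positive semidefinite matrices, maps Borel subsets of `P` to Borel sets. The preimage of `T` under
the root of `A` is the preimage under `A` of the squares of `T ∩ P`. -/
lemma measurable_msqrt {A : R3 → Matrix (Fin 3) (Fin 3) ℝ}
    (hA : ∀ i j, Measurable fun y => A y i j) (hp : ∀ y, (A y).PosSemidef) (i j : Fin 3) :
    Measurable fun y => msqrt (A y) i j := by
  set P : Set (Fin 3 → Fin 3 → ℝ) := {S | (Matrix.of S).PosSemidef}
  set sq : (Fin 3 → Fin 3 → ℝ) → Fin 3 → Fin 3 → ℝ := fun S => Matrix.of S * Matrix.of S with hsq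
  have hc : Continuous sq := by
    refine continuous_pi fun a => continuous_pi fun b => ?_
    simp only [hsq, Matrix.mul_apply, Matrix.of_apply]
    fun_prop
  have hinj : Set.InjOn sq P := fun S hS T hT h => by
    have h1 : msqrt (Matrix.of S * Matrix.of S) = Matrix.of S := eq_msqrt hS rfl
    have h2 : msqrt (Matrix.of T * Matrix.of T) = Matrix.of T := eq_msqrt hT rfl
    have h3 : (Matrix.of S * Matrix.of S : Matrix (Fin 3) (Fin 3) ℝ)
      = Matrix.of T * Matrix.of T := h
    rw [h3, h2] at h1
    exact h1.symm
  have hA' : Measurable fun y => (fun a b => A y a b : Fin 3 → Fin 3 → ℝ) :=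
    measurable_pi_lambda _ fun a => measurable_pi_lambda _ fun b => hA a b
  have : Measurable fun y => (fun a b => msqrt (A y) a b : Fin 3 → Fin 3 → ℝ) := by
    intro T hT
    have himg := (hT.inter isClosed_posSemidef.measurableSet).image_of_continuousOn_injOn
      hc.continuousOn (hinj.mono Set.inter_subset_right)
    convert! hA' himg using 1
    ext y
    simp only [Set.mem_preimage, Set.mem_image, Set.mem_inter_iff]
    constructor
    · intro h
      exact ⟨_, ⟨h, msqrt_posSemidef (hp y)⟩, msqrt_mul_self (hp y)⟩
    · rintro ⟨S, ⟨hS, hS'⟩, h⟩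
      have : msqrt (A y) = Matrix.of S := eq_msqrt hS' h
      rw [this]
      exact hS
  exact (measurable_pi_apply j).comp ((measurable_pi_apply i).comp this)

lemma measurable_matrix_inv {A : R3 → Matrix (Fin 3) (Fin 3) ℝ}
    (hA : ∀ i j, Measurable fun y => A y i j) (i j : Fin 3) :
    Measurable fun y => (A y)⁻¹ i j := by
  have hdet : ∀ B : R3 → Matrix (Fin 3) (Fin 3) ℝ, (∀ i j, Measurable fun y => B y i j) →
      Measurable fun y => (B y).det := by
    intro B hB
    simp only [Matrix.det_fin_three]
    have := hB
    fun_prop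
  simp only [Matrix.inv_def, Matrix.smul_apply, Ring.inverse_eq_inv', smul_eq_mul,
    Matrix.adjugate_apply]
  refine (hdet A hA).inv.mul (hdet _ fun a b => ?_)
  by_cases h : a = j
  · subst h; simp
  · simpa [Matrix.updateRow_ne h] using hA a b

/-! ### Coefficients -/

/-- The pointwise facts about coefficient matrices with ellipticity constants `α ≤ β`. -/
structure Elliptic (A : R3 → Matrix (Fin 3) (Fin 3) ℝ) (α β : ℝ) : Prop where
  pos : 0 < α
  pos' : 0 < β
  symm : ∀ y, (A y).IsSymm
  lower : ∀ y v, α * ‖v‖ ^ 2 ≤ (inner ℂ v (act (A y) v)).re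
  upper : ∀ y v, (inner ℂ v (act (A y) v)).re ≤ β * ‖v‖ ^ 2
  measurable : ∀ i j, Measurable fun y => A y i j

lemma IsCoefficient.exists_elliptic {A : R3 → Matrix (Fin 3) (Fin 3) ℝ} (hA : IsCoefficient A) :
    ∃ α β, Elliptic A α β := by
  obtain ⟨α, β, hα, h⟩ := hA.bounds
  -- Positivity of `β` is not part of the bounds; comparing both at one unit vector gives `α ≤ β`.
  have hβ : 0 < β := by
    have h1 := h 0 (Pi.single 0 1)
    have h2 : dotProduct (Pi.single 0 1 : Fin 3 → ℝ) (Pi.single 0 1) = 1 := by simp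
    rw [h2] at h1
    linarith [h1.1, h1.2]
  refine ⟨α, β, hα, hβ, hA.symm, fun y v => ?_, fun y v => ?_, hA.measurable⟩
  · rw [re_inner_act, norm_sq_eq_dotProduct, mul_add]
    exact add_le_add (h y _).1 (h y _).1
  · rw [re_inner_act, norm_sq_eq_dotProduct, mul_add]
    exact add_le_add (h y _).2 (h y _).2

namespace Elliptic

variable {A : R3 → Matrix (Fin 3) (Fin 3) ℝ} {α β : ℝ} (h : Elliptic A α β)
include h

lemma posSemidef (y : R3) : (A y).PosSemidef := by
  refine Matrix.PosSemidef.of_dotProduct_mulVec_nonneg (h.symm y) fun x => ?_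
  have h1 := h.lower y (WithLp.toLp 2 fun i => (x i : ℂ))
  rw [re_inner_act] at h1
  simp only [Complex.ofReal_re, Complex.ofReal_im] at h1
  have h0 : dotProduct (fun _ : Fin 3 => (0 : ℝ)) ((A y).mulVec fun _ => 0) = 0 :=
    zero_dotProduct _
  rw [h0, add_zero] at h1
  exact (mul_nonneg h.pos.le (sq_nonneg _)).trans h1

lemma msqrt_symm (y : R3) : (msqrt (A y)).IsSymm := by
  have := (msqrt_posSemidef (h.posSemidef y)).isHermitian
  rwa [Matrix.IsHermitian, Matrix.conjTranspose_eq_transpose_of_trivial] at this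

lemma act_msqrt_msqrt (y : R3) (v : C3) : act (msqrt (A y)) (act (msqrt (A y)) v) = act (A y) v := by
  rw [← act_mul, msqrt_mul_self (h.posSemidef y)]

lemma isUnit_det (y : R3) : IsUnit (A y).det := by
  rw [isUnit_iff_ne_zero]
  intro h0
  obtain ⟨x, hx, hx'⟩ := Matrix.exists_mulVec_eq_zero_iff.2 h0
  have h1 := h.lower y (WithLp.toLp 2 fun i => (x i : ℂ))
  rw [re_inner_act] at h1
  simp only [Complex.ofReal_re, Complex.ofReal_im] at h1
  have h0 : dotProduct (fun _ : Fin 3 => (0 : ℝ)) ((A y).mulVec fun _ => 0) = 0 :=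
    zero_dotProduct _
  rw [h0, add_zero, hx', dotProduct_zero] at h1
  have h2 : ‖(WithLp.toLp 2 fun i => (x i : ℂ) : C3)‖ = 0 := by
    have := h.pos
    have h3 : ‖(WithLp.toLp 2 fun i => (x i : ℂ) : C3)‖ ^ 2 ≤ 0 := by nlinarith
    exact pow_eq_zero_iff two_ne_zero |>.1 (le_antisymm h3 (sq_nonneg _))
  rw [norm_eq_zero] at h2
  apply hx
  ext i
  have := congrArg (fun v : C3 => v i) h2
  simpa using this

lemma isUnit_det_msqrt (y : R3) : IsUnit (msqrt (A y)).det := by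
  have := h.isUnit_det y
  rw [← msqrt_mul_self (h.posSemidef y), Matrix.det_mul] at this
  exact isUnit_of_mul_isUnit_left this

lemma norm_act_msqrt_sq (y : R3) (v : C3) :
    ‖act (msqrt (A y)) v‖ ^ 2 = (inner ℂ v (act (A y) v)).re := by
  rw [← h.act_msqrt_msqrt, ← inner_act (h.msqrt_symm y), ← RCLike.re_eq_complex_re,
    inner_self_eq_norm_sq]

lemma norm_act_msqrt_le (y : R3) (v : C3) : ‖act (msqrt (A y)) v‖ ≤ √β * ‖v‖ := by
  refine abs_le_of_sq_le_sq' ?_ (by positivity) |>.2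
  rw [mul_pow, Real.sq_sqrt h.pos'.le, h.norm_act_msqrt_sq]
  exact h.upper y v

lemma norm_act_le (y : R3) (v : C3) : ‖act (A y) v‖ ≤ β * ‖v‖ := by
  rw [← h.act_msqrt_msqrt]
  refine (h.norm_act_msqrt_le y _).trans ?_
  have := mul_le_mul_of_nonneg_left (h.norm_act_msqrt_le y v) (Real.sqrt_nonneg β)
  rwa [← mul_assoc, Real.mul_self_sqrt h.pos'.le] at this

lemma msqrt_inv_symm (y : R3) : ((msqrt (A y))⁻¹).IsSymm := by
  rw [Matrix.IsSymm, Matrix.transpose_nonsing_inv, h.msqrt_symm y]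

lemma act_msqrt_inv_inv (y : R3) (v : C3) :
    act (msqrt (A y))⁻¹ (act (msqrt (A y))⁻¹ v) = act (A y)⁻¹ v := by
  rw [← act_mul, ← Matrix.mul_inv_rev, msqrt_mul_self (h.posSemidef y)]

lemma norm_act_inv_le (y : R3) (v : C3) : ‖act (A y)⁻¹ v‖ ≤ α⁻¹ * ‖v‖ := by
  set u := act (A y)⁻¹ v with hu
  have hv : act (A y) u = v := act_act_inv (h.isUnit_det y) v
  have h1 := h.lower y u
  rw [hv] at h1
  have h2 : (inner ℂ u v).re ≤ ‖u‖ * ‖v‖ := re_inner_le_norm (𝕜 := ℂ) u v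
  have hα := h.pos
  rw [inv_mul_eq_div, le_div_iff₀ hα]
  rcases (norm_nonneg u).eq_or_lt with h0 | h0
  · rw [← h0]; simp
  · have : ‖u‖ * (α * ‖u‖) ≤ ‖u‖ * ‖v‖ := by nlinarith
    have := le_of_mul_le_mul_left this h0
    linarith

/-- With `v = A^{1/2}u`, the form of `A⁻¹` at `v` equals `‖u‖²`, while `‖v‖² ≤ β‖u‖²`. -/
lemma inv_lower (y : R3) (v : C3) : β⁻¹ * ‖v‖ ^ 2 ≤ (inner ℂ v (act (A y)⁻¹ v)).re := by
  set u := act (msqrt (A y))⁻¹ v with hu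
  have hv : act (msqrt (A y)) u = v := act_act_inv (h.isUnit_det_msqrt y) v
  have h1 := h.norm_act_msqrt_le y u
  rw [hv] at h1
  have h2 : (inner ℂ v (act (A y)⁻¹ v)).re = ‖u‖ ^ 2 := by
    rw [← h.act_msqrt_inv_inv, ← inner_act (h.msqrt_inv_symm y), ← RCLike.re_eq_complex_re,
      inner_self_eq_norm_sq]
  rw [h2, inv_mul_le_iff₀ h.pos', ← Real.sq_sqrt h.pos'.le, ← mul_pow]
  gcongr

lemma norm_act_msqrt_inv_le (y : R3) (v : C3) : ‖act (msqrt (A y))⁻¹ v‖ ≤ √α⁻¹ * ‖v‖ := by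
  set u := act (msqrt (A y))⁻¹ v with hu
  have hv : act (msqrt (A y)) u = v := act_act_inv (h.isUnit_det_msqrt y) v
  refine abs_le_of_sq_le_sq' ?_ (by positivity) |>.2
  rw [mul_pow, Real.sq_sqrt (inv_pos.2 h.pos).le, ← hv, h.norm_act_msqrt_sq,
    inv_mul_eq_div, le_div_iff₀ h.pos, mul_comm]
  exact h.lower y u

lemma measurable_msqrt (i j : Fin 3) : Measurable fun y => msqrt (A y) i j :=
  PerMaxwell.measurable_msqrt h.measurable h.posSemidef i j

lemma measurable_inv (i j : Fin 3) : Measurable fun y => (A y)⁻¹ i j :=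
  measurable_matrix_inv h.measurable i j

lemma measurable_msqrt_inv (i j : Fin 3) : Measurable fun y => (msqrt (A y))⁻¹ i j :=
  measurable_matrix_inv h.measurable_msqrt i j

end Elliptic

/-! ### Cross products with an imaginary vector -/

/-- The complex vector `iκ`. -/
noncomputable def iVec (κ : R3) : C3 := WithLp.toLp 2 fun j => Complex.I * ((κ j : ℝ) : ℂ)

@[simp] lemma iVec_apply (κ : R3) (j : Fin 3) : iVec κ j = Complex.I * ((κ j : ℝ) : ℂ) := rfl

lemma cact_crossI (κ : R3) (v : C3) :
    cact (crossI κ) v = WithLp.toLp 2 ![Complex.I * κ 1 * v 2 - Complex.I * κ 2 * v 1,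
      Complex.I * κ 2 * v 0 - Complex.I * κ 0 * v 2,
      Complex.I * κ 0 * v 1 - Complex.I * κ 1 * v 0] := by
  rw [cact, crossI, ← Matrix.toLin'_apply, Matrix.toLin'_toMatrix', cross_apply]

/-- The real cross-product matrix is skew-symmetric and the factor `i` makes it Hermitian. This is
what lets `iκ×` move across inner products throughout. -/
lemma crossI_conjTranspose (κ : R3) : (crossI κ).conjTranspose = crossI κ := by
  ext i j
  fin_cases i <;> fin_cases j <;>
    simp [crossI, LinearMap.toMatrix'_apply, cross_apply, Matrix.conjTranspose_apply]

lemma inner_crossI (κ : R3) (u v : C3) :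
    inner ℂ (cact (crossI κ) u) v = inner ℂ u (cact (crossI κ) v) := by
  rw [inner_cact, crossI_conjTranspose]

lemma crossI_smul (c : ℝ) (κ : R3) (v : C3) :
    cact (crossI (c • κ)) v = (c : ℂ) • cact (crossI κ) v := by
  ext i
  fin_cases i <;> simp [cact_crossI] <;> ring

lemma crossI_iVec_smul (c : ℝ) (κ : R3) : cact (crossI κ) (iVec (c • κ)) = 0 := by
  ext i
  fin_cases i <;> simp [cact_crossI] <;> ring

/-- Lagrange's identity for vectors orthogonal to `ξ`. -/
lemma norm_crossI_of_orthogonal {ξ : R3} {v : C3} (h : inner ℂ (iVec ξ) v = 0) :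
    ‖cact (crossI ξ) v‖ = ‖ξ‖ * ‖v‖ := by
  have h' : (ξ 0 : ℂ) * v 0 + ξ 1 * v 1 + ξ 2 * v 2 = 0 := by
    simp only [PiLp.inner_apply, Fin.sum_univ_three, iVec_apply, RCLike.inner_apply, map_mul,
      Complex.conj_I, Complex.conj_ofReal] at h
    have : Complex.I * ((ξ 0 : ℂ) * v 0 + ξ 1 * v 1 + ξ 2 * v 2) = 0 := by linear_combination -h
    simpa using this
  have hr : ξ 0 * (v 0).re + ξ 1 * (v 1).re + ξ 2 * (v 2).re = 0 := by
    simpa using congrArg Complex.re h'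
  have hi : ξ 0 * (v 0).im + ξ 1 * (v 1).im + ξ 2 * (v 2).im = 0 := by
    simpa using congrArg Complex.im h'
  have hsq : ‖cact (crossI ξ) v‖ ^ 2 = (‖ξ‖ * ‖v‖) ^ 2 := by
    rw [mul_pow]
    simp only [EuclideanSpace.norm_sq_eq, ← Complex.normSq_eq_norm_sq, Complex.normSq_apply,
      Fin.sum_univ_three, cact_crossI, Real.norm_eq_abs, sq_abs, Matrix.cons_val_zero,
      Matrix.cons_val_one, Matrix.cons_val]
    simp
    linear_combination (-(ξ 0 * (v 0).re + ξ 1 * (v 1).re + ξ 2 * (v 2).re)) * hr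
      - (ξ 0 * (v 0).im + ξ 1 * (v 1).im + ξ 2 * (v 2).im) * hi
  exact (sq_eq_sq₀ (norm_nonneg _) (by positivity)).1 hsq

/-- The double cross product is `iξ × (iξ × v) = |ξ|²v - (ξ·v)ξ`, and the last term vanishes. -/
lemma crossI_crossI_of_orthogonal {ξ : R3} {v : C3} (h : inner ℂ (iVec ξ) v = 0) :
    cact (crossI ξ) (cact (crossI ξ) v) = ((‖ξ‖ ^ 2 : ℝ) : ℂ) • v := by
  have h' : (ξ 0 : ℂ) * v 0 + ξ 1 * v 1 + ξ 2 * v 2 = 0 := by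
    simp only [PiLp.inner_apply, Fin.sum_univ_three, iVec_apply, RCLike.inner_apply, map_mul,
      Complex.conj_I, Complex.conj_ofReal] at h
    have : Complex.I * ((ξ 0 : ℂ) * v 0 + ξ 1 * v 1 + ξ 2 * v 2) = 0 := by linear_combination -h
    simpa using this
  ext i
  rw [EuclideanSpace.norm_sq_eq]
  fin_cases i <;> simp [cact_crossI, Fin.sum_univ_three]
  · linear_combination (-ξ 0 : ℂ) * h' + (ξ 0 * ξ 1 * v 1 - ξ 1 ^ 2 * v 0 + ξ 0 * ξ 2 * v 2 - ξ 2 ^ 2 * v 0) * Complex.I_sq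
  · linear_combination (-ξ 1 : ℂ) * h' + (ξ 1 * ξ 0 * v 0 - ξ 0 ^ 2 * v 1 + ξ 1 * ξ 2 * v 2 - ξ 2 ^ 2 * v 1) * Complex.I_sq
  · linear_combination (-ξ 2 : ℂ) * h' + (ξ 2 * ξ 0 * v 0 - ξ 0 ^ 2 * v 2 + ξ 2 * ξ 1 * v 1 - ξ 1 ^ 2 * v 2) * Complex.I_sq

/-- If `v ⊥ ξ` then `|ξ| |u · v| ≤ |ξ × u| |v|`. -/
lemma norm_inner_le_crossI {ξ : R3} {v : C3} (h : inner ℂ (iVec ξ) v = 0) (u : C3) :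
    ‖ξ‖ * ‖inner ℂ u v‖ ≤ ‖cact (crossI ξ) u‖ * ‖v‖ := by
  rcases (norm_nonneg ξ).eq_or_lt with h0 | h0
  · rw [← h0, zero_mul]; positivity
  have h1 : inner ℂ (cact (crossI ξ) u) (cact (crossI ξ) v) = ((‖ξ‖ ^ 2 : ℝ) : ℂ) * inner ℂ u v := by
    rw [inner_crossI, crossI_crossI_of_orthogonal h, inner_smul_right]
  have h2 := norm_inner_le_norm (𝕜 := ℂ) (cact (crossI ξ) u) (cact (crossI ξ) v)
  rw [h1, norm_crossI_of_orthogonal h, norm_mul, Complex.norm_real, Real.norm_of_nonneg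
    (sq_nonneg _)] at h2
  refine le_of_mul_le_mul_left ?_ h0
  linarith

/-! ### Derivatives of smooth periodic functions -/

section Smooth

variable {F : Type*} [NormedAddCommGroup F] [NormedSpace ℝ F]

lemma SmoothPeriodic.differentiable {f : R3 → F} (hf : SmoothPeriodic f) : Differentiable ℝ f :=
  hf.1.differentiable (by simp)

lemma SmoothPeriodic.const (a : F) : SmoothPeriodic fun _ : R3 => a :=
  ⟨contDiff_const, fun _ _ => rfl⟩

lemma SmoothPeriodic.pderiv {f : R3 → F} (hf : SmoothPeriodic f) (j : Fin 3) :
    SmoothPeriodic (pderiv j f) := by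
  refine ⟨(hf.1.fderiv_right (m := ∞) (by simp)).clm_apply contDiff_const, fun n x => ?_⟩
  have : f = fun x => f (x + latticePt n) := funext fun x => (hf.2 n x).symm
  unfold PerMaxwell.pderiv
  conv_rhs => rw [this]
  rw [fderiv_comp_add_right]

lemma SmoothPeriodic.add {f g : R3 → F} (hf : SmoothPeriodic f) (hg : SmoothPeriodic g) :
    SmoothPeriodic fun x => f x + g x :=
  ⟨hf.1.add hg.1, fun n x => by simp only [hf.2 n x, hg.2 n x]⟩

lemma SmoothPeriodic.sub {f g : R3 → F} (hf : SmoothPeriodic f) (hg : SmoothPeriodic g) :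
    SmoothPeriodic fun x => f x - g x :=
  ⟨hf.1.sub hg.1, fun n x => by simp only [hf.2 n x, hg.2 n x]⟩

lemma SmoothPeriodic.smul [NormedSpace ℂ F] {f : R3 → ℂ} {g : R3 → F}
    (hf : SmoothPeriodic f) (hg : SmoothPeriodic g) : SmoothPeriodic fun x => f x • g x :=
  ⟨hf.1.smul hg.1, fun n x => by simp only [hf.2 n x, hg.2 n x]⟩

lemma SmoothPeriodic.comp_clm {G : Type*} [NormedAddCommGroup G] [NormedSpace ℝ G]
    {f : R3 → F} (hf : SmoothPeriodic f) (L : F →L[ℝ] G) : SmoothPeriodic fun x => L (f x) :=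
  ⟨L.contDiff.comp hf.1, fun n x => by simp only [hf.2 n x]⟩

lemma SmoothPeriodic.apply {u : R3 → C3} (hu : SmoothPeriodic u) (k : Fin 3) :
    SmoothPeriodic fun x => u x k :=
  hu.comp_clm ((EuclideanSpace.proj (𝕜 := ℂ) k).restrictScalars ℝ)

lemma smoothPeriodic_toLp {u : R3 → Fin 3 → ℂ} (hu : ∀ k, SmoothPeriodic fun x => u x k) :
    SmoothPeriodic fun x => (WithLp.toLp 2 (u x) : C3) := by
  refine ⟨(PiLp.continuousLinearEquiv 2 ℝ fun _ : Fin 3 => ℂ).symm.contDiff.comp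
    (contDiff_pi.2 fun k => (hu k).1), fun n x => ?_⟩
  exact congrArg (WithLp.toLp 2) (funext fun k => (hu k).2 n x)

lemma pderiv_apply {u : R3 → C3} {x : R3} (hu : DifferentiableAt ℝ u x) (j k : Fin 3) :
    pderiv j u x k = pderiv j (fun x => u x k) x := by
  have := (((EuclideanSpace.proj (𝕜 := ℂ) k : C3 →L[ℂ] ℂ).restrictScalars ℝ).hasFDerivAt.comp x
    hu.hasFDerivAt).fderiv
  unfold pderiv
  erw [this]
  rfl

lemma pderiv_smul [NormedSpace ℂ F] {f : R3 → ℂ} {g : R3 → F} {x : R3}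
    (hf : DifferentiableAt ℝ f x) (hg : DifferentiableAt ℝ g x) (j : Fin 3) :
    pderiv j (fun x => f x • g x) x = f x • pderiv j g x + pderiv j f x • g x := by
  unfold pderiv
  rw [fderiv_fun_smul hf hg]
  simp

lemma pderiv_mul {f g : R3 → ℂ} {x : R3}
    (hf : DifferentiableAt ℝ f x) (hg : DifferentiableAt ℝ g x) (j : Fin 3) :
    pderiv j (fun x => f x * g x) x = f x * pderiv j g x + pderiv j f x * g x :=
  pderiv_smul hf hg j

lemma pderiv_add {f g : R3 → F} {x : R3}
    (hf : DifferentiableAt ℝ f x) (hg : DifferentiableAt ℝ g x) (j : Fin 3) :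
    pderiv j (fun x => f x + g x) x = pderiv j f x + pderiv j g x := by
  unfold pderiv
  rw [fderiv_fun_add hf hg]
  simp

@[simp] lemma pderiv_const (a : F) (x : R3) (j : Fin 3) : pderiv j (fun _ => a) x = 0 := by
  simp [pderiv]

end Smooth

lemma SmoothPeriodic.grad {φ : R3 → ℂ} (hφ : SmoothPeriodic φ) : SmoothPeriodic (grad φ) :=
  smoothPeriodic_toLp fun k => hφ.pderiv k

lemma SmoothPeriodic.curl {u : R3 → C3} (hu : SmoothPeriodic u) : SmoothPeriodic (curl u) := by
  refine smoothPeriodic_toLp fun k => ?_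
  fin_cases k
  · exact ((hu.pderiv 1).apply 2).sub ((hu.pderiv 2).apply 1)
  · exact ((hu.pderiv 2).apply 0).sub ((hu.pderiv 0).apply 2)
  · exact ((hu.pderiv 0).apply 1).sub ((hu.pderiv 1).apply 0)

/-! ### Exponentials -/

lemma contDiff_expo (κ : R3) : ContDiff ℝ ∞ (expo κ) := by
  have h : ContDiff ℝ ∞ fun y : R3 => ∑ i, κ i * y i := ContDiff.sum fun i _ =>
    contDiff_const.mul (EuclideanSpace.proj (𝕜 := ℝ) i : R3 →L[ℝ] ℝ).contDiff
  exact Complex.contDiff_exp.comp (contDiff_const.mul (Complex.ofRealCLM.contDiff.comp h))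

lemma norm_expo (κ y : R3) : ‖expo κ y‖ = 1 := by
  rw [expo, mul_comm, Complex.norm_exp_ofReal_mul_I]

lemma conj_expo_mul (κ y : R3) : (starRingEnd ℂ) (expo κ y) * expo κ y = 1 := by
  rw [mul_comm, Complex.mul_conj, Complex.normSq_eq_norm_sq, norm_expo]; simp

lemma expo_mul_conj (κ y : R3) : expo κ y * (starRingEnd ℂ) (expo κ y) = 1 := by
  rw [mul_comm, conj_expo_mul]

@[simp] lemma expo_zero (y : R3) : expo 0 y = 1 := by simp [expo]

lemma pderiv_expo (κ y : R3) (j : Fin 3) :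
    pderiv j (expo κ) y = Complex.I * κ j * expo κ y := by
  have h : HasFDerivAt (expo κ) (expo κ y • (Complex.I •
      Complex.ofRealCLM.comp (∑ i, κ i • (EuclideanSpace.proj (𝕜 := ℝ) i : R3 →L[ℝ] ℝ)))) y := by
    have h1 : HasFDerivAt (fun y : R3 => (∑ i, κ i * y i : ℝ))
        (∑ i, κ i • (EuclideanSpace.proj (𝕜 := ℝ) i : R3 →L[ℝ] ℝ)) y := by
      refine HasFDerivAt.fun_sum fun i _ => ?_
      exact (EuclideanSpace.proj (𝕜 := ℝ) i : R3 →L[ℝ] ℝ).hasFDerivAt.const_mul (κ i)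
    exact ((Complex.ofRealCLM.hasFDerivAt.comp y h1).const_mul Complex.I).cexp
  unfold pderiv
  rw [h.fderiv]
  fin_cases j <;> simp [Fin.sum_univ_three] <;> ring

lemma differentiable_expo (κ : R3) : Differentiable ℝ (expo κ) :=
  (contDiff_expo κ).differentiable (by simp)

/-- The shifted gradient `conj(e_κ) ∇(e_κ φ)`. -/
noncomputable def sgrad (κ : R3) (φ : R3 → ℂ) (y : R3) : C3 := grad φ y + φ y • iVec κ

lemma SmoothPeriodic.sgrad {φ : R3 → ℂ} (hφ : SmoothPeriodic φ) (κ : R3) :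
    SmoothPeriodic (sgrad κ φ) :=
  hφ.grad.add (hφ.smul (SmoothPeriodic.const _))

lemma grad_expo_mul {φ : R3 → ℂ} (hφ : SmoothPeriodic φ) (κ y : R3) :
    grad (fun x => expo κ x * φ x) y = expo κ y • sgrad κ φ y := by
  ext j
  simp only [grad, sgrad, PiLp.add_apply, PiLp.smul_apply, smul_eq_mul, iVec_apply]
  rw [pderiv_mul (differentiable_expo κ y) (hφ.differentiable y), pderiv_expo]
  ring

lemma curl_expo_smul {u : R3 → C3} (hu : SmoothPeriodic u) (κ y : R3) :
    curl (fun x => expo κ x • u x) y = expo κ y • (curl u y + cact (crossI κ) (u y)) := by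
  have h := fun j => pderiv_smul (differentiable_expo κ y) (hu.differentiable y) j
  ext k
  fin_cases k <;> simp [curl, cact_crossI, h, pderiv_expo] <;> ring

lemma pderiv_comm {φ : R3 → ℂ} (hφ : SmoothPeriodic φ) (i j : Fin 3) (y : R3) :
    pderiv i (pderiv j φ) y = pderiv j (pderiv i φ) y := by
  have hs : IsSymmSndFDerivAt ℝ φ y :=
    hφ.1.contDiffAt.isSymmSndFDerivAt (by
      rw [minSmoothness_of_isRCLikeNormedField]; exact WithTop.coe_le_coe.2 le_top)
  have hd : DifferentiableAt ℝ (fderiv ℝ φ) y :=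
    (hφ.1.fderiv_right (m := ∞) (by simp)).differentiable (by simp) y
  have key : ∀ a b : R3, fderiv ℝ (fun x => fderiv ℝ φ x a) y b = fderiv ℝ (fderiv ℝ φ) y b a := by
    intro a b
    rw [fderiv_clm_apply hd (differentiableAt_const a)]
    simp
  change fderiv ℝ (fun x => fderiv ℝ φ x _) y _ = fderiv ℝ (fun x => fderiv ℝ φ x _) y _
  rw [key, key, hs.eq]

lemma curl_smul_const {φ : R3 → ℂ} (hφ : SmoothPeriodic φ) (κ y : R3) :
    curl (fun x => φ x • iVec κ) y = -cact (crossI κ) (grad φ y) := by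
  have h := fun j => pderiv_smul (hφ.differentiable y) (differentiableAt_const (iVec κ)) j
  ext k
  fin_cases k <;> simp [curl, cact_crossI, h, grad] <;> ring

lemma curl_add {u v : R3 → C3} (hu : SmoothPeriodic u) (hv : SmoothPeriodic v) (y : R3) :
    curl (fun x => u x + v x) y = curl u y + curl v y := by
  have h := fun j => pderiv_add (hu.differentiable y) (hv.differentiable y) j
  ext k
  fin_cases k <;> simp [curl, h] <;> ring

lemma curl_grad {φ : R3 → ℂ} (hφ : SmoothPeriodic φ) (y : R3) : curl (grad φ) y = 0 := by
  have h : ∀ j k, pderiv j (grad φ) y k = pderiv j (pderiv k φ) y := fun j k =>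
    pderiv_apply (hφ.grad.differentiable y) j k
  ext k
  fin_cases k <;> simp [curl, h]
  · rw [pderiv_comm hφ, sub_self]
  · rw [pderiv_comm hφ, sub_self]
  · rw [pderiv_comm hφ, sub_self]

/-- This is `curl ∇ = 0` conjugated by `e_κ`, that is `(curl + iκ×)(∇ + iκ) = 0`: the cross terms
cancel and `iκ × iκ = 0`. -/
lemma curl_sgrad {φ : R3 → ℂ} (hφ : SmoothPeriodic φ) (κ y : R3) :
    curl (sgrad κ φ) y = -cact (crossI κ) (sgrad κ φ y) := by
  unfold sgrad
  rw [curl_add hφ.grad (hφ.smul (SmoothPeriodic.const _)), curl_grad hφ, curl_smul_const hφ,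
    cact_add, cact_smul]
  have := crossI_iVec_smul 1 κ
  rw [one_smul] at this
  rw [this]
  simp

@[simp] lemma curl_const (a : C3) (y : R3) : curl (fun _ => a) y = 0 := by
  ext k
  fin_cases k <;> simp [curl]

lemma curl_smul {u : R3 → C3} (hu : SmoothPeriodic u) (c : ℂ) (y : R3) :
    curl (fun x => c • u x) y = c • curl u y := by
  have h := fun j => pderiv_smul (differentiableAt_const c) (hu.differentiable y) j
  ext k
  fin_cases k <;> simp [curl, h] <;> ring

/-! ### Fourier modes -/

/-- The vector `2πn` of the dual lattice. -/
noncomputable def dualPt (n : Fin 3 → ℤ) : R3 := (2 * Real.pi) • latticePt n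

@[simp] lemma dualPt_apply (n : Fin 3 → ℤ) (i : Fin 3) : dualPt n i = 2 * Real.pi * n i := rfl

/-- The Fourier mode `exp(2πi n·y)`. -/
noncomputable def mode (n : Fin 3 → ℤ) : R3 → ℂ := expo (dualPt n)

lemma smoothPeriodic_mode (n : Fin 3 → ℤ) : SmoothPeriodic (mode n) := by
  refine ⟨contDiff_expo _, fun m x => ?_⟩
  unfold mode expo
  rw [Complex.exp_eq_exp_iff_exists_int]
  refine ⟨∑ i, n i * m i, ?_⟩
  simp [latticePt, Fin.sum_univ_three]
  ring

lemma conj_mode (n : Fin 3 → ℤ) (y : R3) : (starRingEnd ℂ) (mode n y) = mode (-n) y := by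
  unfold mode expo
  rw [← Complex.exp_conj]
  congr 1
  rw [map_mul, Complex.conj_I, Complex.conj_ofReal, neg_mul, ← mul_neg, ← Complex.ofReal_neg]
  congr 2
  simp [Fin.sum_univ_three]

lemma mode_mul (n m : Fin 3 → ℤ) (y : R3) : mode n y * mode m y = mode (n + m) y := by
  unfold mode expo
  rw [← Complex.exp_add]
  simp [Fin.sum_univ_three]
  ring_nf

@[simp] lemma mode_zero (y : R3) : mode 0 y = 1 := by
  simp [mode, expo]

lemma pderiv_mode (n : Fin 3 → ℤ) (y : R3) (j : Fin 3) :
    pderiv j (mode n) y = Complex.I * dualPt n j * mode n y := pderiv_expo _ _ _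

lemma sgrad_mode (κ : R3) (n : Fin 3 → ℤ) (y : R3) :
    sgrad κ (mode n) y = mode n y • iVec (κ + dualPt n) := by
  ext j
  simp [sgrad, grad, pderiv_mode]
  ring

/-- A nonzero `n i` shifts that coordinate by at least `2π`, while `|κ i| ≤ π`. So only the
frequency `n = 0` can come close to zero, and the gap is uniform in `κ`. -/
lemma pi_le_norm_add_dualPt {κ : R3} (hκ : κ ∈ dualCell) {n : Fin 3 → ℤ} (hn : n ≠ 0) :
    Real.pi ≤ ‖κ + dualPt n‖ := by
  obtain ⟨i, hi⟩ := Function.ne_iff.1 hn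
  refine le_trans ?_ (PiLp.norm_apply_le (κ + dualPt n) i)
  have h := hκ i
  have hpi := Real.pi_pos
  rw [PiLp.add_apply, dualPt_apply, Real.norm_eq_abs, le_abs]
  rcases lt_or_gt_of_ne hi with h0 | h0
  · right
    have : (n i : ℝ) ≤ -1 := by exact_mod_cast Int.le_sub_one_of_lt h0
    nlinarith
  · left
    have : (1 : ℝ) ≤ n i := by exact_mod_cast h0
    nlinarith

/-! ### Bounded multiplication operators on `L²` -/

/-- A measurable and bounded family of linear maps of `ℂ³`. -/
structure BddFamily (L : R3 → C3 →ₗ[ℂ] C3) : Prop where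
  measurable : ∀ v, Measurable fun y => L y v
  bound : ∃ C : ℝ, ∀ y v, ‖L y v‖ ≤ C * ‖v‖

lemma linearMap_eq_sum (L : C3 →ₗ[ℂ] C3) (v : C3) :
    L v = ∑ i, v i • L (EuclideanSpace.single i 1) := by
  conv_lhs => rw [← (EuclideanSpace.basisFun (Fin 3) ℂ).sum_repr v]
  simp [map_sum]

namespace BddFamily

variable {ν : Measure R3} {L L' : R3 → C3 →ₗ[ℂ] C3}

/-- Measurability of the family is only assumed on fixed vectors, so `u` is expanded in the standard
basis. -/
lemma aestronglyMeasurable (h : BddFamily L) {u : R3 → C3} (hu : AEStronglyMeasurable u ν) :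
    AEStronglyMeasurable (fun y => L y (u y)) ν := by
  simp_rw [fun y => linearMap_eq_sum (L y) (u y)]
  refine Finset.aestronglyMeasurable_fun_sum _ fun i _ => ?_
  exact (((EuclideanSpace.proj (𝕜 := ℂ) i).continuous.comp_aestronglyMeasurable hu).smul
    (h.measurable _).aestronglyMeasurable)

lemma memLp (h : BddFamily L) {u : R3 → C3} (hu : MemLp u 2 ν) :
    MemLp (fun y => L y (u y)) 2 ν := by
  obtain ⟨C, hC⟩ := h.bound
  exact hu.of_le_mul (h.aestronglyMeasurable hu.1) (Eventually.of_forall fun y => hC y (u y))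

end BddFamily

variable {ν : Measure R3} {L L' : R3 → C3 →ₗ[ℂ] C3}

variable (ν) in
/-- Pointwise multiplication by a bounded family of linear maps, on `L²(ν)`. -/
noncomputable def mulOp (h : BddFamily L) : Lp C3 2 ν →L[ℂ] Lp C3 2 ν :=
  LinearMap.mkContinuous
    { toFun := fun f => (h.memLp (Lp.memLp f)).toLp _
      map_add' := fun f g => by
        rw [← MemLp.toLp_add]
        refine MemLp.toLp_congr _ _ ?_
        filter_upwards [Lp.coeFn_add f g] with y hy
        rw [Pi.add_apply, hy, Pi.add_apply, map_add]
      map_smul' := fun c f => by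
        rw [RingHom.id_apply, ← MemLp.toLp_const_smul]
        refine MemLp.toLp_congr _ _ ?_
        filter_upwards [Lp.coeFn_smul c f] with y hy
        rw [Pi.smul_apply, hy, Pi.smul_apply, map_smul] }
    h.bound.choose fun f => by
      refine Lp.norm_le_mul_norm_of_ae_le_mul ?_
      filter_upwards [(h.memLp (Lp.memLp f)).coeFn_toLp] with y hy
      rw [LinearMap.coe_mk, AddHom.coe_mk, hy]
      exact h.bound.choose_spec y _

lemma coeFn_mulOp (h : BddFamily L) (f : Lp C3 2 ν) :
    mulOp ν h f =ᵐ[ν] fun y => L y (f y) :=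
  (h.memLp (Lp.memLp f)).coeFn_toLp

lemma mulOp_toLp (h : BddFamily L) {u : R3 → C3} (hu : MemLp u 2 ν) :
    mulOp ν h (hu.toLp u) = (h.memLp hu).toLp _ := by
  refine MemLp.toLp_congr (h.memLp (Lp.memLp _)) _ ?_
  filter_upwards [hu.coeFn_toLp] with y hy
  rw [hy]

lemma norm_mulOp_le (h : BddFamily L) {C : ℝ} (hC : ∀ y v, ‖L y v‖ ≤ C * ‖v‖)
    (f : Lp C3 2 ν) : ‖mulOp ν h f‖ ≤ C * ‖f‖ := by
  refine Lp.norm_le_mul_norm_of_ae_le_mul ?_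
  filter_upwards [coeFn_mulOp h f] with y hy
  rw [hy]
  exact hC y _

lemma mulOp_mulOp (h : BddFamily L) (h' : BddFamily L') (hLL : ∀ y v, L y (L' y v) = v)
    (f : Lp C3 2 ν) : mulOp ν h (mulOp ν h' f) = f := by
  ext1
  filter_upwards [coeFn_mulOp h (mulOp ν h' f), coeFn_mulOp h' f] with y h1 h2
  rw [h1, h2, hLL]

lemma inner_mulOp (h : BddFamily L) (h' : BddFamily L')
    (hL : ∀ y u v, inner ℂ (L y u) v = inner ℂ u (L' y v))
    (f g : Lp C3 2 ν) : inner ℂ (mulOp ν h f) g = inner ℂ f (mulOp ν h' g) := by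
  rw [L2.inner_def, L2.inner_def]
  refine integral_congr_ae ?_
  filter_upwards [coeFn_mulOp h f, coeFn_mulOp h' g] with y h1 h2
  rw [h1, h2, hL]

lemma mulOp_lower (h : BddFamily L) {a : ℝ} (ha : ∀ y v, a * ‖v‖ ^ 2 ≤ (inner ℂ v (L y v)).re)
    (f : Lp C3 2 ν) : a * ‖f‖ ^ 2 ≤ (inner ℂ f (mulOp ν h f)).re := by
  have h1 : ‖f‖ ^ 2 = ∫ y, ‖f y‖ ^ 2 ∂ν := by
    rw [← inner_self_eq_norm_sq (𝕜 := ℂ) f, L2.inner_def, ← integral_re (L2.integrable_inner f f)]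
    simp_rw [inner_self_eq_norm_sq]
  rw [h1, L2.inner_def, ← RCLike.re_eq_complex_re, ← integral_re (L2.integrable_inner f _),
    ← integral_const_mul]
  refine integral_mono_ae ((Lp.memLp f).norm.integrable_sq.const_mul a)
    (L2.integrable_inner f (mulOp ν h f)).re ?_
  filter_upwards [coeFn_mulOp h f] with y hy
  rw [hy]
  exact ha y _

/-! ### The families in use -/

lemma measurable_act {M : R3 → Matrix (Fin 3) (Fin 3) ℝ} (hM : ∀ i j, Measurable fun y => M y i j)
    (v : C3) : Measurable fun y => act (M y) v := by
  refine (WithLp.measurable_toLp 2 (Fin 3 → ℂ)).comp ?_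
  refine measurable_pi_lambda _ fun i => ?_
  simp only [Matrix.mulVec, dotProduct, Matrix.map_apply]
  exact Finset.measurable_fun_sum _ fun j _ => (Complex.measurable_ofReal.comp (hM i j)).mul_const _

namespace Elliptic

variable {A : R3 → Matrix (Fin 3) (Fin 3) ℝ} {α β : ℝ} (h : Elliptic A α β)
include h

lemma bdd : BddFamily fun y => actL (A y) :=
  ⟨measurable_act h.measurable, β, h.norm_act_le⟩

lemma bdd_inv : BddFamily fun y => actL (A y)⁻¹ :=
  ⟨measurable_act h.measurable_inv, α⁻¹, h.norm_act_inv_le⟩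

lemma bdd_msqrt : BddFamily fun y => actL (msqrt (A y)) :=
  ⟨measurable_act h.measurable_msqrt, √β, h.norm_act_msqrt_le⟩

lemma bdd_msqrt_inv : BddFamily fun y => actL (msqrt (A y))⁻¹ :=
  ⟨measurable_act h.measurable_msqrt_inv, √α⁻¹, h.norm_act_msqrt_inv_le⟩

end Elliptic

/-- Multiplication by `e_κ`, as a family of linear maps. -/
noncomputable def expoL (κ y : R3) : C3 →ₗ[ℂ] C3 := expo κ y • LinearMap.id

/-- Multiplication by `conj(e_κ)`, as a family of linear maps. -/
noncomputable def conjExpoL (κ y : R3) : C3 →ₗ[ℂ] C3 := starRingEnd ℂ (expo κ y) • LinearMap.id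

/-- The map `v ↦ iκ × v`, as a constant family of linear maps. -/
noncomputable def crossL (κ _y : R3) : C3 →ₗ[ℂ] C3 where
  toFun := cact (crossI κ)
  map_add' := cact_add _
  map_smul' := cact_smul _

lemma measurable_expo (κ : R3) : Measurable (expo κ) := (contDiff_expo κ).continuous.measurable

lemma bdd_expo (κ : R3) : BddFamily (expoL κ) :=
  ⟨fun v => (measurable_expo κ).smul_const v, 1, fun y v => by
    simp [expoL, norm_smul, norm_expo]⟩

lemma bdd_conjExpo (κ : R3) : BddFamily (conjExpoL κ) :=
  ⟨fun v => (Complex.continuous_conj.measurable.comp (measurable_expo κ)).smul_const v, 1,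
    fun y v => by simp [conjExpoL, norm_smul, norm_expo]⟩

lemma norm_crossI_le (κ : R3) (v : C3) : ‖cact (crossI κ) v‖ ≤ ‖κ‖ * ‖v‖ := by
  refine abs_le_of_sq_le_sq' ?_ (by positivity) |>.2
  rw [mul_pow]
  simp only [EuclideanSpace.norm_sq_eq, ← Complex.normSq_eq_norm_sq, Complex.normSq_apply,
    Fin.sum_univ_three, cact_crossI, Real.norm_eq_abs, sq_abs, Matrix.cons_val_zero,
    Matrix.cons_val_one, Matrix.cons_val]
  simp
  nlinarith [sq_nonneg (κ 0 * (v 0).re + κ 1 * (v 1).re + κ 2 * (v 2).re),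
    sq_nonneg (κ 0 * (v 0).im + κ 1 * (v 1).im + κ 2 * (v 2).im)]

lemma bdd_cross (κ : R3) : BddFamily (crossL κ) :=
  ⟨fun _ => measurable_const, ‖κ‖, fun _ v => norm_crossI_le κ v⟩

variable (ν)

/-- Multiplication by `e_κ` on `L²(ν)`. -/
noncomputable def expOp (κ : R3) : Lp C3 2 ν →L[ℂ] Lp C3 2 ν := mulOp ν (bdd_expo κ)

/-- Multiplication by `conj(e_κ)` on `L²(ν)`. -/
noncomputable def conjExpOp (κ : R3) : Lp C3 2 ν →L[ℂ] Lp C3 2 ν := mulOp ν (bdd_conjExpo κ)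

/-- The operator `u ↦ iκ × u` on `L²(ν)`. -/
noncomputable def crossOp (κ : R3) : Lp C3 2 ν →L[ℂ] Lp C3 2 ν := mulOp ν (bdd_cross κ)

variable {ν}

lemma conjExpOp_expOp (κ : R3) (f : Lp C3 2 ν) : conjExpOp ν κ (expOp ν κ f) = f :=
  mulOp_mulOp (bdd_conjExpo κ) (bdd_expo κ) (fun y v => by
    simp [expoL, conjExpoL, smul_smul, expo_mul_conj]) f

lemma inner_expOp (κ : R3) (f g : Lp C3 2 ν) :
    inner ℂ (expOp ν κ f) g = inner ℂ f (conjExpOp ν κ g) :=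
  inner_mulOp (bdd_expo κ) (bdd_conjExpo κ) (fun y u v => by
    rw [expoL, conjExpoL, LinearMap.smul_apply, LinearMap.smul_apply, inner_smul_left,
      inner_smul_right, LinearMap.id_apply, LinearMap.id_apply]) f g

lemma inner_crossOp (κ : R3) (f g : Lp C3 2 ν) :
    inner ℂ (crossOp ν κ f) g = inner ℂ f (crossOp ν κ g) :=
  inner_mulOp (bdd_cross κ) (bdd_cross κ) (fun _ u v => inner_crossI κ u v) f g

lemma norm_crossOp_le (κ : R3) (f : Lp C3 2 ν) : ‖crossOp ν κ f‖ ≤ ‖κ‖ * ‖f‖ :=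
  norm_mulOp_le (bdd_cross κ) (fun _ v => norm_crossI_le κ v) f

lemma coeFn_crossOp (κ : R3) (f : Lp C3 2 ν) :
    crossOp ν κ f =ᵐ[ν] fun y => cact (crossI κ) (f y) := coeFn_mulOp _ f

lemma crossOp_smul (c : ℝ) (κ : R3) (f : Lp C3 2 ν) :
    crossOp ν (c • κ) f = (c : ℂ) • crossOp ν κ f := by
  apply Lp.ext
  have h1 := coeFn_crossOp (ν := ν) (c • κ) f
  have h2 := coeFn_crossOp (ν := ν) κ f
  have h3 := Lp.coeFn_smul (c : ℂ) (crossOp ν κ f)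
  filter_upwards [h1, h2, h3] with y h1 h2 h3
  rw [h1, h3, Pi.smul_apply, h2]
  exact crossI_smul c κ _

/-! ### Constants -/

variable (ν) in
/-- Constant vector fields, as elements of `L²(ν)`. -/
noncomputable def constOp [IsFiniteMeasure ν] : C3 →L[ℂ] Lp C3 2 ν := Lp.constL 2 ν ℂ

lemma coeFn_constOp [IsFiniteMeasure ν] (a : C3) : constOp ν a =ᵐ[ν] fun _ => a :=
  Lp.coeFn_const 2 ν a

lemma constOp_eq_toLp [IsFiniteMeasure ν] (a : C3) :
    constOp ν a = (memLp_const a).toLp (fun _ => a) := rfl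

lemma norm_constOp [IsProbabilityMeasure ν] (a : C3) : ‖constOp ν a‖ = ‖a‖ := by
  change ‖Lp.const 2 ν a‖ = _
  rw [Lp.norm_const _ _ _ (by simp)]
  simp

/-- Zero mean thereby becomes orthogonality to constants, a closed condition in `L²`. -/
lemma inner_constOp [IsFiniteMeasure ν] (a : C3) (f : Lp C3 2 ν) :
    inner ℂ (constOp ν a) f = inner ℂ a (∫ y, f y ∂ν) := by
  rw [L2.inner_def, ← integral_inner ((Lp.memLp f).integrable (by norm_num))]
  refine integral_congr_ae ?_
  filter_upwards [coeFn_constOp a] with y hy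
  rw [hy]

lemma crossOp_constOp [IsFiniteMeasure ν] (κ : R3) (a : C3) :
    crossOp ν κ (constOp ν a) = constOp ν (cact (crossI κ) a) := by
  rw [constOp_eq_toLp, crossOp, mulOp_toLp]
  rfl

/-! ### Smooth periodic functions in `L²` -/

/-- The closed cube replaces the half-open cell to have a compact set of representatives. -/
lemma exists_sub_latticePt (x : R3) : ∃ (n : Fin 3 → ℤ) (z : R3),
    z ∈ (WithLp.toLp 2 '' Set.Icc (0 : Fin 3 → ℝ) 1 : Set R3) ∧ x = z + latticePt n := by
  refine ⟨fun i => ⌊x i⌋, WithLp.toLp 2 fun i => Int.fract (x i), ⟨_, ⟨?_, ?_⟩, rfl⟩, ?_⟩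
  · exact fun i => Int.fract_nonneg _
  · exact fun i => (Int.fract_lt_one _).le
  · ext i
    simp [latticePt]

lemma Periodic.exists_bound {F : Type*} [NormedAddCommGroup F] {u : R3 → F} (hp : Periodic u)
    (hc : Continuous u) : ∃ C, ∀ x, ‖u x‖ ≤ C := by
  have hK : IsCompact (WithLp.toLp 2 '' Set.Icc (0 : Fin 3 → ℝ) 1 : Set R3) :=
    isCompact_Icc.image (PiLp.continuous_toLp 2 _)
  obtain ⟨C, hC⟩ := hK.exists_bound_of_continuousOn hc.continuousOn
  refine ⟨C, fun x => ?_⟩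
  obtain ⟨n, z, hz, rfl⟩ := exists_sub_latticePt x
  rw [hp]
  exact hC z hz

lemma SmoothPeriodic.memLp [IsFiniteMeasure ν] {F : Type*} [NormedAddCommGroup F] [NormedSpace ℝ F]
    [SecondCountableTopologyEither R3 F] {u : R3 → F} (hu : SmoothPeriodic u) : MemLp u 2 ν := by
  obtain ⟨C, hC⟩ := hu.2.exists_bound hu.1.continuous
  exact MemLp.of_bound hu.1.continuous.aestronglyMeasurable C (Eventually.of_forall hC)

/-- The class of a smooth periodic vector field in `L²(ν)`. -/
noncomputable def SmoothPeriodic.toL2 {u : R3 → C3} (hu : SmoothPeriodic u) (ν : Measure R3)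
    [IsFiniteMeasure ν] : Lp C3 2 ν := (hu.memLp (ν := ν)).toLp u

lemma SmoothPeriodic.coeFn_toL2 [IsFiniteMeasure ν] {u : R3 → C3} (hu : SmoothPeriodic u) :
    hu.toL2 ν =ᵐ[ν] u := (hu.memLp (ν := ν)).coeFn_toLp

lemma SmoothPeriodic.eq_toL2 [IsFiniteMeasure ν] {u : R3 → C3} (hu : SmoothPeriodic u)
    {f : Lp C3 2 ν} (h : f =ᵐ[ν] u) : f = hu.toL2 ν :=
  Lp.ext (h.trans hu.coeFn_toL2.symm)

variable (ν) in
/-- The pairs `(φ, curl φ)` with `φ` smooth and periodic. -/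
noncomputable def smoothCurl [IsFiniteMeasure ν] : Submodule ℂ (Lp C3 2 ν × Lp C3 2 ν) where
  carrier := {p | ∃ φ : R3 → C3, SmoothPeriodic φ ∧ p.1 =ᵐ[ν] φ ∧ p.2 =ᵐ[ν] curl φ}
  add_mem' := by
    rintro p q ⟨φ, hφ, h1, h2⟩ ⟨χ, hχ, h3, h4⟩
    refine ⟨_, hφ.add hχ, (Lp.coeFn_add _ _).trans (h1.add h3),
      ((Lp.coeFn_add _ _).trans (h2.add h4)).trans (Eventually.of_forall fun y => ?_)⟩
    exact (curl_add hφ hχ y).symm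
  zero_mem' := by
    refine ⟨_, SmoothPeriodic.const 0, Lp.coeFn_zero _ _ _,
      (Lp.coeFn_zero _ _ _).trans (Eventually.of_forall fun y => ?_)⟩
    exact (curl_const 0 y).symm
  smul_mem' := by
    rintro c p ⟨φ, hφ, h1, h2⟩
    refine ⟨_, (SmoothPeriodic.const c).smul hφ, (Lp.coeFn_smul _ _).trans (h1.const_smul c),
      ((Lp.coeFn_smul _ _).trans (h2.const_smul c)).trans (Eventually.of_forall fun y => ?_)⟩
    exact (curl_smul hφ c y).symm

variable (ν) in
/-- The graph closure of the curl, in `L²(ν) × L²(ν)`. -/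
noncomputable def curlGraph [IsFiniteMeasure ν] : Submodule ℂ (Lp C3 2 ν × Lp C3 2 ν) :=
  (smoothCurl ν).topologicalClosure

section

variable [IsFiniteMeasure ν]

lemma smooth_mem_curlGraph {φ : R3 → C3} (hφ : SmoothPeriodic φ) :
    (hφ.toL2 ν, hφ.curl.toL2 ν) ∈ curlGraph ν :=
  Submodule.le_topologicalClosure (smoothCurl ν) ⟨φ, hφ, hφ.coeFn_toL2, hφ.curl.coeFn_toL2⟩

lemma const_mem_curlGraph (a : C3) : (constOp ν a, (0 : Lp C3 2 ν)) ∈ curlGraph ν := by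
  refine Submodule.le_topologicalClosure (smoothCurl ν)
    ⟨_, SmoothPeriodic.const a, coeFn_constOp a,
      (Lp.coeFn_zero _ _ _).trans (Eventually.of_forall fun y => ?_)⟩
  exact (curl_const a y).symm

/-- A closed property of pairs which holds for smooth fields holds on the closed graph. -/
lemma curlGraph_induction {P : Lp C3 2 ν → Lp C3 2 ν → Prop}
    (hc : IsClosed {p : Lp C3 2 ν × Lp C3 2 ν | P p.1 p.2})
    (hs : ∀ (φ : R3 → C3) (hφ : SmoothPeriodic φ), P (hφ.toL2 ν) (hφ.curl.toL2 ν))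
    {f q : Lp C3 2 ν} (h : (f, q) ∈ curlGraph ν) : P f q := by
  have h1 : closure (smoothCurl ν : Set (Lp C3 2 ν × Lp C3 2 ν)) ⊆ {p | P p.1 p.2} := by
    refine closure_minimal ?_ hc
    rintro p ⟨φ, hφ, h1, h2⟩
    have := hs φ hφ
    rwa [← hφ.eq_toL2 h1, ← hφ.curl.eq_toL2 h2] at this
  exact h1 h

end

/-! ### Uniform density of Fourier modes -/

/-- The projection of `ℝ³` to the torus. -/
noncomputable def toTorus (x : R3) : UnitAddTorus (Fin 3) := fun i => (x i : UnitAddCircle)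

lemma continuous_toTorus : Continuous toTorus := by
  unfold toTorus
  refine continuous_pi fun i => ?_
  exact (AddCircle.continuous_mk' 1).comp (EuclideanSpace.proj (𝕜 := ℝ) i).continuous

lemma isQuotientMap_toTorus : IsQuotientMap toTorus := by
  have h1 : IsOpenQuotientMap (Pi.map fun (_ : Fin 3) (x : ℝ) => (x : UnitAddCircle)) :=
    IsOpenQuotientMap.piMap fun _ => QuotientAddGroup.isOpenQuotientMap_mk
  exact h1.isQuotientMap.comp (PiLp.homeomorph 2 fun _ : Fin 3 => ℝ).isQuotientMap

lemma mFourier_toTorus (n : Fin 3 → ℤ) (x : R3) :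
    UnitAddTorus.mFourier n (toTorus x) = mode n x := by
  simp only [UnitAddTorus.mFourier, toTorus, ContinuousMap.coe_mk, fourier_coe_apply, mode, expo,
    ← Complex.exp_sum]
  congr 1
  simp [Fin.sum_univ_three]
  ring

/-- Two points with the same image in the torus differ by a lattice point, so `f` is constant on the
fibres of a quotient map and descends continuously. -/
lemma Periodic.exists_lift {f : R3 → ℂ} (hp : Periodic f) (hf : Continuous f) :
    ∃ g : C(UnitAddTorus (Fin 3), ℂ), ∀ x, g (toTorus x) = f x := by
  have hfac : Function.FactorsThrough (⟨f, hf⟩ : C(R3, ℂ))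
      (⟨toTorus, continuous_toTorus⟩ : C(R3, UnitAddTorus (Fin 3))) := by
    intro x z hxz
    have h : ∀ i, ∃ n : ℤ, x i = z i + n := by
      intro i
      have h1 : (x i : UnitAddCircle) = z i := congrFun hxz i
      obtain ⟨n, hn⟩ := QuotientAddGroup.eq.1 h1
      refine ⟨-n, ?_⟩
      simp only [zsmul_eq_mul, mul_one] at hn
      push_cast
      linarith
    choose n hn using h
    have : x = z + latticePt n := by
      ext i
      exact hn i
    change f x = f z
    rw [this, hp]
  refine ⟨isQuotientMap_toTorus.lift ⟨f, hf⟩ hfac, fun x => ?_⟩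
  exact congrArg (fun g : C(R3, ℂ) => g x) (isQuotientMap_toTorus.lift_comp ⟨f, hf⟩ hfac)

section

variable {ν : Measure R3} [IsFiniteMeasure ν]

/-- The vector Fourier mode `exp(2πi n·y) a`. -/
noncomputable def vmode (ν : Measure R3) [IsFiniteMeasure ν] (n : Fin 3 → ℤ) (a : C3) :
    Lp C3 2 ν :=
  ((smoothPeriodic_mode n).smul (SmoothPeriodic.const a)).toL2 ν

lemma coeFn_vmode (n : Fin 3 → ℤ) (a : C3) : vmode ν n a =ᵐ[ν] fun y => mode n y • a :=
  SmoothPeriodic.coeFn_toL2 _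

end

lemma norm_toLp_le {ν : Measure R3} [IsProbabilityMeasure ν] {u : R3 → C3} (hu : MemLp u 2 ν)
    {C : ℝ} (hC : 0 ≤ C) (h : ∀ y, ‖u y‖ ≤ C) : ‖hu.toLp u‖ ≤ C := by
  have := Lp.norm_le_of_ae_bound (f := hu.toLp u) hC (by
    filter_upwards [hu.coeFn_toLp] with y hy
    rw [hy]; exact h y)
  have h1 : measureUnivNNReal ν = 1 := by simp [measureUnivNNReal]
  simpa [h1] using this

variable {ν : Measure R3} [IsProbabilityMeasure ν]

lemma memLp_torus (g : C(UnitAddTorus (Fin 3), ℂ)) (a : C3) :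
    MemLp (fun y => g (toTorus y) • a) 2 ν :=
  MemLp.of_bound ((g.continuous.comp continuous_toTorus).smul
    (continuous_const (y := a))).aestronglyMeasurable (‖g‖ * ‖a‖) (Eventually.of_forall fun y => by
      change ‖g (toTorus y) • a‖ ≤ _
      rw [norm_smul]; gcongr; exact g.norm_coe_le_norm _)

variable (ν) in
/-- Continuous functions on the torus, as `L²` fields in a fixed direction. -/
noncomputable def torusOp (a : C3) : C(UnitAddTorus (Fin 3), ℂ) →L[ℂ] Lp C3 2 ν :=
  LinearMap.mkContinuous
    { toFun := fun g => (memLp_torus g a).toLp _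
      map_add' := fun f g => by
        rw [← MemLp.toLp_add]
        refine MemLp.toLp_congr _ _ (Eventually.of_forall fun y => ?_)
        exact add_smul _ _ _
      map_smul' := fun c f => by
        rw [RingHom.id_apply, ← MemLp.toLp_const_smul]
        refine MemLp.toLp_congr _ _ (Eventually.of_forall fun y => ?_)
        exact mul_smul c (f (toTorus y)) a }
    ‖a‖ fun g => norm_toLp_le (memLp_torus g a) (by positivity) fun y => by
      rw [norm_smul, mul_comm]; gcongr; exact g.norm_coe_le_norm _

lemma coeFn_torusOp (a : C3) (g : C(UnitAddTorus (Fin 3), ℂ)) :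
    torusOp ν a g =ᵐ[ν] fun y => g (toTorus y) • a := (memLp_torus g a).coeFn_toLp

lemma torusOp_mFourier (a : C3) (n : Fin 3 → ℤ) :
    torusOp ν a (UnitAddTorus.mFourier n) = vmode ν n a := by
  refine SmoothPeriodic.eq_toL2 _ ((coeFn_torusOp _ _).trans (Eventually.of_forall fun y => ?_))
  simp only [mFourier_toTorus]

/-- Trigonometric polynomials are uniformly dense in the continuous functions on the torus, and
`torusOp` is continuous from the sup norm to `L²(ν)`. -/
lemma torusOp_mem (a : C3) (g : C(UnitAddTorus (Fin 3), ℂ)) :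
    torusOp ν a g ∈ (Submodule.span ℂ (Set.range fun n => vmode ν n a)).topologicalClosure := by
  have hg : g ∈ (Submodule.span ℂ
      (Set.range (UnitAddTorus.mFourier (d := Fin 3)))).topologicalClosure := by
    rw [UnitAddTorus.span_mFourier_closure_eq_top]; trivial
  refine map_mem_closure (torusOp ν a).continuous hg fun f hf => ?_
  refine Submodule.span_induction ?_ ?_ ?_ ?_ hf
  · rintro _ ⟨n, rfl⟩
    rw [torusOp_mFourier]
    exact Submodule.subset_span ⟨n, rfl⟩
  · rw [map_zero]; exact Submodule.zero_mem _
  · intro f g _ _ h1 h2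
    rw [map_add]; exact Submodule.add_mem _ h1 h2
  · intro c f _ h1
    rw [map_smul]; exact Submodule.smul_mem _ c h1

variable (ν) in
/-- The Fourier modes in the coordinate directions. -/
noncomputable def emode (p : (Fin 3 → ℤ) × Fin 3) : Lp C3 2 ν :=
  vmode ν p.1 (EuclideanSpace.single p.2 1)

/-- Completeness of the modes is needed only for smooth fields: in the Fourier estimate one factor
is smooth and the other is an arbitrary element of `L²`. -/
lemma smooth_mem_span_emode {u : R3 → C3} (hu : SmoothPeriodic u) :
    hu.toL2 ν ∈ (Submodule.span ℂ (Set.range (emode ν))).topologicalClosure := by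
  have h : ∀ k, ∃ g : C(UnitAddTorus (Fin 3), ℂ), ∀ x, g (toTorus x) = u x k := fun k =>
    (hu.apply k).2.exists_lift (hu.apply k).1.continuous
  choose g hg using h
  have hsum : hu.toL2 ν = ∑ k, torusOp ν (EuclideanSpace.single k 1) (g k) := by
    symm
    refine hu.eq_toL2 ?_
    have hk : ∀ k, torusOp ν (EuclideanSpace.single k 1) (g k) =ᵐ[ν]
        fun y => u y k • (EuclideanSpace.single k 1 : C3) := fun k => by
      refine (coeFn_torusOp _ _).trans (Eventually.of_forall fun y => ?_)
      simp only [hg]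
    rw [Fin.sum_univ_three]
    filter_upwards [hk 0, hk 1, hk 2, Lp.coeFn_add (torusOp ν (EuclideanSpace.single 0 1) (g 0) +
      torusOp ν (EuclideanSpace.single 1 1) (g 1)) (torusOp ν (EuclideanSpace.single 2 1) (g 2)),
      Lp.coeFn_add (torusOp ν (EuclideanSpace.single 0 1) (g 0))
      (torusOp ν (EuclideanSpace.single 1 1) (g 1))] with y h0 h1 h2 h3 h4
    rw [h3, Pi.add_apply, h4, Pi.add_apply, h0, h1, h2]
    ext k
    fin_cases k <;> simp
  rw [hsum]
  refine Submodule.sum_mem _ fun k _ => ?_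
  refine Submodule.topologicalClosure_mono ?_ (torusOp_mem _ _)
  refine Submodule.span_mono ?_
  rintro _ ⟨n, rfl⟩
  exact ⟨(n, k), rfl⟩

/-! ### An estimate by Fourier coefficients -/

/-- The pairing is the limit of its partial Fourier sums even if only `x` lies in the closed span. A
bound on a cofinal family of finite sums is enough, which leaves room to complete an index set to
full frequency blocks. -/
lemma norm_inner_le_of_mem_closure_span {E ι : Type*} [NormedAddCommGroup E]
    [InnerProductSpace ℂ E] {v : ι → E} (hv : Orthonormal ℂ v) {x y : E}
    (hx : x ∈ (Submodule.span ℂ (Set.range v)).topologicalClosure) {C : ℝ}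
    (hC : ∀ F : Finset ι, ∃ F', F ⊆ F' ∧ ‖∑ i ∈ F', inner ℂ x (v i) * inner ℂ (v i) y‖ ≤ C) :
    ‖inner ℂ x y‖ ≤ C := by
  refine le_of_forall_pos_le_add fun δ hδ => ?_
  obtain ⟨p, hp, hxp⟩ := Metric.mem_closure_iff.1 hx (δ / (‖y‖ + 1)) (by positivity)
  obtain ⟨c, rfl⟩ := Finsupp.mem_span_range_iff_exists_finsupp.1 hp
  obtain ⟨F, hcF, hF⟩ := hC c.support
  -- `s` is the projection of `y` onto the modes in `F`. As `y - s` is orthogonal to the approximant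
  -- of `x`, only the approximation error pairs with it, and `⟨x, s⟩` is the partial sum.
  set s := ∑ i ∈ F, inner ℂ (v i) y • v i with hs
  have hvs : ∀ i ∈ F, inner ℂ (v i) (y - s) = 0 := fun i hi => by
    rw [inner_sub_right, hs, hv.inner_right_sum _ hi, sub_self]
  have hss : inner ℂ s (y - s) = 0 := by
    conv_lhs => rw [hs, sum_inner]
    exact Finset.sum_eq_zero fun i hi => by rw [inner_smul_left, hvs i hi, mul_zero]
  have hps : inner ℂ (c.sum fun i a => a • v i) (y - s) = 0 := by
    rw [Finsupp.sum, sum_inner]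
    exact Finset.sum_eq_zero fun i hi => by rw [inner_smul_left, hvs i (hcF hi), mul_zero]
  have hle : ‖y - s‖ ≤ ‖y‖ := by
    have h1 := norm_add_sq_eq_norm_sq_add_norm_sq_of_inner_eq_zero s (y - s) hss
    rw [add_sub_cancel] at h1
    nlinarith [norm_nonneg y, norm_nonneg s, norm_nonneg (y - s)]
  have hdec : inner ℂ x y = inner ℂ (x - c.sum fun i a => a • v i) (y - s) + inner ℂ x s := by
    rw [inner_sub_left, hps, sub_zero, ← inner_add_right, sub_add_cancel]
  have hxs : inner ℂ x s = ∑ i ∈ F, inner ℂ x (v i) * inner ℂ (v i) y := by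
    rw [hs, inner_sum]
    exact Finset.sum_congr rfl fun i _ => by rw [inner_smul_right, mul_comm]
  rw [hdec, hxs, add_comm C]
  refine (norm_add_le _ _).trans (add_le_add ?_ hF)
  refine (norm_inner_le_norm _ _).trans ?_
  rw [dist_eq_norm] at hxp
  calc _ ≤ δ / (‖y‖ + 1) * ‖y‖ := by gcongr
    _ ≤ δ / (‖y‖ + 1) * (‖y‖ + 1) := by gcongr; linarith
    _ = δ := by field_simp

/-! ### Fourier coefficients -/

variable (ν) in
/-- The vector Fourier coefficient. -/
noncomputable def fcoef (n : Fin 3 → ℤ) (u : R3 → C3) : C3 :=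
  ∫ y, (starRingEnd ℂ) (mode n y) • u y ∂ν

lemma norm_mode (n : Fin 3 → ℤ) (y : R3) : ‖mode n y‖ = 1 := norm_expo _ _

lemma inner_vmode (n : Fin 3 → ℤ) (a : C3) (f : Lp C3 2 ν) :
    inner ℂ (vmode ν n a) f = inner ℂ a (fcoef ν n f) := by
  have hint : Integrable (fun y => (starRingEnd ℂ) (mode n y) • f y) ν := by
    refine ((Lp.memLp f).integrable (by norm_num)).bdd_smul 1
      (Complex.continuous_conj.comp (smoothPeriodic_mode n).1.continuous).aestronglyMeasurable ?_
    exact Eventually.of_forall fun y => by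
      rw [Function.comp_apply, RCLike.norm_conj, norm_mode]
  rw [fcoef, ← integral_inner hint, L2.inner_def]
  refine integral_congr_ae ?_
  filter_upwards [coeFn_vmode (ν := ν) n a] with y hy
  rw [hy, inner_smul_left, inner_smul_right]

lemma inner_emode (p : (Fin 3 → ℤ) × Fin 3) (f : Lp C3 2 ν) :
    inner ℂ (emode ν p) f = fcoef ν p.1 f p.2 := by
  rw [emode, inner_vmode, EuclideanSpace.inner_single_left]
  simp

/-- Derivatives of smooth periodic functions have mean zero. -/
def ZeroMeanDerivatives (ν : Measure R3) : Prop :=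
  ∀ φ : R3 → ℂ, SmoothPeriodic φ → ∀ j, ∫ y, pderiv j φ y ∂ν = 0

omit [IsProbabilityMeasure ν] in
-- The mode is an eigenfunction of `∂_i` with eigenvalue `2πi n_i`, nonzero for a suitable `i`,
-- while its derivative has zero mean.
lemma integral_mode (hν : ZeroMeanDerivatives ν) {n : Fin 3 → ℤ} (hn : n ≠ 0) :
    ∫ y, mode n y ∂ν = 0 := by
  obtain ⟨i, hi⟩ := Function.ne_iff.1 hn
  have h := hν _ (smoothPeriodic_mode n) i
  simp_rw [pderiv_mode] at h
  rw [integral_const_mul] at h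
  refine (mul_eq_zero.1 h).resolve_left ?_
  simpa [Real.pi_ne_zero] using hi

/-- A mode times a conjugate mode is again a mode, so the Gram matrix only involves means of modes;
the zero-mean property of derivatives supplies what Lebesgue measure would. -/
lemma orthonormal_emode (hν : ZeroMeanDerivatives ν) : Orthonormal ℂ (emode ν) := by
  classical
  rw [orthonormal_iff_ite]
  intro p q
  rw [inner_emode]
  have h1 : fcoef ν p.1 (emode ν q) = (∫ y, mode (q.1 - p.1) y ∂ν) •
      (EuclideanSpace.single q.2 1 : C3) := by
    rw [fcoef, ← integral_smul_const]
    refine integral_congr_ae ?_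
    filter_upwards [coeFn_vmode (ν := ν) q.1 (EuclideanSpace.single q.2 1)] with y hy
    rw [emode, hy, smul_smul, conj_mode, mode_mul, neg_add_eq_sub]
  rw [h1]
  by_cases hpq : p.1 = q.1
  · simp only [hpq, sub_self, mode_zero, integral_const, probReal_univ, one_smul]
    simp [Prod.ext_iff, hpq]
  · rw [integral_mode hν (sub_ne_zero.2 (Ne.symm hpq))]
    simp [Prod.ext_iff, hpq]

/-- Bessel's inequality. -/
lemma sum_norm_fcoef_sq_le (hν : ZeroMeanDerivatives ν) (f : Lp C3 2 ν)
    (F : Finset (Fin 3 → ℤ)) : ∑ n ∈ F, ‖fcoef ν n f‖ ^ 2 ≤ ‖f‖ ^ 2 := by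
  have h := (orthonormal_emode hν).sum_inner_products_le f (s := F ×ˢ Finset.univ)
  rw [Finset.sum_product] at h
  simp_rw [inner_emode] at h
  simpa [EuclideanSpace.norm_sq_eq] using h

omit [IsProbabilityMeasure ν] in
lemma fcoef_congr {n : Fin 3 → ℤ} {u v : R3 → C3} (h : u =ᵐ[ν] v) :
    fcoef ν n u = fcoef ν n v :=
  integral_congr_ae (h.mono fun y hy => by simp only [hy])

lemma fcoef_apply {u : R3 → C3} (hu : SmoothPeriodic u) (n : Fin 3 → ℤ) (k : Fin 3) :
    fcoef ν n u k = ∫ y, mode (-n) y * u y k ∂ν := by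
  have hs := ((smoothPeriodic_mode (-n)).smul hu).memLp (ν := ν)
  have hint : Integrable (fun y => mode (-n) y • u y) ν := hs.integrable (by norm_num)
  simp_rw [fcoef, conj_mode]
  exact ((EuclideanSpace.proj (𝕜 := ℂ) k : C3 →L[ℂ] ℂ).integral_comp_comm hint).symm

/-- Integration by parts: the derivative of the product `mode (-n) • f` has zero mean. -/
lemma integral_mode_mul_pderiv (hν : ZeroMeanDerivatives ν) {f : R3 → ℂ} (hf : SmoothPeriodic f)
    (n : Fin 3 → ℤ) (j : Fin 3) :
    ∫ y, mode (-n) y * pderiv j f y ∂ν =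
      Complex.I * dualPt n j * ∫ y, mode (-n) y * f y ∂ν := by
  have h := hν _ ((smoothPeriodic_mode (-n)).smul hf) j
  have h1 : ∀ y, pderiv j (fun x => mode (-n) x • f x) y =
      mode (-n) y * pderiv j f y - Complex.I * dualPt n j * (mode (-n) y * f y) := fun y => by
    rw [pderiv_smul ((smoothPeriodic_mode (-n)).differentiable y) (hf.differentiable y),
      pderiv_mode]
    simp
    ring
  simp_rw [h1] at h
  have hi1 : Integrable (fun y => mode (-n) y * pderiv j f y) ν :=
    (((smoothPeriodic_mode (-n)).smul (hf.pderiv j)).memLp (ν := ν)).integrable (by norm_num)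
  have hi2 : Integrable (fun y => mode (-n) y * f y) ν :=
    (((smoothPeriodic_mode (-n)).smul hf).memLp (ν := ν)).integrable (by norm_num)
  rw [integral_sub hi1 (hi2.const_mul _), integral_const_mul] at h
  exact sub_eq_zero.1 h

/-- On the Fourier side `∂_j` becomes multiplication by `2πi n_j`, so `curl + iκ×` acts on the
coefficient of index `n` as the cross product with `i(κ + 2πn)`. -/
lemma fcoef_curl (hν : ZeroMeanDerivatives ν) {u : R3 → C3} (hu : SmoothPeriodic u)
    (κ : R3) (n : Fin 3 → ℤ) :
    fcoef ν n (hu.curl.toL2 ν + crossOp ν κ (hu.toL2 ν) : Lp C3 2 ν) =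
      cact (crossI (κ + dualPt n)) (fcoef ν n (hu.toL2 ν)) := by
  have hX : SmoothPeriodic fun y => cact (crossI κ) (u y) :=
    hu.comp_clm ((LinearMap.toContinuousLinearMap (crossL κ 0)).restrictScalars ℝ)
  rw [fcoef_congr hu.coeFn_toL2]
  have h1 : ((hu.curl.toL2 ν + crossOp ν κ (hu.toL2 ν) : Lp C3 2 ν) : R3 → C3) =ᵐ[ν]
      fun y => curl u y + cact (crossI κ) (u y) := by
    filter_upwards [Lp.coeFn_add (hu.curl.toL2 ν) (crossOp ν κ (hu.toL2 ν)),
      coeFn_crossOp κ (hu.toL2 ν), hu.coeFn_toL2 (ν := ν), hu.curl.coeFn_toL2 (ν := ν)]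
      with y h1 h2 h3 h4
    rw [h1, Pi.add_apply, h2, h3, h4]
  rw [fcoef_congr h1]
  have hint : ∀ j k, Integrable (fun y => mode (-n) y * pderiv j u y k) ν := fun j k =>
    (((smoothPeriodic_mode (-n)).smul ((hu.pderiv j).apply k)).memLp (ν := ν)).integrable
      (by norm_num)
  have hint' : ∀ k, Integrable (fun y => mode (-n) y * u y k) ν := fun k =>
    (((smoothPeriodic_mode (-n)).smul (hu.apply k)).memLp (ν := ν)).integrable (by norm_num)
  have hd : ∀ j k, ∫ y, mode (-n) y * pderiv j u y k ∂ν =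
      Complex.I * dualPt n j * ∫ y, mode (-n) y * u y k ∂ν := fun j k => by
    rw [← integral_mode_mul_pderiv hν (hu.apply k)]
    simp_rw [pderiv_apply (hu.differentiable _)]
  -- The three components have the same shape up to a choice of indices, so one computation covers
  -- them all.
  have key : ∀ a b c d : Fin 3,
      ∫ y, mode (-n) y * ((pderiv a u y b - pderiv c u y d) +
        (Complex.I * κ a * u y b - Complex.I * κ c * u y d)) ∂ν =
      Complex.I * ((κ a + dualPt n a : ℝ) : ℂ) * (∫ y, mode (-n) y * u y b ∂ν) -
        Complex.I * ((κ c + dualPt n c : ℝ) : ℂ) * ∫ y, mode (-n) y * u y d ∂ν := fun a b c d => by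
    have h2 : ∀ y, mode (-n) y * ((pderiv a u y b - pderiv c u y d) +
        (Complex.I * κ a * u y b - Complex.I * κ c * u y d)) =
        (mode (-n) y * pderiv a u y b - mode (-n) y * pderiv c u y d) +
        (Complex.I * κ a * (mode (-n) y * u y b) - Complex.I * κ c * (mode (-n) y * u y d)) :=
      fun y => by ring
    simp_rw [h2]
    have h3 : Integrable (fun y => mode (-n) y * pderiv a u y b - mode (-n) y * pderiv c u y d) ν :=
      (hint a b).sub (hint c d)
    have h4 : Integrable (fun y => Complex.I * κ a * (mode (-n) y * u y b) -
        Complex.I * κ c * (mode (-n) y * u y d)) ν :=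
      ((hint' b).const_mul _).sub ((hint' d).const_mul _)
    rw [integral_add h3 h4, integral_sub (hint a b) (hint c d),
      integral_sub ((hint' b).const_mul _) ((hint' d).const_mul _), hd, hd, integral_const_mul,
      integral_const_mul]
    push_cast
    ring
  ext k
  rw [fcoef_apply (hu.curl.add hX), cact_crossI]
  simp only [cact_crossI]
  fin_cases k
  · exact (key 1 2 2 1).trans (by simp [fcoef_apply hu])
  · exact (key 2 0 0 2).trans (by simp [fcoef_apply hu])
  · exact (key 0 1 1 0).trans (by simp [fcoef_apply hu])

/-! ### A Poincaré-type inequality, uniform in the quasimomentum -/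

lemma vmode_zero (a : C3) : vmode ν 0 a = constOp ν a := by
  refine Lp.ext ?_
  filter_upwards [coeFn_vmode (ν := ν) 0 a, coeFn_constOp (ν := ν) a] with y h1 h2
  rw [h1, h2, mode_zero, one_smul]

/-- If `R` has zero mean and is orthogonal to the shifted gradients, then its pairing with `f` is
controlled by the shifted curl of `f`. -/
theorem norm_inner_le_of_solenoidal (hν : ZeroMeanDerivatives ν) {κ : R3} (hκ : κ ∈ dualCell)
    {R : Lp C3 2 ν} (h0 : ∀ a, inner ℂ (constOp ν a) R = 0)
    (hR : ∀ (φ : R3 → ℂ) (hφ : SmoothPeriodic φ), ∫ y, φ y ∂ν = 0 →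
      inner ℂ ((hφ.sgrad κ).toL2 ν) R = 0)
    {f q : Lp C3 2 ν} (hf : (f, q) ∈ curlGraph ν) :
    ‖inner ℂ f R‖ ≤ ‖q + crossOp ν κ f‖ * ‖R‖ := by
  revert hf
  refine curlGraph_induction (P := fun f q => ‖inner ℂ f R‖ ≤ ‖q + crossOp ν κ f‖ * ‖R‖) ?_ ?_
  · refine isClosed_le ?_ ?_ <;> fun_prop
  intro u hu
  -- Index sets are enlarged to contain all three directions of each frequency, so that each block
  -- sums to an inner product of vector coefficients.
  refine norm_inner_le_of_mem_closure_span (orthonormal_emode hν) (smooth_mem_span_emode hu)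
    fun F => ⟨(F.image Prod.fst) ×ˢ Finset.univ, ?_, ?_⟩
  · intro p hp
    simp only [Finset.mem_product, Finset.mem_image, Finset.mem_univ, and_true]
    exact ⟨p, hp, rfl⟩
  set Z := hu.toL2 ν
  set q := hu.curl.toL2 ν + crossOp ν κ Z with hq
  rw [Finset.sum_product]
  have hterm : ∀ n, ‖∑ k, inner ℂ Z (emode ν (n, k)) * inner ℂ (emode ν (n, k)) R‖ ≤
      ‖fcoef ν n q‖ * ‖fcoef ν n R‖ := by
    intro n
    have h1 : ∑ k, inner ℂ Z (emode ν (n, k)) * inner ℂ (emode ν (n, k)) R =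
        inner ℂ (fcoef ν n Z) (fcoef ν n R) := by
      rw [PiLp.inner_apply]
      refine Finset.sum_congr rfl fun k _ => ?_
      rw [← inner_conj_symm Z, inner_emode, inner_emode, RCLike.inner_apply, mul_comm]
    rw [h1]
    -- At `n = 0` the frequency `κ` may be arbitrarily small and the curl gives no control; the zero
    -- mean of `R` removes this block.
    by_cases hn : n = 0
    · have h2 : fcoef ν n R = 0 := by
        have h3 := h0 (fcoef ν n R)
        rw [← vmode_zero, inner_vmode, hn] at h3
        rw [hn]
        exact inner_self_eq_zero.1 h3
      rw [h2]; simp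
    -- For `n ≠ 0` the mode has zero mean and is an admissible potential; its shifted gradient is
    -- the mode times `i(κ + 2πn)`.
    have horth : inner ℂ (iVec (κ + dualPt n)) (fcoef ν n R) = 0 := by
      rw [← inner_vmode, ← hR _ (smoothPeriodic_mode n) (integral_mode hν hn)]
      congr 1
      refine SmoothPeriodic.eq_toL2 _ ((coeFn_vmode n _).trans (Eventually.of_forall fun y => ?_))
      exact (sgrad_mode κ n y).symm
    have h4 := norm_inner_le_crossI horth (fcoef ν n Z)
    rw [← fcoef_curl hν hu] at h4
    have h5 : 1 ≤ ‖κ + dualPt n‖ :=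
      (by linarith [Real.pi_gt_three] : 1 ≤ Real.pi).trans (pi_le_norm_add_dualPt hκ hn)
    exact (le_mul_of_one_le_left (norm_nonneg _) h5).trans h4
  refine (norm_sum_le _ _).trans ((Finset.sum_le_sum fun n _ => hterm n).trans ?_)
  refine (Real.sum_mul_le_sqrt_mul_sqrt _ _ _).trans ?_
  gcongr
  · exact Real.sqrt_le_iff.2 ⟨norm_nonneg _, sum_norm_fcoef_sq_le hν _ _⟩
  · exact Real.sqrt_le_iff.2 ⟨norm_nonneg _, sum_norm_fcoef_sq_le hν _ _⟩

/-! ### From the weak formulations to `L²` operators -/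

section

variable {ν : Measure R3} {L L' L'' : R3 → C3 →ₗ[ℂ] C3}

lemma mulOp_comp (h : BddFamily L) (h' : BddFamily L') (h'' : BddFamily L'')
    (hLL : ∀ y v, L y (L' y v) = L'' y v) (f : Lp C3 2 ν) :
    mulOp ν h (mulOp ν h' f) = mulOp ν h'' f := by
  refine Lp.ext ?_
  filter_upwards [coeFn_mulOp h (mulOp ν h' f), coeFn_mulOp h' f, coeFn_mulOp h'' f] with y h1 h2 h3
  rw [h1, h2, h3, hLL]

lemma mulOp_comm (h : BddFamily L) (h' : BddFamily L')
    (hLL : ∀ y v, L y (L' y v) = L' y (L y v)) (f : Lp C3 2 ν) :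
    mulOp ν h (mulOp ν h' f) = mulOp ν h' (mulOp ν h f) := by
  refine Lp.ext ?_
  filter_upwards [coeFn_mulOp h (mulOp ν h' f), coeFn_mulOp h' f,
    coeFn_mulOp h' (mulOp ν h f), coeFn_mulOp h f] with y h1 h2 h3 h4
  rw [h1, h2, h3, h4, hLL]

lemma conjExpOp_mulOp (κ : R3) (h : BddFamily L) (f : Lp C3 2 ν) :
    conjExpOp ν κ (mulOp ν h f) = mulOp ν h (conjExpOp ν κ f) :=
  mulOp_comm (bdd_conjExpo κ) h (fun y v => by simp [conjExpoL]) f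

lemma coeFn_expOp (κ : R3) (f : Lp C3 2 ν) :
    expOp ν κ f =ᵐ[ν] fun y => expo κ y • f y := coeFn_mulOp (bdd_expo κ) f

lemma coeFn_conjExpOp (κ : R3) (f : Lp C3 2 ν) :
    conjExpOp ν κ f =ᵐ[ν] fun y => starRingEnd ℂ (expo κ y) • f y := coeFn_mulOp (bdd_conjExpo κ) f

@[simp] lemma conjExpOp_zero (f : Lp C3 2 ν) : conjExpOp ν 0 f = f := by
  refine Lp.ext ?_
  filter_upwards [coeFn_conjExpOp 0 f] with y hy
  rw [hy]; simp

@[simp] lemma crossOp_zero (f : Lp C3 2 ν) : crossOp ν 0 f = 0 := by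
  have := crossOp_smul 0 0 f
  simpa using this

lemma Lp.tendsto_of_ae {u : ℕ → R3 → C3} {f : ℕ → Lp C3 2 ν} {g : Lp C3 2 ν} {v : R3 → C3}
    (hf : ∀ n, f n =ᵐ[ν] u n) (hg : g =ᵐ[ν] v) :
    Tendsto f atTop (𝓝 g) ↔ Tendsto (fun n => eLpNorm (fun y => u n y - v y) 2 ν) atTop (𝓝 0) := by
  rw [Lp.tendsto_Lp_iff_tendsto_eLpNorm']
  refine iff_of_eq (congrArg (fun F => Tendsto F atTop (𝓝 0)) (funext fun n => ?_))
  exact eLpNorm_congr_ae ((hf n).sub hg)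

end

namespace Elliptic

variable {ν : Measure R3} {A : R3 → Matrix (Fin 3) (Fin 3) ℝ} {α β : ℝ} (h : Elliptic A α β)
include h

lemma mulOp_msqrt_inv (f : Lp C3 2 ν) :
    mulOp ν h.bdd_msqrt (mulOp ν h.bdd_msqrt_inv f) = f :=
  mulOp_mulOp h.bdd_msqrt h.bdd_msqrt_inv (fun y v => act_act_inv (h.isUnit_det_msqrt y) v) f

lemma mulOp_inv_msqrt (f : Lp C3 2 ν) :
    mulOp ν h.bdd_msqrt_inv (mulOp ν h.bdd_msqrt f) = f :=
  mulOp_mulOp h.bdd_msqrt_inv h.bdd_msqrt (fun y v => act_inv_act (h.isUnit_det_msqrt y) v) f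

lemma inner_msqrt_inv (f g : Lp C3 2 ν) :
    inner ℂ (mulOp ν h.bdd_msqrt_inv f) g = inner ℂ f (mulOp ν h.bdd_msqrt_inv g) :=
  inner_mulOp h.bdd_msqrt_inv h.bdd_msqrt_inv (fun y => inner_act (h.msqrt_inv_symm y)) f g

lemma mulOp_msqrt_inv_inv (f : Lp C3 2 ν) :
    mulOp ν h.bdd_msqrt_inv (mulOp ν h.bdd_msqrt_inv f) = mulOp ν h.bdd_inv f :=
  mulOp_comp h.bdd_msqrt_inv h.bdd_msqrt_inv h.bdd_inv h.act_msqrt_inv_inv f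

end Elliptic

variable {μ : Measure R3} [IsProbabilityMeasure (μ.restrict cell)]
  {A At : R3 → Matrix (Fin 3) (Fin 3) ℝ} {α β : ℝ}

/-- Multiplications by `A^{1/2}` and `conj(e_κ)` are bounded, so they carry the approximating
sequence over to smooth fields; `curl_expo_smul` identifies the curls. All dependence on `κ` and `A`
leaves the function space. -/
lemma IsCurlPair.mem_curlGraph (h : Elliptic A α β) {κ : R3} {u w : R3 → C3}
    (hp : IsCurlPair μ A κ u w) :
    (mulOp (μ.restrict cell) h.bdd_msqrt (hp.1.toLp u),
      conjExpOp (μ.restrict cell) κ (hp.2.1.toLp w) -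
        crossOp (μ.restrict cell) κ (mulOp (μ.restrict cell) h.bdd_msqrt (hp.1.toLp u))) ∈
      curlGraph (μ.restrict cell) := by
  obtain ⟨hu, hw, φ, hφ, h1, h2⟩ := hp
  set V := mulOp (μ.restrict cell) h.bdd_msqrt (hu.toLp u) with hV
  have hφeq : ∀ n, (mulOp (μ.restrict cell) h.bdd_msqrt_inv ((hφ n).toL2 (μ.restrict cell))) =ᵐ[(μ.restrict cell)] φ n := fun n => by
    filter_upwards [coeFn_mulOp h.bdd_msqrt_inv ((hφ n).toL2 (μ.restrict cell)), (hφ n).coeFn_toL2 (ν := μ.restrict cell)]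
      with y h3 h4
    rw [h3, h4]
    exact act_inv_act (h.isUnit_det_msqrt y) _
  have t1 : Tendsto (fun n => expOp (μ.restrict cell) κ (mulOp (μ.restrict cell) h.bdd_msqrt_inv ((hφ n).toL2 (μ.restrict cell)))) atTop
      (𝓝 (expOp (μ.restrict cell) κ (hu.toLp u))) := by
    refine (Lp.tendsto_of_ae (fun n => ?_) ?_).2 h1
    · filter_upwards [coeFn_expOp κ (mulOp (μ.restrict cell) h.bdd_msqrt_inv ((hφ n).toL2 (μ.restrict cell))), hφeq n] with y h3 h4
      rw [h3, h4]
    · filter_upwards [coeFn_expOp κ (hu.toLp u), hu.coeFn_toLp] with y h3 h4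
      rw [h3, h4]
  have t2 : Tendsto (fun n => (hφ n).toL2 (μ.restrict cell)) atTop (𝓝 V) := by
    have := ((mulOp (μ.restrict cell) h.bdd_msqrt).continuous.tendsto _).comp
      (((conjExpOp (μ.restrict cell) κ).continuous.tendsto _).comp t1)
    simpa only [Function.comp_def, conjExpOp_expOp, h.mulOp_msqrt_inv] using this
  have t3 : Tendsto (fun n => expOp (μ.restrict cell) κ ((hφ n).curl.toL2 (μ.restrict cell) + crossOp (μ.restrict cell) κ ((hφ n).toL2 (μ.restrict cell)))) atTop
      (𝓝 (hw.toLp w)) := by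
    refine (Lp.tendsto_of_ae (fun n => ?_) hw.coeFn_toLp).2 h2
    filter_upwards [coeFn_expOp κ ((hφ n).curl.toL2 (μ.restrict cell) + crossOp (μ.restrict cell) κ ((hφ n).toL2 (μ.restrict cell))),
      Lp.coeFn_add ((hφ n).curl.toL2 (μ.restrict cell)) (crossOp (μ.restrict cell) κ ((hφ n).toL2 (μ.restrict cell))),
      coeFn_crossOp κ ((hφ n).toL2 (μ.restrict cell)), (hφ n).coeFn_toL2 (ν := μ.restrict cell), (hφ n).curl.coeFn_toL2 (ν := μ.restrict cell)]
      with y e1 e2 e3 e4 e5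
    rw [e1, e2, Pi.add_apply, e3, e4, e5, curl_expo_smul (hφ n)]
  have t4 : Tendsto (fun n => (hφ n).curl.toL2 (μ.restrict cell)) atTop
      (𝓝 (conjExpOp (μ.restrict cell) κ (hw.toLp w) - crossOp (μ.restrict cell) κ V)) := by
    have := (((conjExpOp (μ.restrict cell) κ).continuous.tendsto _).comp t3).sub
      (((crossOp (μ.restrict cell) κ).continuous.tendsto _).comp t2)
    simpa only [Function.comp_def, conjExpOp_expOp, add_sub_cancel_right] using this
  exact (smoothCurl (μ.restrict cell)).isClosed_topologicalClosure.mem_of_tendsto (t2.prodMk_nhds t4)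
    (Eventually.of_forall fun n => smooth_mem_curlGraph (hφ n))

/-- Conversely, every element of the graph yields a test pair of the original weak problems, with `φ
= A^{-1/2}f`; the approximants need only `A^{1/2}φ` to be smooth. -/
lemma isCurlPair_of_mem (h : Elliptic A α β) {f q : Lp C3 2 (μ.restrict cell)}
    (hfq : (f, q) ∈ curlGraph (μ.restrict cell)) (κ : R3) :
    IsCurlPair μ A κ (mulOp (μ.restrict cell) h.bdd_msqrt_inv f)
      (expOp (μ.restrict cell) κ (q + crossOp (μ.restrict cell) κ f)) := by
  refine ⟨Lp.memLp _, Lp.memLp _, ?_⟩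
  obtain ⟨p, hp, hlim⟩ := mem_closure_iff_seq_limit.1 hfq
  choose φ hφ h1 h2 using hp
  have hφ' : ∀ n, (fun y => act (msqrt (A y)) (act (msqrt (A y))⁻¹ (φ n y))) = φ n := fun n =>
    funext fun y => act_act_inv (h.isUnit_det_msqrt y) _
  have l1 : Tendsto (fun n => (p n).1) atTop (𝓝 f) := (continuous_fst.tendsto _).comp hlim
  have l2 : Tendsto (fun n => (p n).2) atTop (𝓝 q) := (continuous_snd.tendsto _).comp hlim
  refine ⟨fun n y => act (msqrt (A y))⁻¹ (φ n y), fun n => ?_, ?_, ?_⟩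
  · rw [hφ' n]; exact hφ n
  · have t1 := ((expOp (μ.restrict cell) κ).continuous.tendsto _).comp
      (((mulOp (μ.restrict cell) h.bdd_msqrt_inv).continuous.tendsto _).comp l1)
    refine (Lp.tendsto_of_ae (fun n => ?_) ?_).1 t1
    · filter_upwards [coeFn_expOp κ (mulOp (μ.restrict cell) h.bdd_msqrt_inv (p n).1),
        coeFn_mulOp h.bdd_msqrt_inv (p n).1, h1 n] with y e1 e2 e3
      rw [Function.comp_apply, Function.comp_apply, e1, e2, e3, actL_apply]
    · exact coeFn_expOp κ _
  · have t2 := ((expOp (μ.restrict cell) κ).continuous.tendsto _).comp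
      (l2.add (((crossOp (μ.restrict cell) κ).continuous.tendsto _).comp l1))
    refine (Lp.tendsto_of_ae (fun n => ?_) EventuallyEq.rfl).1 t2
    have hc : ∀ n y, curl (fun x => expo κ x • act (msqrt (A x)) (act (msqrt (A x))⁻¹ (φ n x))) y =
        expo κ y • (curl (φ n) y + cact (crossI κ) (φ n y)) := fun n y => by
      rw [← curl_expo_smul (hφ n)]
      congr 1
      exact funext fun x => congrArg (expo κ x • ·) (congrFun (hφ' n) x)
    filter_upwards [coeFn_expOp κ ((p n).2 + crossOp (μ.restrict cell) κ (p n).1),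
      Lp.coeFn_add (p n).2 (crossOp (μ.restrict cell) κ (p n).1), coeFn_crossOp κ (p n).1, h1 n, h2 n]
      with y e1 e2 e3 e4 e5
    rw [hc, Function.comp_apply, Function.comp_apply, e1, e2, Pi.add_apply, e3, e4, e5]

/-- The Maxwell system, tested against the graph of the curl. -/
lemma IsMaxwellSolution.inner_eq {αt βt : ℝ} (h : Elliptic A α β) (ht : Elliptic At αt βt) {ε : ℝ}
    {κ : R3} {G D w : R3 → C3} (hG : MemLp G 2 (μ.restrict cell))
    (hs : IsMaxwellSolution μ A At ε κ G D w) {f q : Lp C3 2 (μ.restrict cell)}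
    (hfq : (f, q) ∈ curlGraph (μ.restrict cell)) :
    ((ε ^ 2 : ℝ) : ℂ)⁻¹ * inner ℂ (q + crossOp (μ.restrict cell) κ f)
        (mulOp (μ.restrict cell) ht.bdd (conjExpOp (μ.restrict cell) κ (hs.1.2.1.toLp w)))
      + inner ℂ f (mulOp (μ.restrict cell) h.bdd_inv
          (mulOp (μ.restrict cell) h.bdd_msqrt (hs.1.1.toLp D)))
      = -inner ℂ f (hG.toLp G) := by
  have key := hs.2 _ _ (isCurlPair_of_mem h hfq κ)
  have hD : MemLp D 2 (μ.restrict cell) := hs.1.1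
  have hw : MemLp w 2 (μ.restrict cell) := hs.1.2.1
  have e1 : ∫ y, inner ℂ (expOp (μ.restrict cell) κ (q + crossOp (μ.restrict cell) κ f) y) (act (At y) (w y)) ∂(μ.restrict cell) =
      inner ℂ (q + crossOp (μ.restrict cell) κ f) (mulOp (μ.restrict cell) ht.bdd (conjExpOp (μ.restrict cell) κ (hw.toLp w))) := by
    rw [← conjExpOp_mulOp, ← inner_expOp, mulOp_toLp, L2.inner_def]
    refine integral_congr_ae ?_
    filter_upwards [(ht.bdd.memLp hw).coeFn_toLp] with y hy
    rw [hy, actL_apply]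
  have e2 : ∫ y, inner ℂ (mulOp (μ.restrict cell) h.bdd_msqrt_inv f y) (D y) ∂(μ.restrict cell) =
      inner ℂ f (mulOp (μ.restrict cell) h.bdd_inv (mulOp (μ.restrict cell) h.bdd_msqrt (hD.toLp D))) := by
    rw [← h.mulOp_msqrt_inv_inv, h.mulOp_inv_msqrt, ← h.inner_msqrt_inv, L2.inner_def]
    refine integral_congr_ae ?_
    filter_upwards [hD.coeFn_toLp] with y hy
    rw [hy]
  have e3 : ∫ y, inner ℂ (mulOp (μ.restrict cell) h.bdd_msqrt_inv f y) (act (msqrt (A y)) (G y)) ∂(μ.restrict cell) =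
      inner ℂ f (hG.toLp G) := by
    conv_rhs => rw [← h.mulOp_inv_msqrt (hG.toLp G)]
    rw [← h.inner_msqrt_inv, mulOp_toLp, L2.inner_def]
    refine integral_congr_ae ?_
    filter_upwards [(h.bdd_msqrt.memLp hG).coeFn_toLp] with y hy
    rw [hy, actL_apply]
  rw [e1, e2, e3] at key
  exact key

lemma IsDivFree.inner_eq_zero {κ : R3} {G : R3 → C3} (hG : MemLp G 2 (μ.restrict cell))
    (hdiv : IsDivFree μ κ G) {φ : R3 → ℂ} (hφ : SmoothPeriodic φ) :
    inner ℂ ((hφ.sgrad κ).toL2 (μ.restrict cell)) (hG.toLp G) = 0 := by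
  rw [← hdiv φ hφ, L2.inner_def]
  refine integral_congr_ae ?_
  filter_upwards [hG.coeFn_toLp, (hφ.sgrad κ).coeFn_toL2 (ν := μ.restrict cell)] with y h1 h2
  rw [h1, h2, grad_expo_mul hφ, inner_smul_left, inner_smul_right, ← mul_assoc, conj_expo_mul,
    one_mul]

/-- Gradients are limits of shifted gradients of smooth functions of zero mean. -/
lemma IsGradPair.mem_closure {κ : R3} {ψ : R3 → ℂ} {g : R3 → C3} (hp : IsGradPair μ κ ψ g)
    {P : Lp C3 2 (μ.restrict cell) → Prop} (hc : IsClosed {f | P f})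
    (hs : ∀ (φ : R3 → ℂ) (hφ : SmoothPeriodic φ), ∫ y in cell, φ y ∂μ = 0 →
      P ((hφ.sgrad κ).toL2 (μ.restrict cell))) :
    P (conjExpOp (μ.restrict cell) κ (hp.2.1.toLp g)) := by
  obtain ⟨hψ, hg, φ, hφ, -, h2⟩ := hp
  have t1 : Tendsto (fun n => expOp (μ.restrict cell) κ (((hφ n).1.sgrad κ).toL2 (μ.restrict cell))) atTop (𝓝 (hg.toLp g)) := by
    refine (Lp.tendsto_of_ae (fun n => ?_) hg.coeFn_toLp).2 h2
    filter_upwards [coeFn_expOp κ (((hφ n).1.sgrad κ).toL2 (μ.restrict cell)),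
      ((hφ n).1.sgrad κ).coeFn_toL2 (ν := μ.restrict cell)] with y e1 e2
    rw [e1, e2, grad_expo_mul (hφ n).1]
  have t2 := ((conjExpOp (μ.restrict cell) κ).continuous.tendsto _).comp t1
  simp only [Function.comp_def, conjExpOp_expOp] at t2
  exact hc.mem_of_tendsto t2 (Eventually.of_forall fun n => hs _ (hφ n).1 (hφ n).2)

lemma sgrad_mem_curlGraph {κ : R3} {φ : R3 → ℂ} (hφ : SmoothPeriodic φ) {ν : Measure R3}
    [IsFiniteMeasure ν] :
    ((hφ.sgrad κ).toL2 ν, -crossOp ν κ ((hφ.sgrad κ).toL2 ν)) ∈ curlGraph ν := by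
  have h := smooth_mem_curlGraph (ν := ν) (hφ.sgrad κ)
  have : (hφ.sgrad κ).curl.toL2 ν = -crossOp ν κ ((hφ.sgrad κ).toL2 ν) := by
    refine Lp.ext ?_
    filter_upwards [(hφ.sgrad κ).curl.coeFn_toL2 (ν := ν),
      Lp.coeFn_neg (crossOp ν κ ((hφ.sgrad κ).toL2 ν)), coeFn_crossOp κ ((hφ.sgrad κ).toL2 ν),
      (hφ.sgrad κ).coeFn_toL2 (ν := ν)] with y e1 e2 e3 e4
    rw [e1, e2, Pi.neg_apply, e3, e4, curl_sgrad hφ]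
  rwa [← this]

/-- The mean of `∇φ` vanishes by the hypothesis on the measure, that of `φ iκ` because `φ` has zero
mean. Passing to limits makes the gradient correctors orthogonal to constants. -/
lemma integral_sgrad_eq_zero {ν : Measure R3} [IsProbabilityMeasure ν]
    (hν : ZeroMeanDerivatives ν) (κ : R3) {φ : R3 → ℂ} (hφ : SmoothPeriodic φ)
    (h0 : ∫ y, φ y ∂ν = 0) (a : C3) :
    inner ℂ (constOp ν a) ((hφ.sgrad κ).toL2 ν) = 0 := by
  rw [inner_constOp, integral_congr_ae ((hφ.sgrad κ).coeFn_toL2 (ν := ν))]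
  have hint : Integrable (sgrad κ φ) ν := ((hφ.sgrad κ).memLp (ν := ν)).integrable (by norm_num)
  have hint1 : ∀ j, Integrable (pderiv j φ) ν := fun j =>
    ((hφ.pderiv j).memLp (ν := ν)).integrable (by norm_num)
  have hint2 : Integrable φ ν := (hφ.memLp (ν := ν)).integrable (by norm_num)
  have : ∫ y, sgrad κ φ y ∂ν = 0 := by
    ext j
    refine ((EuclideanSpace.proj (𝕜 := ℂ) j : C3 →L[ℂ] ℂ).integral_comp_comm hint).symm.trans ?_
    change ∫ y, (pderiv j φ y + φ y * iVec κ j) ∂ν = 0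
    rw [integral_add (hint1 j) (hint2.mul_const _), hν φ hφ, integral_mul_const, h0]
    simp
  rw [this, inner_zero_right]

lemma IsPsiSolution.inner_eq_zero (h : Elliptic A α β) {κ : R3} {Ψ : Fin 3 → R3 → ℂ}
    {g : Fin 3 → R3 → C3} (hs : IsPsiSolution μ A κ Ψ g) (j : Fin 3) {φ : R3 → ℂ}
    (hφ : SmoothPeriodic φ) (h0 : ∫ y in cell, φ y ∂μ = 0) :
    inner ℂ ((hφ.sgrad κ).toL2 (μ.restrict cell)) (mulOp (μ.restrict cell) h.bdd_inv
      (conjExpOp (μ.restrict cell) κ ((hs j).1.2.1.toLp (g j)) +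
        constOp (μ.restrict cell) (EuclideanSpace.single j 1))) = 0 := by
  have key := (hs j).2 φ ⟨hφ, h0⟩
  have hg := (hs j).1.2.1
  have e : ∀ (v : R3 → C3) (hv : MemLp v 2 (μ.restrict cell)),
      ∫ y, inner ℂ (grad (fun x => expo κ x * φ x) y) (act (A y)⁻¹ (v y)) ∂(μ.restrict cell) =
      inner ℂ ((hφ.sgrad κ).toL2 (μ.restrict cell)) (mulOp (μ.restrict cell) h.bdd_inv (conjExpOp (μ.restrict cell) κ (hv.toLp v))) := by
    intro v hv
    rw [← conjExpOp_mulOp, ← inner_expOp, mulOp_toLp, L2.inner_def]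
    refine integral_congr_ae ?_
    filter_upwards [(h.bdd_inv.memLp hv).coeFn_toLp, coeFn_expOp κ ((hφ.sgrad κ).toL2 (μ.restrict cell)),
      (hφ.sgrad κ).coeFn_toL2 (ν := μ.restrict cell)] with y e1 e2 e3
    rw [e1, e2, e3, grad_expo_mul hφ, actL_apply]
  have hm : MemLp (fun y => expo κ y • (EuclideanSpace.single j 1 : C3)) 2 (μ.restrict cell) :=
    (bdd_expo κ).memLp (memLp_const _)
  have hm' : hm.toLp _ = expOp (μ.restrict cell) κ (constOp (μ.restrict cell) (EuclideanSpace.single j 1)) := by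
    rw [constOp_eq_toLp, expOp, mulOp_toLp]; rfl
  rw [e _ hg, e _ hm, hm', conjExpOp_expOp] at key
  rw [map_add, inner_add_right, key, neg_add_cancel]

lemma IsCurlCellSolution.mem_curlGraph (h : Elliptic A α β) {N W : Fin 3 → R3 → C3}
    (hs : IsCurlCellSolution μ A At N W) (j : Fin 3) :
    (mulOp (μ.restrict cell) h.bdd_msqrt ((hs j).1.1.toLp (N j)),
      (hs j).1.2.1.toLp (W j)) ∈ curlGraph (μ.restrict cell) := by
  have := (hs j).1.mem_curlGraph h
  simpa using this

/-- The cell problem is posed against zero-mean fields only. Subtracting the mean from `f` keeps the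
pair in the graph and leaves `q` unchanged, so the restriction disappears. -/
lemma IsCurlCellSolution.inner_eq_zero {αt βt : ℝ} (h : Elliptic A α β) (ht : Elliptic At αt βt)
    {N W : Fin 3 → R3 → C3} (hs : IsCurlCellSolution μ A At N W) (j : Fin 3)
    {f q : Lp C3 2 (μ.restrict cell)} (hfq : (f, q) ∈ curlGraph (μ.restrict cell)) :
    inner ℂ q (mulOp (μ.restrict cell) ht.bdd ((hs j).1.2.1.toLp (W j) +
      constOp (μ.restrict cell) (EuclideanSpace.single j 1))) = 0 := by
  have hW := (hs j).1.2.1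
  set f' := f - constOp (μ.restrict cell) (∫ y, f y ∂(μ.restrict cell)) with hf'
  have hfq' : (f', q) ∈ curlGraph (μ.restrict cell) := by
    have := (curlGraph (μ.restrict cell)).sub_mem hfq (const_mem_curlGraph (∫ y, f y ∂(μ.restrict cell)))
    simpa using this
  have hmean : ∫ y, act (msqrt (A y)) (mulOp (μ.restrict cell) h.bdd_msqrt_inv f' y) ∂(μ.restrict cell) = 0 := by
    have h1 : (fun y => act (msqrt (A y)) (mulOp (μ.restrict cell) h.bdd_msqrt_inv f' y)) =ᵐ[(μ.restrict cell)]
        fun y => f y - ∫ y, f y ∂(μ.restrict cell) := by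
      filter_upwards [coeFn_mulOp h.bdd_msqrt_inv f', Lp.coeFn_sub f (constOp (μ.restrict cell) (∫ y, f y ∂(μ.restrict cell))),
        coeFn_constOp (ν := μ.restrict cell) (∫ y, f y ∂(μ.restrict cell))] with y e1 e2 e3
      rw [e1, actL_apply, act_act_inv (h.isUnit_det_msqrt y), e2, Pi.sub_apply, e3]
    rw [integral_congr_ae h1, integral_sub ((Lp.memLp f).integrable (by norm_num))
      (integrable_const _)]
    simp
  have key := (hs j).2.2.2 _ _ (isCurlPair_of_mem h hfq' 0) hmean
  have e : ∀ (v : R3 → C3) (hv : MemLp v 2 (μ.restrict cell)),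
      ∫ y, inner ℂ (expOp (μ.restrict cell) 0 (q + crossOp (μ.restrict cell) 0 f') y) (act (At y) (v y)) ∂(μ.restrict cell) =
      inner ℂ q (mulOp (μ.restrict cell) ht.bdd (hv.toLp v)) := by
    intro v hv
    rw [mulOp_toLp, L2.inner_def]
    refine integral_congr_ae ?_
    filter_upwards [(ht.bdd.memLp hv).coeFn_toLp, coeFn_expOp 0 (q + crossOp (μ.restrict cell) 0 f')]
      with y e1 e2
    rw [e1, e2, actL_apply, crossOp_zero, add_zero, expo_zero, one_smul]
  rw [e _ hW, e _ (memLp_const _), ← constOp_eq_toLp] at key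
  rw [map_add, inner_add_right, key, neg_add_cancel]

/-! ### Homogenised matrices -/

lemma cact_of (m : Fin 3 → C3) (ζ : C3) :
    cact (Matrix.of fun i j => m j i) ζ = ∑ j, ζ j • m j := by
  ext i
  simp [cact, Matrix.mulVec, dotProduct, mul_comm]

/-- The linear combination of three fields with given coefficients. -/
noncomputable def comb {H : Type*} [AddCommGroup H] [Module ℂ H] (F : Fin 3 → H) (ζ : C3) : H :=
  ∑ j, ζ j • F j

lemma comb_add {H : Type*} [AddCommGroup H] [Module ℂ H] (F F' : Fin 3 → H) (ζ : C3) :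
    comb (fun j => F j + F' j) ζ = comb F ζ + comb F' ζ := by
  simp [comb, Finset.sum_add_distrib]

lemma map_comb {H H' : Type*} [AddCommGroup H] [Module ℂ H] [AddCommGroup H'] [Module ℂ H']
    (T : H →ₗ[ℂ] H') (F : Fin 3 → H) (ζ : C3) : T (comb F ζ) = comb (fun j => T (F j)) ζ := by
  simp [comb]

lemma comb_single (ζ : C3) : comb (fun j => (EuclideanSpace.single j 1 : C3)) ζ = ζ := by
  ext k
  fin_cases k <;> simp [comb, Fin.sum_univ_three]

/-- Expresses a matrix with columns `m j` as a sesquilinear form on constant fields; both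
homogenised matrices are used only in this form. -/
lemma inner_cact_of {ν : Measure R3} [IsProbabilityMeasure ν] {L : R3 → C3 →ₗ[ℂ] C3}
    (h : BddFamily L) (F : Fin 3 → Lp C3 2 ν) (m : Fin 3 → C3)
    (hm : ∀ j, m j = ∫ y, mulOp ν h (F j + constOp ν (EuclideanSpace.single j 1)) y ∂ν) (a ζ : C3) :
    inner ℂ a (cact (Matrix.of fun i j => m j i) ζ) =
      inner ℂ (constOp ν a) (mulOp ν h (comb F ζ + constOp ν ζ)) := by
  have h1 : constOp ν ζ = comb (fun j => constOp ν (EuclideanSpace.single j 1)) ζ := by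
    conv_lhs => rw [← comb_single ζ]
    exact map_comb (constOp ν).toLinearMap _ ζ
  have h2 : mulOp ν h (comb F ζ + constOp ν ζ) =
      comb (fun j => mulOp ν h (F j + constOp ν (EuclideanSpace.single j 1))) ζ := by
    rw [h1, ← comb_add]
    exact map_comb (mulOp ν h).toLinearMap _ ζ
  rw [cact_of, h2, comb, inner_sum, inner_sum]
  refine Finset.sum_congr rfl fun j _ => ?_
  rw [inner_smul_right, inner_smul_right, inner_constOp, hm]

lemma inner_homHat (h : Elliptic A α β) {κ : R3} {g : Fin 3 → R3 → C3}
    (hg : ∀ j, MemLp (g j) 2 (μ.restrict cell)) (a ζ : C3) :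
    inner ℂ a (cact (homHat μ A κ g) ζ) =
      inner ℂ (constOp (μ.restrict cell) a) (mulOp (μ.restrict cell) h.bdd_inv
        (comb (fun j => conjExpOp (μ.restrict cell) κ ((hg j).toLp (g j))) ζ +
          constOp (μ.restrict cell) ζ)) := by
  refine inner_cact_of h.bdd_inv _ (fun j => ∫ y in cell, act (A y)⁻¹
    (starRingEnd ℂ (expo κ y) • g j y + (EuclideanSpace.single j 1 : C3)) ∂μ) (fun j => ?_) a ζ
  refine integral_congr_ae ?_
  filter_upwards [coeFn_mulOp h.bdd_inv (conjExpOp (μ.restrict cell) κ ((hg j).toLp (g j)) +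
      constOp (μ.restrict cell) (EuclideanSpace.single j 1)),
    Lp.coeFn_add (conjExpOp (μ.restrict cell) κ ((hg j).toLp (g j))) (constOp (μ.restrict cell) (EuclideanSpace.single j 1)),
    coeFn_conjExpOp κ ((hg j).toLp (g j)), (hg j).coeFn_toLp,
    coeFn_constOp (ν := μ.restrict cell) (EuclideanSpace.single j 1)] with y e1 e2 e3 e4 e5
  rw [e1, e2, Pi.add_apply, e3, e4, e5, actL_apply]

lemma inner_homTilde (h : Elliptic At α β) {W : Fin 3 → R3 → C3}
    (hW : ∀ j, MemLp (W j) 2 (μ.restrict cell)) (a ζ : C3) :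
    inner ℂ a (cact (homTilde μ At W) ζ) =
      inner ℂ (constOp (μ.restrict cell) a) (mulOp (μ.restrict cell) h.bdd
        (comb (fun j => (hW j).toLp (W j)) ζ + constOp (μ.restrict cell) ζ)) := by
  refine inner_cact_of h.bdd _ (fun j => ∫ y in cell, act (At y)
    (W j y + (EuclideanSpace.single j 1 : C3)) ∂μ) (fun j => ?_) a ζ
  refine integral_congr_ae ?_
  filter_upwards [coeFn_mulOp h.bdd ((hW j).toLp (W j) + constOp (μ.restrict cell) (EuclideanSpace.single j 1)),
    Lp.coeFn_add ((hW j).toLp (W j)) (constOp (μ.restrict cell) (EuclideanSpace.single j 1)),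
    (hW j).coeFn_toLp, coeFn_constOp (ν := μ.restrict cell) (EuclideanSpace.single j 1)] with y e1 e2 e3 e4
  rw [e1, e2, Pi.add_apply, e3, e4, actL_apply]

/-- The homogenised matrix of the curl cell problem does not depend on the solution. -/
lemma homTilde_eq {αt βt : ℝ} (h : Elliptic A α β) (ht : Elliptic At αt βt)
    {N W N' W' : Fin 3 → R3 → C3} (hs : IsCurlCellSolution μ A At N W)
    (hs' : IsCurlCellSolution μ A At N' W') : homTilde μ At W = homTilde μ At W' := by
  have hW : ∀ j, W j =ᵐ[μ.restrict cell] W' j := by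
    intro j
    -- The difference of the solutions is a test pair for both cell problems, so its curl has zero
    -- energy and vanishes by ellipticity.
    have hm := (curlGraph (μ.restrict cell)).sub_mem (hs.mem_curlGraph h j) (hs'.mem_curlGraph h j)
    rw [Prod.mk_sub_mk] at hm
    have h1 := hs.inner_eq_zero h ht j hm
    have h2 := hs'.inner_eq_zero h ht j hm
    set q := (hs j).1.2.1.toLp (W j) - (hs' j).1.2.1.toLp (W' j) with hq
    have h3 : inner ℂ q (mulOp (μ.restrict cell) ht.bdd q) = 0 := by
      have : q = ((hs j).1.2.1.toLp (W j) + constOp (μ.restrict cell) (EuclideanSpace.single j 1)) -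
          ((hs' j).1.2.1.toLp (W' j) + constOp (μ.restrict cell) (EuclideanSpace.single j 1)) := by
        rw [hq]; abel
      have h3 := congrArg (fun p => inner ℂ q (mulOp (μ.restrict cell) ht.bdd p)) this
      refine h3.trans ?_
      rw [map_sub, inner_sub_right, h1, h2, sub_zero]
    have h4 := mulOp_lower ht.bdd ht.lower q
    rw [h3] at h4
    have h5 : q = 0 := by
      have := ht.pos
      rw [← norm_eq_zero, ← pow_eq_zero_iff two_ne_zero]
      refine le_antisymm ?_ (sq_nonneg _)
      rw [Complex.zero_re] at h4
      exact le_of_mul_le_mul_left (by rwa [mul_zero]) this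
    rw [hq, sub_eq_zero] at h5
    exact (MemLp.toLp_eq_toLp_iff _ _).1 h5
  ext i j
  change (∫ y in cell, act (At y) (W j y + (EuclideanSpace.single j 1 : C3)) ∂μ) i =
    (∫ y in cell, act (At y) (W' j y + (EuclideanSpace.single j 1 : C3)) ∂μ) i
  refine congrArg (fun v : C3 => v i) (integral_congr_ae ?_)
  filter_upwards [hW j] with y hy
  rw [hy]

/-! ### The effective problem in `ℂ³` -/

lemma isUnit_of_coercive {M : Matrix (Fin 3) (Fin 3) ℂ} {b : ℝ} (hb : 0 < b)
    (h : ∀ ζ, b * ‖ζ‖ ^ 2 ≤ (inner ℂ ζ (cact M ζ)).re) : IsUnit M := by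
  rw [Matrix.isUnit_iff_isUnit_det, isUnit_iff_ne_zero]
  intro h0
  obtain ⟨x, hx, hx'⟩ := Matrix.exists_mulVec_eq_zero_iff.2 h0
  have h1 := h (WithLp.toLp 2 x)
  have h2 : cact M (WithLp.toLp 2 x) = 0 := by simp [cact, hx']
  rw [h2, inner_zero_right, Complex.zero_re] at h1
  have h3 : ‖(WithLp.toLp 2 x : C3)‖ ^ 2 ≤ 0 := le_of_mul_le_mul_left (by rwa [mul_zero]) hb
  have h4 : (WithLp.toLp 2 x : C3) = 0 :=
    norm_eq_zero.1 (pow_eq_zero_iff two_ne_zero |>.1 (le_antisymm h3 (sq_nonneg _)))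
  exact hx (by simpa using h4)

lemma cact_effective (θ : R3) {Ah At : Matrix (Fin 3) (Fin 3) ℂ} (hAh : IsUnit Ah) (d : C3) :
    cact (effective θ Ah At) (cact Ah d) =
      cact (crossI θ) (cact At (cact (crossI θ) d)) + cact Ah d := by
  rw [effective, add_cact, cact_one, cact_mul, cact_mul, cact_mul, ← cact_mul Ah⁻¹,
    Matrix.nonsing_inv_mul _ ((Matrix.isUnit_iff_isUnit_det _).1 hAh), cact_one]

lemma inner_cross_cross (θ : R3) (M : Matrix (Fin 3) (Fin 3) ℂ) (d : C3) :
    inner ℂ d (cact (crossI θ) (cact M (cact (crossI θ) d))) =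
      inner ℂ (cact (crossI θ) d) (cact M (cact (crossI θ) d)) := (inner_crossI _ _ _).symm

/-- Multiplying by `Ah` on the right clears the inverse and leaves `iθ × At iθ× + Ah`. As `iθ×` is
Hermitian, the first summand has a form with nonnegative real part, so the coercivity of `Ah` is
inherited. -/
lemma isUnit_effective {θ : R3} {Ah At : Matrix (Fin 3) (Fin 3) ℂ} {a b : ℝ} (ha : 0 < a)
    (hb : 0 < b) (hAh : ∀ ζ, b * ‖ζ‖ ^ 2 ≤ (inner ℂ ζ (cact Ah ζ)).re)
    (hAt : ∀ ζ, a * ‖ζ‖ ^ 2 ≤ (inner ℂ ζ (cact At ζ)).re) : IsUnit (effective θ Ah At) := by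
  have hu := isUnit_of_coercive hb hAh
  have hdet := (Matrix.isUnit_iff_isUnit_det _).1 hu
  have h1 : IsUnit (effective θ Ah At * Ah) := by
    refine isUnit_of_coercive hb fun ζ => ?_
    rw [cact_mul, cact_effective θ hu, inner_add_right, inner_cross_cross, Complex.add_re]
    have h2 := hAt (cact (crossI θ) ζ)
    have h3 : 0 ≤ a * ‖cact (crossI θ) ζ‖ ^ 2 := by positivity
    linarith [hAh ζ]
  have h2 := h1.mul ((Matrix.isUnit_nonsing_inv_iff (A := Ah)).2 hu)
  rwa [mul_assoc, Matrix.mul_nonsing_inv _ hdet, mul_one] at h2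

lemma effective_equation {θ : R3} {Ah At : Matrix (Fin 3) (Fin 3) ℂ} (hAh : IsUnit Ah)
    (hM : IsUnit (effective θ Ah At)) {d γ : C3}
    (hd : d = WithLp.toLp 2 (-((Ah⁻¹ * (effective θ Ah At)⁻¹).mulVec γ.ofLp))) :
    cact (crossI θ) (cact At (cact (crossI θ) d)) + cact Ah d = -γ := by
  have h1 : d = cact Ah⁻¹ (cact (effective θ Ah At)⁻¹ (-γ)) := by
    rw [← cact_mul, hd]
    simp [cact, Matrix.mulVec_neg]
  rw [← cact_effective θ hAh, h1, ← cact_mul Ah, Matrix.mul_nonsing_inv _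
    ((Matrix.isUnit_iff_isUnit_det _).1 hAh), cact_one, ← cact_mul, Matrix.mul_nonsing_inv _
    ((Matrix.isUnit_iff_isUnit_det _).1 hM), cact_one]

/-- A priori bounds for the effective equation. -/
lemma effective_bounds {θ : R3} {Ah At : Matrix (Fin 3) (Fin 3) ℂ} {a b K : ℝ} (ha : 0 < a)
    (hb : 0 < b) (hAh : ∀ ζ, b * ‖ζ‖ ^ 2 ≤ (inner ℂ ζ (cact Ah ζ)).re)
    (hK : ∀ ζ, ‖cact Ah ζ‖ ≤ K * ‖ζ‖)
    (hAt : ∀ ζ, a * ‖ζ‖ ^ 2 ≤ (inner ℂ ζ (cact At ζ)).re) {d γ : C3}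
    (hd : cact (crossI θ) (cact At (cact (crossI θ) d)) + cact Ah d = -γ) :
    ‖d‖ ≤ b⁻¹ * ‖γ‖ ∧ ‖cact (crossI θ) d‖ ≤ √(a⁻¹ * b⁻¹) * ‖γ‖ ∧
      ‖θ‖ * ‖cact (crossI θ) d‖ ≤ a⁻¹ * (1 + K * b⁻¹) * ‖γ‖ := by
  set c := cact (crossI θ) d with hc
  have h1 : (inner ℂ d (-γ)).re = (inner ℂ c (cact At c)).re + (inner ℂ d (cact Ah d)).re := by
    rw [← hd, inner_add_right, hc, inner_cross_cross, Complex.add_re]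
  have h2 : (inner ℂ d (-γ)).re ≤ ‖d‖ * ‖γ‖ := by
    have := re_inner_le_norm (𝕜 := ℂ) d (-γ)
    rwa [norm_neg] at this
  have h3 : a * ‖c‖ ^ 2 + b * ‖d‖ ^ 2 ≤ ‖d‖ * ‖γ‖ := by linarith [hAt c, hAh d]
  have hdle : ‖d‖ ≤ b⁻¹ * ‖γ‖ := by
    rw [inv_mul_eq_div, le_div_iff₀ hb]
    rcases (norm_nonneg d).eq_or_lt with h0 | h0
    · rw [← h0, zero_mul]; exact norm_nonneg _
    · have h4 : 0 ≤ a * ‖c‖ ^ 2 := by positivity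
      refine le_of_mul_le_mul_left ?_ h0
      nlinarith
  have hK0 : 0 ≤ K := by
    have h4 := hK (EuclideanSpace.single 0 1)
    have h5 : ‖(EuclideanSpace.single 0 1 : C3)‖ = 1 := by simp
    rw [h5, mul_one] at h4
    exact (norm_nonneg _).trans h4
  refine ⟨hdle, ?_, ?_⟩
  · refine abs_le_of_sq_le_sq' ?_ (by positivity) |>.2
    rw [mul_pow, Real.sq_sqrt (by positivity), mul_assoc, inv_mul_eq_div, le_div_iff₀ ha]
    have h4 : 0 ≤ b * ‖d‖ ^ 2 := by positivity
    have h5 : ‖d‖ * ‖γ‖ ≤ b⁻¹ * ‖γ‖ * ‖γ‖ := by gcongr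
    nlinarith
  -- Since `c` is orthogonal to `θ`, the pairing `⟨At c, c⟩` gains a factor `‖θ‖` when bounded
  -- through `iθ × At c`, and the equation expresses this vector by `γ` and `Ah d`. Coercivity of
  -- `At` bounds the pairing from below.
  · have horth : inner ℂ (iVec θ) c = 0 := by
      have h4 := crossI_iVec_smul 1 θ
      rw [one_smul] at h4
      rw [hc, ← inner_crossI, h4, inner_zero_left]
    have h4 := norm_inner_le_crossI horth (cact At c)
    have h5 : a * ‖c‖ ^ 2 ≤ ‖inner ℂ (cact At c) c‖ := by
      rw [norm_inner_symm]
      exact (hAt c).trans (Complex.re_le_norm _)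
    have h6 : cact (crossI θ) (cact At c) = -γ - cact Ah d := by rw [← hd]; abel
    have h7 : ‖cact (crossI θ) (cact At c)‖ ≤ ‖γ‖ + K * (b⁻¹ * ‖γ‖) := by
      rw [h6]
      refine (norm_sub_le _ _).trans ?_
      rw [norm_neg]
      have := hK d
      gcongr
      exact this.trans (by gcongr)
    rw [mul_assoc, inv_mul_eq_div, le_div_iff₀ ha]
    rcases (norm_nonneg c).eq_or_lt with h0 | h0
    · rw [← h0, mul_zero, zero_mul]; positivity
    · refine le_of_mul_le_mul_right ?_ h0
      calc ‖θ‖ * ‖c‖ * a * ‖c‖ = ‖θ‖ * (a * ‖c‖ ^ 2) := by ring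
        _ ≤ ‖θ‖ * ‖inner ℂ (cact At c) c‖ := by gcongr
        _ ≤ ‖cact (crossI θ) (cact At c)‖ * ‖c‖ := h4
        _ ≤ (‖γ‖ + K * (b⁻¹ * ‖γ‖)) * ‖c‖ := by gcongr
        _ = (1 + K * b⁻¹) * ‖γ‖ * ‖c‖ := by ring

/-! ### Bounds for the homogenised matrices -/

section

variable {ν : Measure R3} [IsProbabilityMeasure ν]

lemma norm_le_norm_add_constOp {x : Lp C3 2 ν} {ζ : C3} (h : inner ℂ (constOp ν ζ) x = 0) :
    ‖ζ‖ ≤ ‖x + constOp ν ζ‖ := by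
  have h1 := norm_add_sq_eq_norm_sq_add_norm_sq_of_inner_eq_zero _ _ h
  rw [norm_constOp, add_comm] at h1
  nlinarith [norm_nonneg ζ, norm_nonneg x, norm_nonneg (x + constOp ν ζ)]

lemma inner_comb_eq_zero {H : Type*} [NormedAddCommGroup H] [InnerProductSpace ℂ H]
    {F : Fin 3 → H} {x : H} (h : ∀ j, inner ℂ (F j) x = 0) (ζ : C3) : inner ℂ (comb F ζ) x = 0 := by
  rw [comb, sum_inner]
  exact Finset.sum_eq_zero fun j _ => by rw [inner_smul_left, h, mul_zero]

lemma inner_comb_right_eq_zero {H : Type*} [NormedAddCommGroup H] [InnerProductSpace ℂ H]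
    {F : Fin 3 → H} {x : H} (h : ∀ j, inner ℂ x (F j) = 0) (ζ : C3) : inner ℂ x (comb F ζ) = 0 := by
  rw [comb, inner_sum]
  exact Finset.sum_eq_zero fun j _ => by rw [inner_smul_right, h, mul_zero]

lemma norm_comb_le {H : Type*} [NormedAddCommGroup H] [NormedSpace ℂ H]
    (F : Fin 3 → H) (ζ : C3) : ‖comb F ζ‖ ≤ (∑ j, ‖F j‖) * ‖ζ‖ := by
  rw [Finset.sum_mul]
  refine (norm_sum_le _ _).trans (Finset.sum_le_sum fun j _ => ?_)
  rw [norm_smul, mul_comm]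
  gcongr
  exact PiLp.norm_apply_le ζ j

lemma comb_mem {H H' : Type*} [AddCommGroup H] [Module ℂ H] [AddCommGroup H'] [Module ℂ H']
    {S : Submodule ℂ (H × H')} {F : Fin 3 → H} {F' : Fin 3 → H'} (h : ∀ j, (F j, F' j) ∈ S)
    (ζ : C3) : (comb F ζ, comb F' ζ) ∈ S := by
  have h1 : (comb F ζ, comb F' ζ) = ∑ j, ζ j • (F j, F' j) := by
    simp [comb, Fin.sum_univ_three]
  rw [h1]
  exact S.sum_mem fun j _ => S.smul_mem _ (h j)

lemma comb_add_constOp (F : Fin 3 → Lp C3 2 ν) (ζ : C3) :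
    comb F ζ + constOp ν ζ = comb (fun j => F j + constOp ν (EuclideanSpace.single j 1)) ζ := by
  rw [comb_add]
  congr 1
  conv_lhs => rw [← comb_single ζ]
  exact map_comb (constOp ν).toLinearMap _ ζ

lemma inner_map_comb_eq_zero {F : Fin 3 → Lp C3 2 ν} {T : Lp C3 2 ν →L[ℂ] Lp C3 2 ν}
    {x : Lp C3 2 ν}
    (h : ∀ j, inner ℂ x (T (F j + constOp ν (EuclideanSpace.single j 1))) = 0) (ζ : C3) :
    inner ℂ x (T (comb F ζ + constOp ν ζ)) = 0 := by
  rw [comb_add_constOp]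
  have h1 := map_comb T.toLinearMap
    (fun j => F j + constOp ν (EuclideanSpace.single j 1)) ζ
  have h2 := inner_comb_right_eq_zero h ζ
  rw [← h2]
  exact congrArg _ h1

/-- Coercivity of a homogenised matrix and bounds for its corrector. -/
lemma hom_bounds {L : R3 → C3 →ₗ[ℂ] C3} (hL : BddFamily L) {a b : ℝ} (ha : 0 < a)
    (hlow : ∀ y v, a * ‖v‖ ^ 2 ≤ (inner ℂ v (L y v)).re) (hup : ∀ y v, ‖L y v‖ ≤ b * ‖v‖)
    {F : Fin 3 → Lp C3 2 ν} (h0 : ∀ j ζ, inner ℂ (constOp ν ζ) (F j) = 0)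
    (hF : ∀ i j, inner ℂ (F i)
      (mulOp ν hL (F j + constOp ν (EuclideanSpace.single j 1))) = 0)
    {M : Matrix (Fin 3) (Fin 3) ℂ} (hM : ∀ ξ ζ, inner ℂ ξ (cact M ζ) =
      inner ℂ (constOp ν ξ) (mulOp ν hL (comb F ζ + constOp ν ζ))) :
    (∀ ζ, a * ‖ζ‖ ^ 2 ≤ (inner ℂ ζ (cact M ζ)).re) ∧
    (∀ ζ, ‖comb F ζ + constOp ν ζ‖ ≤ a⁻¹ * b * ‖ζ‖) ∧
    (∀ ζ, ‖cact M ζ‖ ≤ b * (a⁻¹ * b) * ‖ζ‖) := by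
  have horth : ∀ ζ, inner ℂ (constOp ν ζ) (comb F ζ) = 0 := fun ζ =>
    inner_comb_right_eq_zero (fun j => h0 j ζ) ζ
  -- The corrector is orthogonal to the flux, so the form of `M` at `ζ` is the full energy of the
  -- corrected field, which by Pythagoras is at least as long as `ζ`.
  have hself : ∀ ζ, a * ‖comb F ζ + constOp ν ζ‖ ^ 2 ≤ (inner ℂ ζ (cact M ζ)).re := by
    intro ζ
    have h1 := mulOp_lower hL hlow (comb F ζ + constOp ν ζ)
    have h2 : inner ℂ (comb F ζ) (mulOp ν hL (comb F ζ + constOp ν ζ)) = 0 :=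
      inner_comb_eq_zero (fun i => inner_map_comb_eq_zero (hF i) ζ) ζ
    rwa [inner_add_left, h2, zero_add, ← hM] at h1
  have hb : 0 ≤ b := by
    have h4 := hup 0 (EuclideanSpace.single 0 1)
    have h5 : ‖(EuclideanSpace.single 0 1 : C3)‖ = 1 := by simp
    rw [h5, mul_one] at h4
    exact (norm_nonneg _).trans h4
  have hMle : ∀ ζ, ‖cact M ζ‖ ≤ b * ‖comb F ζ + constOp ν ζ‖ := by
    intro ζ
    set m := cact M ζ with hm
    have h1 : ‖m‖ ^ 2 ≤ ‖m‖ * (b * ‖comb F ζ + constOp ν ζ‖) := by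
      have h2 : ‖m‖ ^ 2 = (inner ℂ m m).re := by
        rw [← RCLike.re_eq_complex_re, inner_self_eq_norm_sq]
      rw [h2]
      conv_lhs => rw [hm, ← hm, hM]
      refine (re_inner_le_norm (𝕜 := ℂ) _ _).trans ?_
      rw [norm_constOp]
      gcongr
      exact norm_mulOp_le hL hup _
    rcases (norm_nonneg m).eq_or_lt with h3 | h3
    · rw [← h3]; positivity
    · exact le_of_mul_le_mul_left (by rwa [← pow_two]) h3
  have hE : ∀ ζ, ‖comb F ζ + constOp ν ζ‖ ≤ a⁻¹ * b * ‖ζ‖ := by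
    intro ζ
    set e := ‖comb F ζ + constOp ν ζ‖ with he
    have h1 : a * e ^ 2 ≤ ‖ζ‖ * (b * e) :=
      (hself ζ).trans ((re_inner_le_norm (𝕜 := ℂ) ζ (cact M ζ)).trans
        (mul_le_mul_of_nonneg_left (hMle ζ) (norm_nonneg _)))
    rw [mul_assoc, inv_mul_eq_div, le_div_iff₀ ha]
    rcases (norm_nonneg (comb F ζ + constOp ν ζ)).eq_or_lt with h3 | h3
    · rw [he, ← h3, zero_mul]; positivity
    · refine le_of_mul_le_mul_right ?_ h3
      nlinarith
  refine ⟨fun ζ => ?_, hE, fun ζ => ?_⟩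
  · refine le_trans ?_ (hself ζ)
    gcongr
    exact norm_le_norm_add_constOp (horth ζ)
  · rw [mul_assoc]
    exact (hMle ζ).trans (by gcongr; exact hE ζ)

/-- The Fourier coefficient of a curl at frequency zero is a cross product with the zero vector. -/
lemma inner_constOp_curl (hν : ZeroMeanDerivatives ν) {f q : Lp C3 2 ν}
    (hfq : (f, q) ∈ curlGraph ν) (a : C3) : inner ℂ (constOp ν a) q = 0 := by
  revert hfq
  refine curlGraph_induction (P := fun _ q => inner ℂ (constOp ν a) q = 0) ?_ ?_
  · refine isClosed_eq ?_ ?_ <;> fun_prop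
  intro u hu
  have h1 := fcoef_curl hν hu 0 0
  have h2 : (0 : R3) + dualPt 0 = (0 : ℝ) • (0 : R3) := by ext i; simp
  rw [crossOp_zero, add_zero, h2, crossI_smul] at h1
  rw [← vmode_zero, inner_vmode, h1]
  simp

/-- The elementary energy estimate. -/
lemma energy_estimate {a b ε g s z K K' : ℝ} (ha : 0 < a) (hb : 0 < b) (hε : 0 < ε) (hg : 0 ≤ g)
    (h : (ε ^ 2)⁻¹ * (a * s ^ 2) + b * z ^ 2 ≤ s * (K * g) + ε * (z * (K' * g))) :
    z ≤ √(a⁻¹ * b⁻¹ * K ^ 2 + b⁻¹ ^ 2 * K' ^ 2) * (ε * g) := by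
  refine abs_le_of_sq_le_sq' ?_ (by positivity) |>.2
  rw [mul_pow, Real.sq_sqrt (by positivity)]
  -- Rescaling absorbs the weight `ε⁻²` and turns the source paired with `s` into one of size `εg`.
  obtain ⟨x, rfl⟩ : ∃ x, s = ε * x := ⟨s / ε, by field_simp⟩
  have h1 : (ε ^ 2)⁻¹ * (a * (ε * x) ^ 2) = a * x ^ 2 := by field_simp
  rw [h1] at h
  have h2 : (a⁻¹ * b⁻¹ * K ^ 2 + b⁻¹ ^ 2 * K' ^ 2) * (ε * g) ^ 2 =
      b⁻¹ * (a⁻¹ * (K * (ε * g)) ^ 2 + b⁻¹ * (K' * (ε * g)) ^ 2) := by ring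
  rw [h2, inv_mul_eq_div, le_div_iff₀ hb]
  -- Young's inequality may consume all of `a x²`, but only half of `b z²`, because `z` is to be
  -- estimated.
  have h3 : x * (K * (ε * g)) ≤ a * x ^ 2 + a⁻¹ * (K * (ε * g)) ^ 2 / 2 := by
    have h4 : 0 ≤ a⁻¹ * (a * x - K * (ε * g) / 2) ^ 2 := by positivity
    have h5 : a⁻¹ * (a * x - K * (ε * g) / 2) ^ 2 =
        a * x ^ 2 - x * (K * (ε * g)) + a⁻¹ * (K * (ε * g)) ^ 2 / 4 := by field_simp; ring
    have h6 : 0 ≤ a⁻¹ * (K * (ε * g)) ^ 2 := by positivity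
    linarith
  have h3' : z * (K' * (ε * g)) ≤ b * z ^ 2 / 2 + b⁻¹ * (K' * (ε * g)) ^ 2 / 2 := by
    have h4 : 0 ≤ b⁻¹ * (b * z - K' * (ε * g)) ^ 2 := by positivity
    have h5 : b⁻¹ * (b * z - K' * (ε * g)) ^ 2 =
        b * z ^ 2 - 2 * (z * (K' * (ε * g))) + b⁻¹ * (K' * (ε * g)) ^ 2 := by field_simp; ring
    linarith
  nlinarith

end

/-! ### The error estimate -/

section

variable {ν : Measure R3} [IsProbabilityMeasure ν] {A At : R3 → Matrix (Fin 3) (Fin 3) ℝ}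
  {α β αt βt : ℝ}

/-- The residual of the two-term expansion, paired with a test field. -/
lemma residual_identity (h : Elliptic A α β) (ht : Elliptic At αt βt)
    {n w₀ gt : Fin 3 → Lp C3 2 ν} (hn : ∀ j, (n j, w₀ j) ∈ curlGraph ν)
    (hw : ∀ j f q, (f, q) ∈ curlGraph ν → inner ℂ q
      (mulOp ν ht.bdd (w₀ j + constOp ν (EuclideanSpace.single j 1))) = 0)
    {ε : ℝ} {θ : R3} (hε : 0 < ε)
    (hgc : ∀ j, (gt j, -crossOp ν (ε • θ) (gt j)) ∈ curlGraph ν) {V Dw G : Lp C3 2 ν}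
    (hV : (V, Dw - crossOp ν (ε • θ) V) ∈ curlGraph ν)
    (hmax : ∀ f q, (f, q) ∈ curlGraph ν →
      ((ε ^ 2 : ℝ) : ℂ)⁻¹ * inner ℂ (q + crossOp ν (ε • θ) f) (mulOp ν ht.bdd Dw)
        + inner ℂ f (mulOp ν h.bdd_inv V) = -inner ℂ f G) (d : C3) :
    ∃ Z q s : Lp C3 2 ν, (Z, q) ∈ curlGraph ν ∧ s = q + crossOp ν (ε • θ) Z ∧
      V - (comb gt d + constOp ν d) = Z + (ε : ℂ) • comb n (cact (crossI θ) d) ∧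
      ((ε ^ 2 : ℝ) : ℂ)⁻¹ * inner ℂ s (mulOp ν ht.bdd s) + inner ℂ Z (mulOp ν h.bdd_inv Z) =
        -inner ℂ Z (G + mulOp ν h.bdd_inv (comb gt d + constOp ν d) + crossOp ν θ (mulOp ν ht.bdd
          (comb w₀ (cact (crossI θ) d) + constOp ν (cact (crossI θ) d)))) -
        inner ℂ s (mulOp ν ht.bdd (crossOp ν θ (comb n (cact (crossI θ) d)))) -
        ε * inner ℂ Z (mulOp ν h.bdd_inv (comb n (cact (crossI θ) d))) := by
  set c := cact (crossI θ) d with hc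
  set E₁ := comb n c with hE₁
  set F := comb w₀ c + constOp ν c with hF
  set E₀ := comb gt d + constOp ν d with hE₀
  have hXgt : comb (fun j => -crossOp ν (ε • θ) (gt j)) d = -crossOp ν (ε • θ) (comb gt d) :=
    (map_comb (-(crossOp ν (ε • θ)).toLinearMap) gt d).symm
  -- The ansatz lies in the graph: the gradient part has curl `-iκ×` of itself, the constant `d` has
  -- none, and `εE₁` contributes the curl of the cell solution.
  have hU : (E₀ + (ε : ℂ) • E₁, -crossOp ν (ε • θ) (comb gt d) + (ε : ℂ) • comb w₀ c) ∈
      curlGraph ν := by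
    have h1 := (curlGraph ν).add_mem ((curlGraph ν).add_mem (comb_mem hgc d) (const_mem_curlGraph d))
      ((curlGraph ν).smul_mem (ε : ℂ) (comb_mem hn c))
    rw [hXgt] at h1
    simpa using h1
  have hZ := (curlGraph ν).sub_mem hV hU
  rw [Prod.mk_sub_mk] at hZ
  set Z := V - (E₀ + (ε : ℂ) • E₁) with hZdef
  set q := Dw - crossOp ν (ε • θ) V - (-crossOp ν (ε • θ) (comb gt d) + (ε : ℂ) • comb w₀ c)
    with hq
  have hVZ : V = Z + E₀ + (ε : ℂ) • E₁ := by rw [hZdef]; abel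
  refine ⟨Z, q, _, hZ, rfl, by rw [hVZ]; abel, ?_⟩
  set s := q + crossOp ν (ε • θ) Z with hs
  have hDw : Dw = s + (ε : ℂ) • F + ((ε ^ 2 : ℝ) : ℂ) • crossOp ν θ E₁ := by
    have h1 : crossOp ν (ε • θ) (constOp ν d) = (ε : ℂ) • constOp ν c := by
      rw [crossOp_smul, crossOp_constOp]
    have h2 : crossOp ν (ε • θ) ((ε : ℂ) • E₁) = ((ε ^ 2 : ℝ) : ℂ) • crossOp ν θ E₁ := by
      rw [crossOp_smul, map_smul, smul_smul]
      push_cast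
      rw [pow_two]
    rw [hs, hq, hZdef, map_sub, map_add, h2, hE₀, map_add, h1, hF, smul_add]
    abel
  have key := hmax Z q hZ
  have hqF : inner ℂ q (mulOp ν ht.bdd F) = 0 := inner_map_comb_eq_zero (fun j => hw j Z q hZ) c
  -- The flux of `F` annihilates `q`, so only the part `iκ × Z` of `s` pairs with it. The factor `ε`
  -- in `κ = εθ` lowers the `ε⁻¹` term to order one, where it joins the residual.
  have hsF : inner ℂ s (mulOp ν ht.bdd F) = ε * inner ℂ Z (crossOp ν θ (mulOp ν ht.bdd F)) := by
    rw [hs, inner_add_left, hqF, zero_add, inner_crossOp, crossOp_smul, inner_smul_right]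
  have hε' : (ε : ℂ) ≠ 0 := by exact_mod_cast hε.ne'
  rw [← hs, hDw, hVZ] at key
  simp only [map_add, map_smul, inner_add_right, inner_smul_right, hsF] at key ⊢
  push_cast at key ⊢
  field_simp at key ⊢
  linear_combination key

/-- Each summand is orthogonal by itself: `G` by its constraint, the second by the cell problem for
`Ψ`, and the third because `iκ×` of a shifted gradient is minus its curl, which the flux of the curl
cell problem annihilates; division by `ε` passes from `κ` to `θ`. -/
lemma residual_solenoidal (h : Elliptic A α β) (ht : Elliptic At αt βt)
    {w₀ gt : Fin 3 → Lp C3 2 ν}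
    (hw : ∀ j f q, (f, q) ∈ curlGraph ν → inner ℂ q
      (mulOp ν ht.bdd (w₀ j + constOp ν (EuclideanSpace.single j 1))) = 0)
    {ε : ℝ} {θ : R3} (hε : 0 < ε) {G : Lp C3 2 ν} {φ : R3 → ℂ} (hφ : SmoothPeriodic φ)
    (hg : ∀ j, inner ℂ ((hφ.sgrad (ε • θ)).toL2 ν)
      (mulOp ν h.bdd_inv (gt j + constOp ν (EuclideanSpace.single j 1))) = 0)
    (hG : inner ℂ ((hφ.sgrad (ε • θ)).toL2 ν) G = 0) (c d : C3) :
    inner ℂ ((hφ.sgrad (ε • θ)).toL2 ν) (G + mulOp ν h.bdd_inv (comb gt d + constOp ν d) +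
      crossOp ν θ (mulOp ν ht.bdd (comb w₀ c + constOp ν c))) = 0 := by
  rw [inner_add_right, inner_add_right, hG, inner_map_comb_eq_zero hg, zero_add, zero_add,
    ← inner_crossOp]
  have h1 : inner ℂ (-crossOp ν (ε • θ) ((hφ.sgrad (ε • θ)).toL2 ν))
      (mulOp ν ht.bdd (comb w₀ c + constOp ν c)) = 0 :=
    inner_map_comb_eq_zero (fun j => hw j _ _ (sgrad_mem_curlGraph hφ)) c
  rw [crossOp_smul, inner_neg_left, inner_smul_left, neg_eq_zero] at h1
  refine (mul_eq_zero.1 h1).resolve_left ?_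
  simpa using hε.ne'

/-- Pairing with constants replaces the three summands by `∫ G`, `Ah d` and `iθ × Ati (iθ × d)`.
Their sum vanishes by the effective equation, and this dictates the choice of `d`. -/
lemma residual_zero_mean (h : Elliptic A α β) (ht : Elliptic At αt βt)
    {w₀ gt : Fin 3 → Lp C3 2 ν} {Ah Ati : Matrix (Fin 3) (Fin 3) ℂ}
    (hAh : ∀ ξ ζ, inner ℂ ξ (cact Ah ζ) =
      inner ℂ (constOp ν ξ) (mulOp ν h.bdd_inv (comb gt ζ + constOp ν ζ)))
    (hAti : ∀ ξ ζ, inner ℂ ξ (cact Ati ζ) =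
      inner ℂ (constOp ν ξ) (mulOp ν ht.bdd (comb w₀ ζ + constOp ν ζ)))
    {θ : R3} {G : Lp C3 2 ν} {d : C3}
    (hd : cact (crossI θ) (cact Ati (cact (crossI θ) d)) + cact Ah d = -∫ y, G y ∂ν) (a : C3) :
    inner ℂ (constOp ν a) (G + mulOp ν h.bdd_inv (comb gt d + constOp ν d) +
      crossOp ν θ (mulOp ν ht.bdd
        (comb w₀ (cact (crossI θ) d) + constOp ν (cact (crossI θ) d)))) = 0 := by
  rw [inner_add_right, inner_add_right, inner_constOp, ← hAh, ← inner_crossOp, crossOp_constOp,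
    ← hAti, inner_crossI, ← inner_add_right, ← inner_add_right, add_assoc,
    add_comm (cact Ah d), hd, add_neg_cancel, inner_zero_right]

omit [IsProbabilityMeasure ν] in
/-- The energy estimate for the remainder of the expansion. -/
lemma norm_le_of_residual (h : Elliptic A α β) (ht : Elliptic At αt βt) {ε : ℝ} (hε : 0 < ε)
    {Z s R B E : Lp C3 2 ν} (hid : ((ε ^ 2 : ℝ) : ℂ)⁻¹ * inner ℂ s (mulOp ν ht.bdd s) +
      inner ℂ Z (mulOp ν h.bdd_inv Z) = -inner ℂ Z R - inner ℂ s B - ε * inner ℂ Z E)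
    {K₁ K₂ K' g : ℝ} (hg : 0 ≤ g) (hR : ‖inner ℂ Z R‖ ≤ ‖s‖ * (K₁ * g)) (hB : ‖inner ℂ s B‖ ≤ ‖s‖ * (K₂ * g))
    (hE : ‖inner ℂ Z E‖ ≤ ‖Z‖ * (K' * g)) :
    ‖Z‖ ≤ √(αt⁻¹ * β⁻¹⁻¹ * (K₁ + K₂) ^ 2 + β⁻¹⁻¹ ^ 2 * K' ^ 2) * (ε * g) := by
  -- The lower ellipticity constant of `A⁻¹` is `β⁻¹`; this is the origin of `β⁻¹⁻¹` in the
  -- constants.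
  refine energy_estimate ht.pos (inv_pos.2 h.pos') hε hg (s := ‖s‖) ?_
  have e1 := mulOp_lower ht.bdd ht.lower s
  have e2 := mulOp_lower h.bdd_inv h.inv_lower Z
  have e3 := congrArg Complex.re hid
  rw [← Complex.ofReal_inv, Complex.add_re, Complex.re_ofReal_mul, Complex.sub_re, Complex.sub_re,
    Complex.neg_re, Complex.re_ofReal_mul] at e3
  have e4 := mul_le_mul_of_nonneg_left e1 (inv_nonneg.2 (sq_nonneg ε))
  have e5 := ((neg_le_abs _).trans (Complex.abs_re_le_norm _)).trans hR
  have e6 := ((neg_le_abs _).trans (Complex.abs_re_le_norm _)).trans hB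
  have e7 := mul_le_mul_of_nonneg_left
    (((neg_le_abs _).trans (Complex.abs_re_le_norm _)).trans hE) hε.le
  have e8 : ‖s‖ * ((K₁ + K₂) * g) = ‖s‖ * (K₁ * g) + ‖s‖ * (K₂ * g) := by ring
  rw [e8]
  linarith

omit [IsProbabilityMeasure ν] in
-- The factor `‖θ‖` is kept next to `y`, the size of `iθ × d` in the application, because only their
-- product is bounded uniformly.
lemma norm_residual_le (h : Elliptic A α β) (ht : Elliptic At αt βt) {u v : Lp C3 2 ν}
    {k l x y : ℝ} (hu : ‖u‖ ≤ k * x) (hv : ‖v‖ ≤ l * y) (θ : R3) (G : Lp C3 2 ν) :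
    ‖G + mulOp ν h.bdd_inv u + crossOp ν θ (mulOp ν ht.bdd v)‖ ≤
      ‖G‖ + α⁻¹ * (k * x) + βt * l * (‖θ‖ * y) := by
  have hα := h.pos
  have hβt := ht.pos'
  refine norm_add₃_le.trans (add_le_add (add_le_add le_rfl ?_) ?_)
  · exact (norm_mulOp_le h.bdd_inv h.norm_act_inv_le _).trans (by gcongr)
  · calc _ ≤ ‖θ‖ * (βt * (l * y)) := by
          refine (norm_crossOp_le θ _).trans ?_
          gcongr
          exact (norm_mulOp_le ht.bdd ht.norm_act_le _).trans (by gcongr)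
      _ = _ := by ring

lemma norm_integral_le (G : Lp C3 2 ν) : ‖∫ y, G y ∂ν‖ ≤ ‖G‖ := by
  set γ := ∫ y, G y ∂ν with hγ
  have h1 : ‖γ‖ ^ 2 ≤ ‖γ‖ * ‖G‖ := by
    have h2 : ‖γ‖ ^ 2 = (inner ℂ (constOp ν γ) G).re := by
      rw [inner_constOp, ← hγ, ← RCLike.re_eq_complex_re, inner_self_eq_norm_sq]
    rw [h2]
    refine (re_inner_le_norm (𝕜 := ℂ) _ _).trans ?_
    rw [norm_constOp]
  rcases (norm_nonneg γ).eq_or_lt with h3 | h3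
  · rw [← h3]; positivity
  · exact le_of_mul_le_mul_left (by rwa [← pow_two]) h3

set_option maxHeartbeats 800000 in
/-- The error estimate, in terms of `L²` operators. -/
theorem exists_error_estimate (hν : ZeroMeanDerivatives ν) (h : Elliptic A α β)
    (ht : Elliptic At αt βt) {n w₀ : Fin 3 → Lp C3 2 ν} (hn : ∀ j, (n j, w₀ j) ∈ curlGraph ν)
    (hw : ∀ j f q, (f, q) ∈ curlGraph ν → inner ℂ q
      (mulOp ν ht.bdd (w₀ j + constOp ν (EuclideanSpace.single j 1))) = 0)
    {Ati : Matrix (Fin 3) (Fin 3) ℂ} (hAti : ∀ ξ ζ, inner ℂ ξ (cact Ati ζ) =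
      inner ℂ (constOp ν ξ) (mulOp ν ht.bdd (comb w₀ ζ + constOp ν ζ))) :
    ∃ C : ℝ, 0 < C ∧ ∀ (ε : ℝ) (θ : R3), 0 < ε → ε • θ ∈ dualCell →
      ∀ gt : Fin 3 → Lp C3 2 ν,
      (∀ j, (gt j, -crossOp ν (ε • θ) (gt j)) ∈ curlGraph ν) →
      (∀ j a, inner ℂ (constOp ν a) (gt j) = 0) →
      (∀ i j, inner ℂ (gt i)
        (mulOp ν h.bdd_inv (gt j + constOp ν (EuclideanSpace.single j 1))) = 0) →
      (∀ (φ : R3 → ℂ) (hφ : SmoothPeriodic φ), ∫ y, φ y ∂ν = 0 → ∀ j,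
        inner ℂ ((hφ.sgrad (ε • θ)).toL2 ν)
          (mulOp ν h.bdd_inv (gt j + constOp ν (EuclideanSpace.single j 1))) = 0) →
      ∀ Ah : Matrix (Fin 3) (Fin 3) ℂ, (∀ ξ ζ, inner ℂ ξ (cact Ah ζ) =
        inner ℂ (constOp ν ξ) (mulOp ν h.bdd_inv (comb gt ζ + constOp ν ζ))) →
      IsUnit Ah ∧ IsUnit (effective θ Ah Ati) ∧ ∀ V Dw G : Lp C3 2 ν,
        (V, Dw - crossOp ν (ε • θ) V) ∈ curlGraph ν →
        (∀ (φ : R3 → ℂ) (hφ : SmoothPeriodic φ), inner ℂ ((hφ.sgrad (ε • θ)).toL2 ν) G = 0) →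
        (∀ f q, (f, q) ∈ curlGraph ν →
          ((ε ^ 2 : ℝ) : ℂ)⁻¹ * inner ℂ (q + crossOp ν (ε • θ) f) (mulOp ν ht.bdd Dw)
            + inner ℂ f (mulOp ν h.bdd_inv V) = -inner ℂ f G) →
        ∀ d : C3, d = WithLp.toLp 2
          (-((Ah⁻¹ * (effective θ Ah Ati)⁻¹).mulVec (∫ y, G y ∂ν).ofLp)) →
        ‖V - (comb gt d + constOp ν d)‖ ≤ C * ε * ‖G‖ := by
  have hα := h.pos
  have hβ := h.pos'
  have hαt := ht.pos
  have hβt := ht.pos'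
  obtain ⟨hlt, hEt, -⟩ := hom_bounds ht.bdd hαt ht.lower ht.norm_act_le
    (fun j ζ => inner_constOp_curl hν (hn j) ζ) (fun i j => hw j _ _ (hn i)) hAti
  set CN := ∑ j, ‖n j‖ with hCN
  have hCN0 : 0 ≤ CN := by positivity
  -- `K₀` bounds the corrected field `E₀` by `‖d‖`; `Kc`, `Kt` and `KR` bound `‖c‖`, `‖θ‖‖c‖` and
  -- the residual by `‖G‖`; `K` and `K'` collect the sources paired with `s` and with `Z`.
  set K₀ := β⁻¹⁻¹ * α⁻¹ with hK₀
  set Kt := αt⁻¹ * (1 + α⁻¹ * K₀ * β⁻¹⁻¹) with hKt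
  set Kc := √(αt⁻¹ * β⁻¹⁻¹) with hKc
  set KR := 1 + α⁻¹ * (K₀ * β⁻¹⁻¹) + βt * (αt⁻¹ * βt) * Kt with hKR
  set K := KR + βt * (CN * Kt) with hK
  set K' := α⁻¹ * (CN * Kc) with hK'
  set C₀ := √(αt⁻¹ * β⁻¹⁻¹ * K ^ 2 + β⁻¹⁻¹ ^ 2 * K' ^ 2) with hC₀
  have hKc0 : 0 ≤ Kc := by positivity
  have hK₀0 : 0 ≤ K₀ := by positivity
  have hKt0 : 0 ≤ Kt := by positivity
  clear_value CN C₀ K K' KR Kt Kc K₀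
  -- `C₀` accounts for `Z`, `CN * Kc` for the corrector `εE₁`, absent from the final approximation,
  -- and `1` ensures strict positivity.
  refine ⟨C₀ + CN * Kc + 1, by rw [hC₀]; positivity, ?_⟩
  intro ε θ hε hθ gt hgc hg0 hgg hg Ah hAh
  obtain ⟨hlow, hE, hup⟩ := hom_bounds h.bdd_inv (inv_pos.2 hβ) h.inv_lower h.norm_act_inv_le
    hg0 hgg hAh
  have hu := isUnit_of_coercive (inv_pos.2 hβ) hlow
  have hM := isUnit_effective (θ := θ) hαt (inv_pos.2 hβ) hlow hlt
  refine ⟨hu, hM, ?_⟩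
  intro V Dw G hV hdiv hmax d hd
  have heff := effective_equation hu hM hd
  obtain ⟨b1, b2, b3⟩ := effective_bounds hαt (inv_pos.2 hβ) hlow hup hlt heff
  obtain ⟨Z, q, s, hZ, hs, hdec, hid⟩ := residual_identity h ht hn hw hε hgc hV hmax d
  have hmean := residual_zero_mean h ht hAh hAti heff
  have hsol := fun (φ : R3 → ℂ) (hφ : SmoothPeriodic φ) (h0 : ∫ y, φ y ∂ν = 0) =>
    residual_solenoidal h ht hw hε hφ (hg φ hφ h0) (hdiv φ hφ) (cact (crossI θ) d) d
  set c := cact (crossI θ) d with hc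
  set γ := ∫ y, G y ∂ν with hγ
  set R := G + mulOp ν h.bdd_inv (comb gt d + constOp ν d) +
    crossOp ν θ (mulOp ν ht.bdd (comb w₀ c + constOp ν c)) with hR
  set E₁ := comb n c with hE₁
  clear_value c γ R E₁
  have hγG : ‖γ‖ ≤ ‖G‖ := hγ ▸ norm_integral_le G
  have hd' : ‖d‖ ≤ β⁻¹⁻¹ * ‖G‖ := b1.trans (by gcongr)
  rw [← hKc] at b2
  rw [← hK₀, ← hKt] at b3
  simp only [← hK₀] at hE
  have hc' : ‖c‖ ≤ Kc * ‖G‖ := b2.trans (by gcongr)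
  have hθc : ‖θ‖ * ‖c‖ ≤ Kt * ‖G‖ := b3.trans (by gcongr)
  have hE₁n : ‖E₁‖ ≤ CN * ‖c‖ := by rw [hE₁, hCN]; exact norm_comb_le n c
  have hRn : ‖R‖ ≤ KR * ‖G‖ := by
    rw [hR, hKR]
    refine (norm_residual_le h ht (hE d) (hEt c) θ G).trans ?_
    have r1 : α⁻¹ * (K₀ * ‖d‖) ≤ α⁻¹ * (K₀ * (β⁻¹⁻¹ * ‖G‖)) := by gcongr
    have r2 : βt * (αt⁻¹ * βt) * (‖θ‖ * ‖c‖) ≤ βt * (αt⁻¹ * βt) * (Kt * ‖G‖) := by gcongr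
    linarith
  -- The restriction of `κ` to the dual cell enters here. With `‖s‖` on the right, an order-one
  -- residual costs only `O(ε)` in the energy.
  have hpoin : ‖inner ℂ Z R‖ ≤ ‖s‖ * ‖R‖ := by
    have := norm_inner_le_of_solenoidal hν hθ hmean hsol hZ
    rwa [← hs] at this
  have hBE : ‖inner ℂ s (mulOp ν ht.bdd (crossOp ν θ E₁))‖ ≤ ‖s‖ * (βt * (CN * Kt) * ‖G‖) := by
    refine (norm_inner_le_norm _ _).trans ?_
    refine mul_le_mul_of_nonneg_left ?_ (norm_nonneg s)
    calc _ ≤ βt * (‖θ‖ * (CN * ‖c‖)) :=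
          (norm_mulOp_le ht.bdd ht.norm_act_le _).trans (mul_le_mul_of_nonneg_left
            ((norm_crossOp_le θ _).trans (mul_le_mul_of_nonneg_left hE₁n (norm_nonneg θ))) hβt.le)
      _ = βt * CN * (‖θ‖ * ‖c‖) := by ring
      _ ≤ βt * CN * (Kt * ‖G‖) := by gcongr
      _ = _ := by ring
  have hAE : ‖inner ℂ Z (mulOp ν h.bdd_inv E₁)‖ ≤ ‖Z‖ * (K' * ‖G‖) := by
    refine (norm_inner_le_norm _ _).trans ?_
    refine mul_le_mul_of_nonneg_left ?_ (norm_nonneg Z)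
    refine (norm_mulOp_le h.bdd_inv h.norm_act_inv_le _).trans ?_
    rw [hK', mul_assoc, mul_assoc]
    exact mul_le_mul_of_nonneg_left (hE₁n.trans (by gcongr)) (inv_nonneg.2 hα.le)
  have hZn := norm_le_of_residual h ht hε hid (norm_nonneg G) (hpoin.trans (by gcongr)) hBE hAE
  rw [← hK, ← hC₀] at hZn
  rw [hdec]
  refine (norm_add_le _ _).trans ?_
  have h1 : ‖(ε : ℂ) • E₁‖ ≤ ε * (CN * (Kc * ‖G‖)) := by
    rw [norm_smul, Complex.norm_real, Real.norm_of_nonneg hε.le]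
    gcongr
    exact hE₁n.trans (by gcongr)
  have h2 : 0 ≤ ε * ‖G‖ := by positivity
  nlinarith

omit [IsProbabilityMeasure ν] in
lemma coeFn_comb (F : Fin 3 → Lp C3 2 ν) (d : C3) :
    (comb F d : Lp C3 2 ν) =ᵐ[ν] fun y => ∑ j, d j • F j y := by
  simp only [comb, Fin.sum_univ_three]
  filter_upwards [Lp.coeFn_add (d 0 • F 0 + d 1 • F 1) (d 2 • F 2),
    Lp.coeFn_add (d 0 • F 0) (d 1 • F 1), Lp.coeFn_smul (d 0) (F 0), Lp.coeFn_smul (d 1) (F 1),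
    Lp.coeFn_smul (d 2) (F 2)] with y h1 h2 h3 h4 h5
  rw [h1, Pi.add_apply, h2, Pi.add_apply, h3, h4, h5]
  rfl

omit [IsProbabilityMeasure ν] in
lemma coeFn_comb_conjExpOp (κ : R3) {g : Fin 3 → R3 → C3} (hg : ∀ j, MemLp (g j) 2 ν) (d : C3) :
    (comb (fun j => conjExpOp ν κ ((hg j).toLp (g j))) d : Lp C3 2 ν) =ᵐ[ν]
      fun y => starRingEnd ℂ (expo κ y) • ∑ j, d j • g j y := by
  filter_upwards [coeFn_comb (fun j => conjExpOp ν κ ((hg j).toLp (g j))) d,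
    ae_all_iff.2 fun j => coeFn_conjExpOp κ ((hg j).toLp (g j)),
    ae_all_iff.2 fun j => (hg j).coeFn_toLp] with y h1 h2 h3
  rw [h1, Finset.smul_sum]
  refine Finset.sum_congr rfl fun j _ => ?_
  rw [h2 j, h3 j, smul_comm]

end

end PerMaxwell

/-! ### The main theorem -/

open PerMaxwell in
theorem mainTheorem11
    (μ : MeasureTheory.Measure PerMaxwell.R3) (hμ : PerMaxwell.IsAdmissible μ)
    (A At : PerMaxwell.R3 → Matrix (Fin 3) (Fin 3) ℝ)
    (hA : PerMaxwell.IsCoefficient A) (hAt : PerMaxwell.IsCoefficient At) :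
    ∃ C : ℝ, 0 < C ∧
      ∀ (ε : ℝ) (θ : PerMaxwell.R3), 0 < ε → ε • θ ∈ PerMaxwell.dualCell →
      ∀ (Ψ : Fin 3 → PerMaxwell.R3 → ℂ) (g : Fin 3 → PerMaxwell.R3 → PerMaxwell.C3),
        PerMaxwell.IsPsiSolution μ A (ε • θ) Ψ g →
      ∀ N W : Fin 3 → PerMaxwell.R3 → PerMaxwell.C3,
        PerMaxwell.IsCurlCellSolution μ A At N W →
      IsUnit (PerMaxwell.homHat μ A (ε • θ) g) ∧
      IsUnit (PerMaxwell.effective θ (PerMaxwell.homHat μ A (ε • θ) g)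
        (PerMaxwell.homTilde μ At W)) ∧
      ∀ G D w : PerMaxwell.R3 → PerMaxwell.C3,
        MeasureTheory.MemLp G 2 (μ.restrict PerMaxwell.cell) →
        PerMaxwell.IsDivFree μ (ε • θ) G →
        PerMaxwell.IsMaxwellSolution μ A At ε (ε • θ) G D w →
        ∀ d : PerMaxwell.C3,
        d = PerMaxwell.dVec μ θ (PerMaxwell.homHat μ A (ε • θ) g)
          (PerMaxwell.homTilde μ At W) G →
        MeasureTheory.eLpNorm
          (fun y => PerMaxwell.act (PerMaxwell.msqrt (A y)) (D y)
            - (starRingEnd ℂ (PerMaxwell.expo (ε • θ) y) • (∑ j, d j • g j y) + d)) 2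
          (μ.restrict PerMaxwell.cell)
        ≤ ENNReal.ofReal (C * ε) * MeasureTheory.eLpNorm G 2 (μ.restrict PerMaxwell.cell) := by
  obtain ⟨α, β, h⟩ := hA.exists_elliptic
  obtain ⟨αt, βt, ht⟩ := hAt.exists_elliptic
  have hprob : IsProbabilityMeasure (μ.restrict cell) :=
    ⟨by rw [Measure.restrict_apply_univ, hμ.mass]⟩
  have hν : ZeroMeanDerivatives (μ.restrict cell) := hμ.grad_mean
  -- The constant depends on the norms of a cell solution and must precede the quantifier over `N`,
  -- so a reference solution is fixed first; without one the claim is vacuous.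
  by_cases hex : ∃ N₀ W₀ : Fin 3 → R3 → C3, IsCurlCellSolution μ A At N₀ W₀
  swap
  · exact ⟨1, one_pos, fun ε θ _ _ Ψ g _ N W hNW => absurd ⟨N, W, hNW⟩ hex⟩
  obtain ⟨N₀, W₀, hs₀⟩ := hex
  obtain ⟨C, hC, H⟩ := exists_error_estimate hν h ht (fun j => hs₀.mem_curlGraph h j)
    (fun j f q hfq => hs₀.inner_eq_zero h ht j hfq) (inner_homTilde ht fun j => (hs₀ j).1.2.1)
  refine ⟨C, hC, ?_⟩
  intro ε θ hε hθ Ψ g hΨ N W hNW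
  -- The given solution enters only through its homogenised matrix, which agrees with that of the
  -- reference solution.
  rw [homTilde_eq h ht hNW hs₀]
  have hg : ∀ j, MemLp (g j) 2 (μ.restrict cell) := fun j => (hΨ j).1.2.1
  -- The properties required of the gradient correctors are closed conditions in `L²` that hold for
  -- shifted gradients of smooth zero-mean functions, so they pass to the limit.
  obtain ⟨hu, hM, H⟩ := H ε θ hε hθ
    (fun j => conjExpOp (μ.restrict cell) (ε • θ) ((hg j).toLp (g j)))
    (fun j => (hΨ j).1.mem_closure
      (P := fun f => (f, -crossOp (μ.restrict cell) (ε • θ) f) ∈ curlGraph (μ.restrict cell))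
      ((smoothCurl (μ.restrict cell)).isClosed_topologicalClosure.preimage
        (continuous_id.prodMk (crossOp (μ.restrict cell) (ε • θ)).continuous.neg))
      fun φ hφ _ => sgrad_mem_curlGraph hφ)
    (fun j a => (hΨ j).1.mem_closure
      (P := fun f => inner ℂ (constOp (μ.restrict cell) a) f = 0)
      (isClosed_eq (by fun_prop) continuous_const)
      fun φ hφ h0 => integral_sgrad_eq_zero hν _ hφ h0 a)
    (fun i j => (hΨ i).1.mem_closure
      (P := fun f => inner ℂ f (mulOp (μ.restrict cell) h.bdd_inv
        (conjExpOp (μ.restrict cell) (ε • θ) ((hg j).toLp (g j)) +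
          constOp (μ.restrict cell) (EuclideanSpace.single j 1))) = 0)
      (isClosed_eq (by fun_prop) continuous_const)
      fun φ hφ h0 => hΨ.inner_eq_zero h j hφ h0)
    (fun φ hφ h0 j => hΨ.inner_eq_zero h j hφ h0)
    (homHat μ A (ε • θ) g) (inner_homHat h hg)
  refine ⟨hu, hM, ?_⟩
  intro G D w hG hdiv hsol d hd
  have hint : ∫ y in cell, hG.toLp G y ∂μ = ∫ y in cell, G y ∂μ := integral_congr_ae hG.coeFn_toLp
  have key := H _ _ (hG.toLp G) (hsol.1.mem_curlGraph h)
    (fun φ hφ => hdiv.inner_eq_zero hG hφ)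
    (fun f q hfq => hsol.inner_eq h ht hG hfq) d (by rw [hint]; exact hd)
  have hfun : (mulOp (μ.restrict cell) h.bdd_msqrt (hsol.1.1.toLp D) -
      (comb (fun j => conjExpOp (μ.restrict cell) (ε • θ) ((hg j).toLp (g j))) d +
        constOp (μ.restrict cell) d) : Lp C3 2 (μ.restrict cell)) =ᵐ[μ.restrict cell]
      fun y => act (msqrt (A y)) (D y) -
        (starRingEnd ℂ (expo (ε • θ) y) • (∑ j, d j • g j y) + d) := by
    filter_upwards [Lp.coeFn_sub (mulOp (μ.restrict cell) h.bdd_msqrt (hsol.1.1.toLp D)) _,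
      Lp.coeFn_add _ (constOp (μ.restrict cell) d),
      coeFn_mulOp h.bdd_msqrt (hsol.1.1.toLp D), hsol.1.1.coeFn_toLp,
      coeFn_constOp (ν := μ.restrict cell) d, coeFn_comb_conjExpOp (ε • θ) hg d]
      with y h1 h2 h3 h4 h5 h6
    rw [h1, Pi.sub_apply, h2, Pi.add_apply, h3, h4, h5, h6]
    rfl
  rw [← eLpNorm_congr_ae hfun, ← eLpNorm_congr_ae hG.coeFn_toLp]
  rw [← Lp.enorm_def, ← Lp.enorm_def, ← ofReal_norm, ← ofReal_norm,
    ← ENNReal.ofReal_mul (by positivity)]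
  exact ENNReal.ofReal_le_ofReal key
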